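/- Let $F$ be a non-degenerate ternary quadratic form with integer coefficients, let $\Delta_F\neq 0$ be the determinant of its symmetric matrix, and let $m_0\in\mathbb{Z}\setminus\{0\}$. Let $w:\mathbb{R}^3\to\mathbb{R}$ be infinitely differentiable with compact support. Let $p_0$ be a prime, $L\geqslant 1$ an integer with $p_0\nmid L$, and $\boldsymbol\lambda\in\mathbb{Z}^3$ with $F(\boldsymbol\lambda)\equiv m_0\bmod L$. For $h\in\mathbb{Z}_{\geqslant 0}$ put $N=p_0^{2h}$, $\boldsymbol\lambda_N=p_0^h\boldsymbol\lambda$, $Q=\sqrt N/L$, and write $\mathrm{e}_n(x)=\exp(2\pi i x/n)$, $\mathrm e=\mathrm e_1$. Let $\omega_0(x)=\exp(-1/(1-x^2))$ for $|x|<1$ and $\omega_0(x)=0$ otherwise, $\omega(x)=4\,\omega_0(4x-3)/\int_{\mathbb R}\omega_0$, and for $x>0$, $y\in\mathbb R$ let $$\mathsf h(x,y)=\sum_{j=1}^{\infty}\frac1{xj}\Big(\omega(xj)-\omega\Big(\frac{|y|}{xj}\Big)\Big).$$ For $q\geqslant 1$ and $\boldsymbol c\in\mathbb Z^3$ define $$\widetilde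 S_q(\boldsymbol c)=\sum_{\substack{a\bmod q\\ (a,q)=1}}\ \sum_{\substack{\boldsymbol\sigma\in(\mathbb Z/qL\mathbb Z)^3\\ L^2\mid F(L\boldsymbol\sigma+\boldsymbol\lambda_N)-m_0N}}\mathrm e_{qL}\Big(a\,\frac{F(L\boldsymbol\sigma+\boldsymbol\lambda_N)-m_0N}{L}+\boldsymbol c\cdot\boldsymbol\sigma\Big),$$ $$\widetilde I_q(w;\boldsymbol c)=\int_{\mathbb R^3}w\Big(\frac{L\boldsymbol s+\boldsymbol\lambda_N}{\sqrt N}\Big)\,\mathsf h\Big(\frac qQ,\frac{F(L\boldsymbol s+\boldsymbol\lambda_N)-m_0N}{(LQ)^2}\Big)\mathrm e_{qL}(-\boldsymbol c\cdot\boldsymbol s)\,d\boldsymbol s .$$ Let $\widetilde{\mathcal I}(w)=\int_{\mathbb R}\big(\int_{\mathbb R^3}w(\boldsymbol t)\,\mathrm e(\theta(F(\boldsymbol t)-m_0))\,d\boldsymbol t\big)d\theta$. Let $\psi_0$ be the real Dirichlet character with $\psi_0(n)=0$ for even $n$ and $\psi_0(n)=\left(\frac{-4m_0\Delta_F}{n}\right)$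 (Jacobi symbol; this equals $\left(\frac{-m_0\Delta_F}{n}\right)$ when $\Delta_F$ is an integer) for odd $n$, and let $\mathbb L(1,\psi_0)=\sum_{n\geqslant 1}\psi_0(n)/n$ when $-m_0\Delta_F$ is not a square. For primes $p\neq p_0$ let $$\sigma_p=\lim_{k\to\infty}\frac{\#\{\boldsymbol x\in(\mathbb Z/p^k\mathbb Z)^3: F(\boldsymbol x)\equiv m_0\bmod p^k,\ \boldsymbol x\equiv\boldsymbol\lambda\bmod p^{\mathrm{ord}_p(L)}\}}{p^{2k}},$$ let $$\sigma_{p_0}=\lim_{k\to\infty}\frac{\#\{\boldsymbol x\in(\mathbb Z/p_0^k\mathbb Z)^3: F(\boldsymbol x)\equiv 0\bmod p_0^k\}}{p_0^{2k}},$$ and let $\widetilde{\mathfrak S}_F=\prod_p(1-\frac{\psi(p)}p)\sigma_p$, the product being over all primes including $p_0$, where $\psi(p)=1$ for all $p$ if $-m_0\Delta_F$ is the square of a rational number and $\psi=\psi_0$ otherwise. Then all the limits, the infinite product, the outer integral in $\widetilde{\mathcal I}(w)$, the series $\mathbb L(1,\psi_0)$ (when $-m_0\Delta_F$ is not a square)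 and the sum over $q$ below converge, and for every $\varepsilon>0$ and all $h\geqslant 0$: - if $-m_0\Delta_F$ is a square, there is a constant $a_0\in\mathbb C$, independent of $h$ and $\varepsilon$, with $$\sum_{q=1}^\infty\frac{\widetilde S_q(\boldsymbol 0)\widetilde I_q(w;\boldsymbol 0)}{(qL)^3}=\Big(\frac{\sqrt N}{L^2}\Big)^3\Big(\widetilde{\mathcal I}(w)L^4\,\widetilde{\mathfrak S}_F\log\sqrt N+a_0\Big)+O_\varepsilon\big(N^{\frac54+\varepsilon}\big);$$ - if $-m_0\Delta_F$ is not a square, $$\sum_{q=1}^\infty\frac{\widetilde S_q(\boldsymbol 0)\widetilde I_q(w;\boldsymbol 0)}{(qL)^3}=\Big(\frac{\sqrt N}{L^2}\Big)^3\,\widetilde{\mathcal I}(w)L^4\,\mathbb L(1,\psi_0)\,\widetilde{\mathfrak S}_F+O_\varepsilon\big(N^{\frac54+\varepsilon}\big).$$ The implied constants may depend on $\varepsilon,F,m_0,w,p_0,L,\boldsymbol\lambda$ but not on $h$. -/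

import Mathlib

open Filter Topology MeasureTheory
open scoped ContDiff

noncomputable section

namespace Ternary

/-- The integer matrix of the polar form `F (x + y) - F x - F y`, that is, twice the symmetric
matrix of the quadratic form `F`. -/
def polarMatrix (F : QuadraticForm ℤ (Fin 3 → ℤ)) : Matrix (Fin 3) (Fin 3) ℤ :=
  Matrix.of fun i j => QuadraticMap.polar F (Pi.single i 1) (Pi.single j 1)

/-- The determinant `Δ_F` of the symmetric matrix of `F` (half of the polar matrix); it is an
integer when that matrix is integral, and in general `4 Δ_F` is an integer. -/
def discr (F : QuadraticForm ℤ (Fin 3 → ℤ)) : ℚ :=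
  ((polarMatrix F).det : ℚ) / 8

/-- The extension of `F` to real vectors. -/
def realForm (F : QuadraticForm ℤ (Fin 3 → ℤ)) (x : Fin 3 → ℝ) : ℝ :=
  (∑ i, ∑ j, (polarMatrix F i j : ℝ) * x i * x j) / 2

/-- `e_n(x) = exp (2 π i x / n)`. -/
def expo (n x : ℝ) : ℂ := Complex.exp (2 * Real.pi * Complex.I * x / n)

/-- The bump function `exp (-1 / (1 - x ^ 2))` on `(-1, 1)`, zero elsewhere. -/
def bump (x : ℝ) : ℝ := if |x| < 1 then Real.exp (-(1 - x ^ 2)⁻¹) else 0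

/-- Heath-Brown's normalised bump function, supported on `[1/2, 1]` and of integral one. -/
def omegaFun (x : ℝ) : ℝ := 4 / (∫ t, bump t) * bump (4 * x - 3)

/-- Heath-Brown's function `h(x, y) = ∑_{j ≥ 1} (1 / (x j)) (ω(x j) - ω(|y| / (x j)))` of the
delta method; for `x > 0` the sum is finite. -/
def hFun (x y : ℝ) : ℝ :=
  ∑' j : ℕ+, 1 / (x * (j : ℝ)) * (omegaFun (x * (j : ℝ)) - omegaFun (|y| / (x * (j : ℝ))))

/-- A complete system of residues for `(ℤ / n) ^ 3`. -/
def residues (n : ℕ) : Finset (Fin 3 → ℤ) :=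
  Fintype.piFinset fun _ => Finset.Ico (0 : ℤ) (n : ℤ)

open Classical in
/-- The exponential sum `S̃_q(c)`: the sum over `a` modulo `q` coprime to `q`, and over `σ` modulo
`q L` with `L ^ 2 ∣ F(L σ + ν) - m₀ N`, of
`e_{q L} (a (F(L σ + ν) - m₀ N) / L + c · σ)`. -/
def expSum (F : QuadraticForm ℤ (Fin 3 → ℤ)) (m₀ : ℤ) (L N : ℕ) (ν : Fin 3 → ℤ)
    (q : ℕ) (c : Fin 3 → ℤ) : ℂ :=
  ∑ a ∈ (Finset.range q).filter (fun a => Nat.Coprime a q),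
    ∑ σ ∈ (residues (q * L)).filter
        (fun σ => (L : ℤ) ^ 2 ∣ F ((L : ℤ) • σ + ν) - m₀ * (N : ℤ)),
      expo ((q : ℝ) * (L : ℝ))
        ((a : ℝ) * (((F ((L : ℤ) • σ + ν) - m₀ * (N : ℤ) : ℤ) : ℝ) / (L : ℝ))
          + ((∑ i, c i * σ i : ℤ) : ℝ))

/-- The oscillatory integral `Ĩ_q(w; c)`, with `Q = √N / L`. -/
def oscInt (F : QuadraticForm ℤ (Fin 3 → ℤ)) (m₀ : ℤ) (L N : ℕ) (ν : Fin 3 → ℤ)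
    (w : (Fin 3 → ℝ) → ℝ) (q : ℕ) (c : Fin 3 → ℤ) : ℂ :=
  ∫ s : Fin 3 → ℝ,
    (w (fun i => ((L : ℝ) * s i + (ν i : ℝ)) / √(N : ℝ)) : ℂ)
      * (hFun ((q : ℝ) / (√(N : ℝ) / (L : ℝ)))
          ((realForm F (fun i => (L : ℝ) * s i + (ν i : ℝ)) - (m₀ : ℝ) * (N : ℝ))
            / ((L : ℝ) * (√(N : ℝ) / (L : ℝ))) ^ 2) : ℂ)
      * expo ((q : ℝ) * (L : ℝ)) (-(∑ i, (c i : ℝ) * s i))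

/-- The `q`-th term `S̃_q(c) Ĩ_q(w; c) / (q L) ^ 3` of the delta method expansion. -/
def deltaTerm (F : QuadraticForm ℤ (Fin 3 → ℤ)) (m₀ : ℤ) (L N : ℕ) (ν : Fin 3 → ℤ)
    (w : (Fin 3 → ℝ) → ℝ) (c : Fin 3 → ℤ) (q : ℕ) : ℂ :=
  expSum F m₀ L N ν q c * oscInt F m₀ L N ν w q c / ((q : ℂ) * (L : ℂ)) ^ 3

/-- The inner integral `∫ w(t) e(θ (F(t) - m₀)) dt` of the singular integral. -/
def singIntInner (F : QuadraticForm ℤ (Fin 3 → ℤ)) (m₀ : ℤ) (w : (Fin 3 → ℝ) → ℝ) (θ : ℝ) : ℂ :=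
  ∫ t : Fin 3 → ℝ, (w t : ℂ) * expo 1 (θ * (realForm F t - (m₀ : ℝ)))

/-- The weighted singular integral `Ĩ(w)`, with the integration over `θ` performed last. -/
def singInt (F : QuadraticForm ℤ (Fin 3 → ℤ)) (m₀ : ℤ) (w : (Fin 3 → ℝ) → ℝ) : ℂ :=
  ∫ θ : ℝ, singIntInner F m₀ w θ

open Classical in
/-- `p ^ (-2k)` times the number of solutions modulo `p ^ k` of `F(x) = m` that are congruent to
`lam` modulo `p ^ (ord_p L)`. -/
def localCount (F : QuadraticForm ℤ (Fin 3 → ℤ)) (m : ℤ) (L : ℕ) (lam : Fin 3 → ℤ)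
    (p k : ℕ) : ℝ :=
  (((residues (p ^ k)).filter (fun x =>
      F x ≡ m [ZMOD ((p : ℤ) ^ k)] ∧
      ∀ i, x i ≡ lam i [ZMOD ((p : ℤ) ^ padicValNat p L)])).card : ℝ) / (p : ℝ) ^ (2 * k)

/-- The local density, the limit of `localCount` as `k` tends to infinity. -/
def localDensity (F : QuadraticForm ℤ (Fin 3 → ℤ)) (m : ℤ) (L : ℕ) (lam : Fin 3 → ℤ)
    (p : ℕ) : ℝ :=
  limUnder atTop (fun k : ℕ => localCount F m L lam p k)

/-- The real character `ψ₀ = (-m₀ Δ_F / ·)`. The Jacobi symbol is taken of `-16 m₀ Δ_F`, an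
integer that differs from `-m₀ Δ_F` by a square, so that `ψ₀` vanishes at even integers and is a
Dirichlet character. -/
def psi (F : QuadraticForm ℤ (Fin 3 → ℤ)) (m₀ : ℤ) (n : ℕ) : ℝ :=
  (jacobiSym (-(2 * m₀ * (polarMatrix F).det)) n : ℝ)

/-- The partial sums of the series `∑ ψ₀(n) / n`. -/
def lPartial (F : QuadraticForm ℤ (Fin 3 → ℤ)) (m₀ : ℤ) (X : ℕ) : ℝ :=
  ∑ n ∈ Finset.Icc 1 X, psi F m₀ n / (n : ℝ)

/-- `L(1, ψ₀)` for non-principal `ψ₀`, the value of the conditionally convergent series. -/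
def lOne (F : QuadraticForm ℤ (Fin 3 → ℤ)) (m₀ : ℤ) : ℝ :=
  limUnder atTop (fun X : ℕ => lPartial F m₀ X)

open Classical in
/-- The convergence factor `1 - ψ₀(p) / p`, or `1 - 1 / p` when `-m₀ Δ_F` is a square. -/
def convFactor (F : QuadraticForm ℤ (Fin 3 → ℤ)) (m₀ : ℤ) (p : ℕ) : ℝ :=
  if IsSquare (-(m₀ : ℚ) * discr F) then 1 - 1 / (p : ℝ) else 1 - psi F m₀ p / (p : ℝ)

/-- The factor at `p ≠ p₀` of the modified singular series. -/
def eulerFactor (F : QuadraticForm ℤ (Fin 3 → ℤ)) (m₀ : ℤ) (L : ℕ) (lam : Fin 3 → ℤ)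
    (p : ℕ) : ℝ :=
  convFactor F m₀ p * localDensity F m₀ L lam p

/-- The modified singular series `𝔖̃_F(p₀; L, lam)`. The factor at `p₀` is the density of the cone
`F = 0`, without any congruence condition. -/
def singSeries (F : QuadraticForm ℤ (Fin 3 → ℤ)) (m₀ : ℤ) (p₀ L : ℕ) (lam : Fin 3 → ℤ) : ℝ :=
  convFactor F m₀ p₀ * localDensity F 0 1 0 p₀
    * ∏' p : {p : ℕ // p.Prime ∧ p ≠ p₀}, eulerFactor F m₀ L lam p

end Ternary

end

/-!
With `P = p₀ ^ h` and `Q = P / L`, both factors of the `q`-th term are evaluated exactly at `c = 0`.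

*The exponential sum.* Let `D(n)` be the density of the `σ` with `n ∣ F(L σ + λ_N) - m₀ N`.
Ramanujan's sum turns the exponential sum, divided by `(q L) ^ 3`, into
`∑_{u d = q} μ(u) d D(d L ^ 2)` (`expSum_zero_div`). As long as `q` is small against `P ^ 2`, the
`p₀`-part of the congruence is that of the cone `F = 0`, and `D` is a limiting density independent
of `h` (`solDens_eq_limDens`).

*The oscillatory integral.* It equals `Q ^ 3 J(q / Q)`, where `J(x) = ∫ w(t) h(x, F(t) - m₀) dt`
(`oscInt_zero`). The function `J` vanishes for large `x`, is Lipschitz on `(0, ∞)` and tends to the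
singular integral at `0` (`levelAvg_lipschitz`). Indeed `J(x) = ∑_{j ≥ 1} g(j x)` for a function `g`
of integral zero with bounded derivatives: since `m₀ ≠ 0`, derivatives in the level parameter can be
moved onto the weight along the Euler field (`bddDeriv_kerInt`), and the trapezoidal rule applies to
`g` and to `u g'(u)`. The value at `0` is half the limit of `g` at `0`, up to sign, and Fourier
inversion identifies it with the singular integral. The latter converges because the phase integral
decays like `θ ^ (-3 / 2)` (`phaseInt_decay`); this follows from a differential equation in `θ`, in
which the form dual to `F` enters as a constant coefficient operator.

*The main term.* Thus the sum over `q` is `Q ^ 3 D(L ^ 2) ∑_q (μ * r)(q) J(q / Q)` with the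
multiplicative function `r(n) = n D(n L ^ 2) / D(L ^ 2)`; if `D(L ^ 2) = 0`, all terms and the
singular series vanish. At the primes of good reduction `r(p ^ e) = 1 + χ(p) / p` for `e ≥ 1`, by a
count over the residue field (`localCount_one_good`) and Hensel's lemma (`localCount_succ`). At the
other primes different from `p₀` the values stabilise, and at `p₀` the normalised densities of the
cone converge like `p₀ ^ (-e / 2)` (`coneDens_diff_bound`). Hence `μ * r = f * (χ / id)`, where
`∑ |f(n)| n ^ a` converges for all `a < 1 / 2` (`LocalFactors.summable_quotPart`), and the Euler
product of `∑ f(n)` is the singular series (`limDens_mul_tsum_quotPart`).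

It remains to insert `R(y) = ∑_n χ(n) / n J(n y)` at `y = d / Q` and sum over `d` with the
coefficients `f(d)` (`exists_sum_asymp`). With `σ` the singular integral, `R(y)` is
`σ L(1, χ) + O(√y)` when `χ` is nonprincipal, by partial summation (`harmSum_nonprincipal`), and
`c₁ - σ log y + O(√y)` when `χ` is identically one, by comparison with an integral
(`harmSum_principal`). The error `O(Q ^ (-1 / 2 + ε))` multiplied by `Q ^ 3` is
`O(N ^ (5 / 4 + ε))`.
-/

noncomputable section

namespace Ternary

/-! ### Functions with bounded derivatives on the half-line -/

/-- `n` successive derivatives exist on `(0, ∞)` and are bounded there, together with `k`. -/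
def BddDeriv : ℕ → (ℝ → ℝ) → Prop
  | 0, k => ∃ C, ∀ u > 0, |k u| ≤ C
  | n + 1, k => (∃ C, ∀ u > 0, |k u| ≤ C) ∧
      ∃ k' : ℝ → ℝ, (∀ u > 0, HasDerivAt k (k' u) u) ∧ BddDeriv n k'

lemma BddDeriv.bdd {n : ℕ} {k : ℝ → ℝ} (h : BddDeriv n k) : ∃ C, ∀ u > 0, |k u| ≤ C := by
  cases n with
  | zero => exact h
  | succ n => exact h.1

lemma BddDeriv.add {n : ℕ} {k l : ℝ → ℝ} (hk : BddDeriv n k) (hl : BddDeriv n l) :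
    BddDeriv n (fun u => k u + l u) := by
  induction n generalizing k l with
  | zero =>
    obtain ⟨C, hC⟩ := hk
    obtain ⟨D, hD⟩ := hl
    exact ⟨C + D, fun u hu => (abs_add_le _ _).trans (add_le_add (hC u hu) (hD u hu))⟩
  | succ n ih =>
    obtain ⟨⟨C, hC⟩, k', hk, hk'⟩ := hk
    obtain ⟨⟨D, hD⟩, l', hl, hl'⟩ := hl
    exact ⟨⟨C + D, fun u hu => (abs_add_le _ _).trans (add_le_add (hC u hu) (hD u hu))⟩,
      _, fun u hu => (hk u hu).add (hl u hu), ih hk' hl'⟩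

/-! ### Quadratic forms and their real extensions -/

lemma polarMatrix_symm (F : QuadraticForm ℤ (Fin 3 → ℤ)) (i j : Fin 3) :
    polarMatrix F i j = polarMatrix F j i := by
  simp [polarMatrix, QuadraticMap.polar_comm]

/-- The partial derivative `∂ F / ∂ t_i` of the real extension. -/
def gradForm (F : QuadraticForm ℤ (Fin 3 → ℤ)) (i : Fin 3) (t : Fin 3 → ℝ) : ℝ :=
  ∑ j, (polarMatrix F i j : ℝ) * t j

lemma realForm_contDiff (F : QuadraticForm ℤ (Fin 3 → ℤ)) : ContDiff ℝ ∞ (realForm F) := by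
  unfold realForm
  fun_prop

lemma fderiv_realForm (F : QuadraticForm ℤ (Fin 3 → ℤ)) (t v : Fin 3 → ℝ) :
    fderiv ℝ (realForm F) t v = ∑ i, gradForm F i t * v i := by
  have hp : ∀ i : Fin 3, HasFDerivAt (fun x : Fin 3 → ℝ => x i)
      (ContinuousLinearMap.proj (R := ℝ) i) t := fun i =>
    (ContinuousLinearMap.proj (R := ℝ) (φ := fun _ : Fin 3 => ℝ) i).hasFDerivAt
  have h : HasFDerivAt (fun x : Fin 3 → ℝ => (∑ i, ∑ j, (polarMatrix F i j : ℝ) * x i * x j) * 2⁻¹)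
      _ t := (HasFDerivAt.fun_sum fun i _ => HasFDerivAt.fun_sum fun j _ =>
        (((hp i).const_mul (polarMatrix F i j : ℝ)).mul (hp j))).mul_const 2⁻¹
  have he : realForm F = fun x : Fin 3 → ℝ =>
      (∑ i, ∑ j, (polarMatrix F i j : ℝ) * x i * x j) * 2⁻¹ := by
    ext x; simp [realForm, div_eq_mul_inv]
  rw [he, h.fderiv]
  simp only [gradForm, Fin.sum_univ_three]
  have h01 := polarMatrix_symm F 0 1
  have h02 := polarMatrix_symm F 0 2
  have h12 := polarMatrix_symm F 1 2
  simp [h01, h02, h12]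
  ring

/-- Euler's identity. -/
lemma sum_gradForm_mul (F : QuadraticForm ℤ (Fin 3 → ℤ)) (t : Fin 3 → ℝ) :
    ∑ i, gradForm F i t * t i = 2 * realForm F t := by
  simp only [gradForm, realForm, Fin.sum_univ_three]
  ring

/-! ### Kernels along the level sets of the quadratic form -/

/-- The integral of `w` against the dilated kernel `η (G / u)`. -/
def kerInt (w G : (Fin 3 → ℝ) → ℝ) (η : ℝ → ℝ) (u : ℝ) : ℝ :=
  ∫ t, w t * η (G t / u)

lemma integrable_mul_of_compactSupport {w f : (Fin 3 → ℝ) → ℝ} (hw : Continuous w)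
    (hwc : HasCompactSupport w) (hf : Continuous f) : Integrable (fun t => w t * f t) :=
  (hw.mul hf).integrable_of_hasCompactSupport hwc.mul_right

lemma hasDerivAt_kerInt {w G : (Fin 3 → ℝ) → ℝ} {η : ℝ → ℝ} (hw : Continuous w)
    (hwc : HasCompactSupport w) (hG : Continuous G) (hη : ContDiff ℝ 1 η) {u : ℝ} (hu : 0 < u) :
    HasDerivAt (kerInt w G η) (∫ t, w t * (deriv η (G t / u) * (-(G t) / u ^ 2))) u := by
  have hη' : Continuous (deriv η) := hη.continuous_deriv le_rfl
  obtain ⟨C, hC⟩ : ∃ C, ∀ z ∈ (tsupport w) ×ˢ (Set.Icc (u / 2) (2 * u)),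
      ‖w z.1 * (deriv η (G z.1 / z.2) * (-(G z.1) / z.2 ^ 2))‖ ≤ C := by
    apply (IsCompact.prod hwc isCompact_Icc).exists_bound_of_continuousOn
    have h0 : ∀ z ∈ (tsupport w) ×ˢ (Set.Icc (u / 2) (2 * u)), z.2 ≠ 0 := by
      rintro z ⟨-, hz⟩
      have := hz.1
      exact (by linarith : 0 < z.2).ne'
    have h1 : ContinuousOn (fun z : (Fin 3 → ℝ) × ℝ => G z.1 / z.2)
        ((tsupport w) ×ˢ (Set.Icc (u / 2) (2 * u))) :=
      (hG.comp continuous_fst).continuousOn.div continuous_snd.continuousOn h0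
    have h2 : ContinuousOn (fun z : (Fin 3 → ℝ) × ℝ => -(G z.1) / z.2 ^ 2)
        ((tsupport w) ×ˢ (Set.Icc (u / 2) (2 * u))) :=
      (hG.comp continuous_fst).neg.continuousOn.div (continuous_snd.pow 2).continuousOn
        fun z hz => pow_ne_zero 2 (h0 z hz)
    exact (hw.comp continuous_fst).continuousOn.mul ((hη'.comp_continuousOn h1).mul h2)
  have hnhds : Set.Icc (u / 2) (2 * u) ∈ 𝓝 u := Icc_mem_nhds (by linarith) (by linarith)
  refine (hasDerivAt_integral_of_dominated_loc_of_deriv_le (μ := volume) (𝕜 := ℝ)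
    (F := fun v t => w t * η (G t / v)) (F' := fun v t => w t * (deriv η (G t / v) *
      (-(G t) / v ^ 2))) (bound := (tsupport w).indicator fun _ => C) hnhds ?_ ?_ ?_ ?_ ?_ ?_).2
  · exact Eventually.of_forall fun v => (hw.mul (hη.continuous.comp
      (hG.div_const v))).aestronglyMeasurable
  · exact integrable_mul_of_compactSupport hw hwc (hη.continuous.comp (hG.div_const u))
  · exact (hw.mul ((hη'.comp (hG.div_const u)).mul (hG.neg.div_const _))).aestronglyMeasurable
  · refine Eventually.of_forall fun t v hv => ?_
    by_cases ht : t ∈ tsupport w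
    · rw [Set.indicator_of_mem ht]
      exact hC (t, v) ⟨ht, hv⟩
    · simp [image_eq_zero_of_notMem_tsupport ht, Set.indicator_of_notMem ht]
  · exact (integrable_indicator_iff (isClosed_tsupport w).measurableSet).2
      (integrableOn_const hwc.measure_lt_top.ne)
  · refine Eventually.of_forall fun t v hv => ?_
    have hv0 : v ≠ 0 := by
      have := hv.1
      exact (by linarith : 0 < v).ne'
    have h1 : HasDerivAt (fun v : ℝ => G t / v) (-(G t) / v ^ 2) v := by
      have h := (hasDerivAt_const v (G t)).div (hasDerivAt_id v) hv0
      convert! h using 1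
      simp
    have h2 : HasDerivAt η (deriv η (G t / v)) (G t / v) :=
      (hη.differentiable one_ne_zero _).hasDerivAt
    exact (h2.comp v h1).const_mul (w t)

lemma hasDerivAt_kerInt_div {w G : (Fin 3 → ℝ) → ℝ} {η : ℝ → ℝ} (hw : Continuous w)
    (hwc : HasCompactSupport w) (hG : Continuous G) (hη : ContDiff ℝ 1 η) {u : ℝ} (hu : 0 < u) :
    HasDerivAt (fun u => kerInt w G η u / u)
      (-(kerInt w G (deriv fun z => z * η z) u / u) / u) u := by
  have hη' : Continuous (deriv η) := hη.continuous_deriv le_rfl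
  have h := (hasDerivAt_kerInt hw hwc hG hη hu).div (hasDerivAt_id u) hu.ne'
  convert! h using 1
  have hd : (deriv fun z => z * η z) = fun z => η z + z * deriv η z := by
    ext z
    have := (hasDerivAt_id' z).fun_mul (hη.differentiable one_ne_zero z).hasDerivAt
    simpa using this.deriv
  have e1 : kerInt w G (deriv fun z => z * η z) u
      = kerInt w G η u + ∫ t, w t * (G t / u * deriv η (G t / u)) := by
    unfold kerInt
    rw [← integral_add]
    · congr 1; ext t; rw [hd]; ring
    · exact integrable_mul_of_compactSupport hw hwc (hη.continuous.comp (hG.div_const u))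
    · exact integrable_mul_of_compactSupport hw hwc
        ((hG.div_const u).mul (hη'.comp (hG.div_const u)))
  have e2 : ∫ t, w t * (deriv η (G t / u) * (-(G t) / u ^ 2))
      = -(1 / u) * ∫ t, w t * (G t / u * deriv η (G t / u)) := by
    rw [← integral_const_mul]
    congr 1; ext t
    field_simp
  rw [e1, e2]
  simp only [id]
  field_simp
  ring

/-- Integration by parts for the Euler vector field `∑ t_i ∂_i`. -/
lemma integral_fderiv_euler {ψ : (Fin 3 → ℝ) → ℝ} (hψ : ContDiff ℝ 1 ψ)
    (hc : HasCompactSupport ψ) : ∫ t, fderiv ℝ ψ t t = -3 * ∫ t, ψ t := by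
  have hcd : ∀ v, HasCompactSupport fun t => fderiv ℝ ψ t v := fun v => hc.fderiv_apply (𝕜 := ℝ) v
  have hcont : ∀ v, Continuous fun t => fderiv ℝ ψ t v := fun v =>
    (hψ.continuous_fderiv one_ne_zero).clm_apply continuous_const
  have hi : ∀ i : Fin 3, Integrable fun t : Fin 3 → ℝ => t i * fderiv ℝ ψ t (Pi.single i 1) :=
    fun i => ((continuous_apply i).mul (hcont _)).integrable_of_hasCompactSupport
      (hcd _).mul_left
  have key : ∀ i : Fin 3, ∫ t : Fin 3 → ℝ, t i * fderiv ℝ ψ t (Pi.single i 1) = -∫ t, ψ t := by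
    intro i
    have hf : ∀ t : Fin 3 → ℝ, fderiv ℝ (fun t : Fin 3 → ℝ => t i) t (Pi.single i 1) = 1 := by
      intro t
      have : fderiv ℝ (fun t : Fin 3 → ℝ => t i) t = ContinuousLinearMap.proj i :=
        (ContinuousLinearMap.proj (R := ℝ) (φ := fun _ : Fin 3 => ℝ) i).hasFDerivAt.fderiv
      rw [this]; simp
    have h := integral_mul_fderiv_eq_neg_fderiv_mul_of_integrable (𝕜 := ℝ) (μ := volume)
      (f := fun t : Fin 3 → ℝ => t i) (g := ψ) (v := Pi.single i 1) ?_ (hi i) ?_ ?_ ?_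
    · rw [h]; simp [hf]
    · simp only [hf, one_mul]
      exact hψ.continuous.integrable_of_hasCompactSupport hc
    · exact ((continuous_apply i).mul hψ.continuous).integrable_of_hasCompactSupport hc.mul_left
    · exact fun x _ => (differentiable_apply i).differentiableAt
    · exact fun x _ => hψ.differentiable one_ne_zero x
  have hsum : ∀ t : Fin 3 → ℝ,
      fderiv ℝ ψ t t = ∑ i, t i * fderiv ℝ ψ t (Pi.single i 1) := by
    intro t
    conv_lhs => rw [show t = ∑ i, t i • (Pi.single i (1 : ℝ) : Fin 3 → ℝ) by
      ext j; simp [Finset.sum_apply, Pi.single_apply]]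
    rw [map_sum]
    simp only [map_smul, smul_eq_mul]
    congr 1
    ext i
    congr 3
    ext j; simp [Finset.sum_apply, Pi.single_apply]
  simp only [hsum]
  rw [integral_finsetSum _ fun i _ => hi i]
  simp only [key, Finset.sum_const, Finset.card_univ, Fintype.card_fin]
  simp

lemma contDiff_div_of_tsupport {w f : (Fin 3 → ℝ) → ℝ} (hw : ContDiff ℝ ∞ w) (hf : ContDiff ℝ ∞ f)
    (h : ∀ t ∈ tsupport w, f t ≠ 0) : ContDiff ℝ ∞ (fun t => w t / f t) := by
  rw [contDiff_iff_contDiffAt]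
  intro t
  by_cases ht : t ∈ tsupport w
  · exact hw.contDiffAt.div hf.contDiffAt (h t ht)
  · have : (fun t => w t / f t) =ᶠ[𝓝 t] fun _ => 0 := by
      filter_upwards [notMem_tsupport_iff_eventuallyEq.1 ht] with x hx
      simp [hx]
    exact contDiffAt_const.congr_of_eventuallyEq this

lemma tsupport_div_subset (w f : (Fin 3 → ℝ) → ℝ) :
    tsupport (fun t => w t / f t) ⊆ tsupport w := by
  refine closure_mono ?_
  intro x hx
  simp only [Function.mem_support] at hx ⊢
  intro h0
  simp [h0] at hx

/-- Weights that are smooth, compactly supported and supported away from the zeros of `f`. -/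
structure IsWeight (f w : (Fin 3 → ℝ) → ℝ) : Prop where
  smooth : ContDiff ℝ ∞ w
  compact : HasCompactSupport w
  ne_zero : ∀ t ∈ tsupport w, f t ≠ 0

lemma IsWeight.div {f w : (Fin 3 → ℝ) → ℝ} (hf : ContDiff ℝ ∞ f) (h : IsWeight f w) :
    IsWeight f (fun t => w t / f t) :=
  ⟨contDiff_div_of_tsupport h.smooth hf h.ne_zero,
    h.compact.of_isClosed_subset (isClosed_tsupport _) (tsupport_div_subset _ _),
    fun t ht => h.ne_zero t (tsupport_div_subset _ _ ht)⟩

/-- The transpose of the operator `(2 F)⁻¹ E`, where `E = ∑ t_i ∂_i` is the Euler field. As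
`E (f (F)) = 2 F f' (F)`, it moves a derivative in the level parameter onto the weight. -/
def levelAdj (F : QuadraticForm ℤ (Fin 3 → ℤ)) (w : (Fin 3 → ℝ) → ℝ) (t : Fin 3 → ℝ) : ℝ :=
  -(3 * (w t / realForm F t / 2) + fderiv ℝ (fun t => w t / realForm F t / 2) t t)

lemma IsWeight.levelAdj {F : QuadraticForm ℤ (Fin 3 → ℤ)} {w : (Fin 3 → ℝ) → ℝ}
    (h : IsWeight (realForm F) w) : IsWeight (realForm F) (levelAdj F w) := by
  have h1 := h.div (realForm_contDiff F)
  have hs : ContDiff ℝ ∞ (fun t => w t / realForm F t / 2) := h1.smooth.div_const 2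
  have hsub : tsupport (Ternary.levelAdj F w) ⊆ tsupport w := by
    refine (closure_minimal ?_ (isClosed_tsupport _)).trans (tsupport_div_subset w (realForm F))
    intro t ht
    by_contra hn
    apply ht
    have h2 : (fun t => w t / realForm F t / 2) =ᶠ[𝓝 t] 0 := by
      filter_upwards [notMem_tsupport_iff_eventuallyEq.1 hn] with x hx
      rw [hx]; simp
    have h3 : fderiv ℝ (fun t => w t / realForm F t / 2) t = 0 := by
      rw [h2.fderiv_eq]; simp
    simp only [Ternary.levelAdj, h3, image_eq_zero_of_notMem_tsupport hn]
    simp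
  refine ⟨?_, h.compact.of_isClosed_subset (isClosed_tsupport _) hsub,
    fun t ht => h.ne_zero t (hsub ht)⟩
  unfold Ternary.levelAdj
  have : ContDiff ℝ ∞ (fun t => fderiv ℝ (fun t => w t / realForm F t / 2) t t) :=
    (hs.fderiv_right (m := ∞) (by simp)).clm_apply contDiff_id
  exact (((contDiff_const.mul hs).add this)).neg

/-- Integration by parts along the Euler field: a derivative in the level parameter becomes the
operator `levelAdj` on the weight. -/
lemma integral_mul_deriv_comp {F : QuadraticForm ℤ (Fin 3 → ℤ)} {w : (Fin 3 → ℝ) → ℝ}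
    (h : IsWeight (realForm F) w) (m : ℝ) {f : ℝ → ℝ} (hf : ContDiff ℝ 1 f) :
    ∫ t, w t * deriv f (realForm F t - m) = ∫ t, levelAdj F w t * f (realForm F t - m) := by
  have hG : ContDiff ℝ ∞ (fun t => realForm F t - m) := (realForm_contDiff F).sub contDiff_const
  have h1 := h.div (realForm_contDiff F)
  set v : (Fin 3 → ℝ) → ℝ := fun t => w t / realForm F t / 2 with hv
  have hs : ContDiff ℝ ∞ v := h1.smooth.div_const 2
  have hvc : HasCompactSupport v := by
    have : v = fun t => (w t / realForm F t) * 2⁻¹ := by ext t; simp [hv, div_eq_mul_inv]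
    rw [this]; exact h1.compact.mul_right
  have hfG : ContDiff ℝ 1 (fun t => f (realForm F t - m)) := hf.comp (hG.of_le (by simp))
  have hψ : ContDiff ℝ 1 (fun t => v t * f (realForm F t - m)) := (hs.of_le (by simp)).mul hfG
  have e := integral_fderiv_euler hψ hvc.mul_right
  have hd : ∀ t, fderiv ℝ (fun t => v t * f (realForm F t - m)) t t
      = fderiv ℝ v t t * f (realForm F t - m) + w t * deriv f (realForm F t - m) := by
    intro t
    have a1 : HasFDerivAt v (fderiv ℝ v t) t :=
      (hs.differentiable (by simp) t).hasFDerivAt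
    have a2 : HasFDerivAt (fun t => realForm F t - m) (fderiv ℝ (realForm F) t) t :=
      ((realForm_contDiff F).differentiable (by simp) t).hasFDerivAt.sub_const m
    have a3 : HasDerivAt f (deriv f (realForm F t - m)) (realForm F t - m) :=
      (hf.differentiable one_ne_zero _).hasDerivAt
    have a4 : HasFDerivAt (fun t => f (realForm F t - m))
        (deriv f (realForm F t - m) • fderiv ℝ (realForm F) t) t := a3.comp_hasFDerivAt t a2
    rw [(a1.fun_mul a4).fderiv]
    have a5 : fderiv ℝ (realForm F) t t = 2 * realForm F t := by
      rw [fderiv_realForm, sum_gradForm_mul]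
    simp only [_root_.add_apply, _root_.smul_apply, smul_eq_mul, a5]
    by_cases ht : t ∈ tsupport w
    · have := h.ne_zero t ht
      simp only [hv]
      field_simp
      ring
    · simp [hv, image_eq_zero_of_notMem_tsupport ht]
      ring
  simp only [hd] at e
  have hvd : HasCompactSupport (fun t => fderiv ℝ v t t) := by
    apply (hvc.fderiv (𝕜 := ℝ)).mono
    intro t ht
    simp only [Function.mem_support] at ht ⊢
    intro h0; apply ht; simp [h0]
  have hvdc : Continuous (fun t => fderiv ℝ v t t) :=
    (hs.continuous_fderiv (by simp)).clm_apply continuous_id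
  have hf'G : Continuous fun t => deriv f (realForm F t - m) :=
    (hf.continuous_deriv le_rfl).comp hG.continuous
  rw [integral_add (integrable_mul_of_compactSupport hvdc hvd hfG.continuous)
    (integrable_mul_of_compactSupport h.smooth.continuous h.compact hf'G)] at e
  have e2 : ∫ t, levelAdj F w t * f (realForm F t - m)
      = -3 * (∫ t, v t * f (realForm F t - m)) -
        ∫ t, fderiv ℝ v t t * f (realForm F t - m) := by
    rw [← integral_const_mul, ← integral_sub
      ((integrable_mul_of_compactSupport hs.continuous hvc hfG.continuous).const_mul _)
      (integrable_mul_of_compactSupport hvdc hvd hfG.continuous)]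
    congr 1; ext t
    simp only [levelAdj]
    ring
  rw [e2]
  linarith

lemma kerInt_bdd {w G : (Fin 3 → ℝ) → ℝ} {η : ℝ → ℝ} (hw : Continuous w)
    (hwc : HasCompactSupport w) {C : ℝ} (hη : ∀ z, |η z| ≤ C) :
    ∃ D, ∀ u, |kerInt w G η u| ≤ D := by
  refine ⟨∫ t, |w t| * C, fun u => ?_⟩
  unfold kerInt
  rw [← Real.norm_eq_abs]
  refine norm_integral_le_of_norm_le (((hw.integrable_of_hasCompactSupport hwc).abs).mul_const C)
    (Eventually.of_forall fun t => ?_)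
  rw [norm_mul, Real.norm_eq_abs, Real.norm_eq_abs]
  exact mul_le_mul_of_nonneg_left (hη _) (abs_nonneg _)

lemma exists_bound_of_compactSupport {η : ℝ → ℝ} (hη : Continuous η) (hc : HasCompactSupport η) :
    ∃ C, ∀ z, |η z| ≤ C := by
  obtain ⟨C, hC⟩ := hc.exists_bound_of_continuous hη
  exact ⟨C, hC⟩

/-- Near the level set, where `F ≠ 0`, all derivatives of the kernel integral are bounded: one
integration by parts against a bounded primitive of `η` removes the factor `1 / u`. -/
lemma bddDeriv_kerInt_of_form_ne_zero {F : QuadraticForm ℤ (Fin 3 → ℤ)} (m : ℝ) (n : ℕ) :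
    ∀ {w : (Fin 3 → ℝ) → ℝ} {η : ℝ → ℝ}, IsWeight (realForm F) w → ContDiff ℝ ∞ η →
      HasCompactSupport η → BddDeriv n (fun u => kerInt w (fun t => realForm F t - m) η u / u) := by
  have bdd : ∀ {w : (Fin 3 → ℝ) → ℝ} {η : ℝ → ℝ}, IsWeight (realForm F) w → ContDiff ℝ ∞ η →
      HasCompactSupport η →
      ∃ C, ∀ u > 0, |kerInt w (fun t => realForm F t - m) η u / u| ≤ C := by
    intro w η hw hη hc
    set H : ℝ → ℝ := fun z => ∫ s in (0 : ℝ)..z, η s with hH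
    have hHd : ∀ z, HasDerivAt H (η z) z := fun z =>
      intervalIntegral.integral_hasDerivAt_right (hη.continuous.intervalIntegrable _ _)
        hη.continuous.stronglyMeasurable.stronglyMeasurableAtFilter hη.continuous.continuousAt
    have hH1 : ContDiff ℝ 1 H := by
      rw [contDiff_one_iff_deriv]
      refine ⟨fun z => (hHd z).differentiableAt, ?_⟩
      rw [show deriv H = η from funext fun z => (hHd z).deriv]
      exact hη.continuous
    have hHb : ∀ z, |H z| ≤ ∫ s, |η s| := by
      intro z
      have hi : Integrable η := hη.continuous.integrable_of_hasCompactSupport hc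
      have := intervalIntegral.norm_integral_le_integral_norm_uIoc (f := η) (a := 0) (b := z)
        (μ := volume)
      refine this.trans ?_
      exact setIntegral_le_integral hi.norm (Eventually.of_forall fun s => norm_nonneg _)
    obtain ⟨D, hD⟩ := kerInt_bdd (G := fun t => realForm F t - m) hw.levelAdj.smooth.continuous
      hw.levelAdj.compact hHb
    refine ⟨D, fun u hu => ?_⟩
    have hf : ContDiff ℝ 1 (fun y => H (y / u)) := hH1.comp (contDiff_id.div_const u)
    have e := integral_mul_deriv_comp hw m hf
    have hd : ∀ y, deriv (fun y => H (y / u)) y = η (y / u) / u := by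
      intro y
      have := (hHd (y / u)).comp y ((hasDerivAt_id y).div_const u)
      rw [show (fun y => H (y / u)) = H ∘ fun y => id y / u from rfl, this.deriv]
      simp [div_eq_mul_inv]
    have e1 : kerInt w (fun t => realForm F t - m) η u / u
        = kerInt (levelAdj F w) (fun t => realForm F t - m) H u := by
      simp only [hd] at e
      unfold kerInt
      rw [← e, div_eq_mul_inv, ← integral_mul_const]
      congr 1; ext t; ring
    rw [e1]
    exact hD u
  induction n with
  | zero => exact fun hw hη hc => bdd hw hη hc
  | succ n ih =>
    intro w η hw hη hc
    have hzη : ContDiff ℝ ∞ fun z : ℝ => z * η z := contDiff_id.mul hη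
    refine ⟨bdd hw hη hc, fun u => -(kerInt (levelAdj F w) (fun t => realForm F t - m)
      (fun z => z * η z) u / u), fun u hu => ?_, ?_⟩
    · have h := hasDerivAt_kerInt_div hw.smooth.continuous hw.compact
        ((realForm_contDiff F).sub (contDiff_const (c := m))).continuous (hη.of_le (by simp)) hu
      convert! h using 1
      have hf : ContDiff ℝ 1 (fun y : ℝ => y / u * η (y / u)) :=
        ((hzη.comp (contDiff_id.div_const u))).of_le (by simp)
      have e := integral_mul_deriv_comp hw m hf
      have hd : ∀ y, deriv (fun y => y / u * η (y / u)) y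
          = deriv (fun z => z * η z) (y / u) / u := by
        intro y
        have := ((hzη.differentiable (by simp) (y / u)).hasDerivAt).comp y
          ((hasDerivAt_id y).div_const u)
        rw [show (fun y => y / u * η (y / u)) = (fun z => z * η z) ∘ fun y => id y / u from rfl,
          this.deriv]
        simp [div_eq_mul_inv]
      simp only [hd] at e
      unfold kerInt
      beta_reduce
      rw [← e, neg_div]
      congr 2
      rw [div_eq_mul_inv _ u, ← integral_mul_const]
      congr 1; ext t; ring
    · have := ih (w := fun t => -levelAdj F w t) (η := fun z => z * η z) ?_ hzη hc.mul_left
      · convert! this using 2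
        rw [← neg_div]; congr 1
        unfold kerInt
        rw [← integral_neg]
        congr 1; ext t; ring
      · have := hw.levelAdj
        have e : tsupport (fun t => -levelAdj F w t) = tsupport (levelAdj F w) := by
          unfold tsupport; congr 1; ext t; simp
        exact ⟨this.smooth.neg, by unfold HasCompactSupport; rw [e]; exact this.compact,
          by rw [e]; exact this.ne_zero⟩

/-- Away from the level set all derivatives of the kernel integral are bounded, because
`η (G / u) / u = G⁻¹ (z η z)` at `z = G / u`. -/
lemma bddDeriv_kerInt_of_ne_zero {G : (Fin 3 → ℝ) → ℝ} (hG : ContDiff ℝ ∞ G) (n : ℕ) :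
    ∀ {w : (Fin 3 → ℝ) → ℝ} {η : ℝ → ℝ}, IsWeight G w → ContDiff ℝ ∞ η →
      HasCompactSupport η → BddDeriv n (fun u => kerInt w G η u / u) := by
  have flat : ∀ {w : (Fin 3 → ℝ) → ℝ} {η : ℝ → ℝ}, IsWeight G w → ∀ u > 0,
      kerInt w G η u / u = kerInt (fun t => w t / G t) G (fun z => z * η z) u := by
    intro w η hw u hu
    unfold kerInt
    rw [div_eq_mul_inv, ← integral_mul_const]
    congr 1; ext t
    by_cases ht : t ∈ tsupport w
    · have := hw.ne_zero t ht
      field_simp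
    · simp [image_eq_zero_of_notMem_tsupport ht]
  have bdd : ∀ {w : (Fin 3 → ℝ) → ℝ} {η : ℝ → ℝ}, IsWeight G w → ContDiff ℝ ∞ η →
      HasCompactSupport η → ∃ C, ∀ u > 0, |kerInt w G η u / u| ≤ C := by
    intro w η hw hη hc
    obtain ⟨C, hC⟩ := exists_bound_of_compactSupport (continuous_id.mul hη.continuous)
      (hc.mul_left (f := id))
    obtain ⟨D, hD⟩ := kerInt_bdd (G := G) (hw.div hG).smooth.continuous (hw.div hG).compact hC
    refine ⟨D, fun u hu => ?_⟩
    rw [flat hw u hu]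
    exact hD u
  induction n with
  | zero => exact fun hw hη hc => bdd hw hη hc
  | succ n ih =>
    intro w η hw hη hc
    have hzη : ContDiff ℝ ∞ (deriv fun z : ℝ => z * η z) :=
      (contDiff_infty_iff_deriv.1 (contDiff_id.mul hη)).2
    have hcd : HasCompactSupport (deriv fun z : ℝ => z * η z) := hc.mul_left.deriv
    have hw' : IsWeight G (fun t => -(w t) / G t) := by
      have h := hw.div hG
      have e : (fun t => -(w t) / G t) = fun t => -(w t / G t) := by ext t; ring
      have e' : tsupport (fun t => -(w t) / G t) = tsupport (fun t => w t / G t) := by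
        rw [e]; unfold tsupport; congr 1; ext t; simp
      exact ⟨e ▸ h.smooth.neg, by unfold HasCompactSupport; rw [e']; exact h.compact,
        by rw [e']; exact h.ne_zero⟩
    refine ⟨bdd hw hη hc, _, fun u hu => ?_, ih hw' (contDiff_id.mul hzη) hcd.mul_left⟩
    have h := hasDerivAt_kerInt_div hw.smooth.continuous hw.compact hG.continuous
      (hη.of_le (by simp)) hu
    convert! h using 1
    congr 1
    rw [flat hw u hu]
    unfold kerInt
    rw [← integral_neg]
    congr 1; ext t
    simp only [id]
    ring

/-- A smooth cut-off splits `w` into a part supported near the level set, where `F` does not vanish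
because `m ≠ 0`, and a part supported away from the level set. -/
lemma bddDeriv_kerInt (F : QuadraticForm ℤ (Fin 3 → ℤ)) {m : ℝ} (hm : m ≠ 0)
    {w : (Fin 3 → ℝ) → ℝ} (hw : ContDiff ℝ ∞ w) (hwc : HasCompactSupport w) {η : ℝ → ℝ}
    (hη : ContDiff ℝ ∞ η) (hc : HasCompactSupport η) (n : ℕ) :
    BddDeriv n (fun u => kerInt w (fun t => realForm F t - m) η u / u) := by
  have hF := realForm_contDiff F
  have hG : ContDiff ℝ ∞ (fun t => realForm F t - m) := hF.sub contDiff_const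
  -- a cut-off that equals one near the level `m` and vanishes near the level zero
  let χ : ContDiffBump m := ⟨|m| / 4, |m| / 2, by positivity, by have := abs_pos.2 hm; linarith⟩
  have hχ : ContDiff ℝ ∞ fun t => χ (realForm F t) := χ.contDiff.comp hF
  have h1 : IsWeight (realForm F) (fun t => w t * χ (realForm F t)) := by
    refine ⟨hw.mul hχ, hwc.mul_right, fun t ht h0 => ?_⟩
    have h2 : t ∈ tsupport fun t => χ (realForm F t) := (tsupport_mul_subset_right ht)
    have h3 := tsupport_comp_subset_preimage χ hF.continuous h2
    rw [Set.mem_preimage, χ.tsupport_eq, h0, Metric.mem_closedBall, Real.dist_eq] at h3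
    have : |m| ≤ |m| / 2 := by simpa using h3
    have := abs_pos.2 hm
    linarith
  have h2 : IsWeight (fun t => realForm F t - m) (fun t => w t * (1 - χ (realForm F t))) := by
    refine ⟨hw.mul (contDiff_const.sub hχ), hwc.mul_right, fun t ht h0 => ?_⟩
    have h2 : t ∈ tsupport fun t => 1 - χ (realForm F t) := (tsupport_mul_subset_right ht)
    apply notMem_tsupport_iff_eventuallyEq.2 _ h2
    have h3 : ∀ᶠ y in 𝓝 m, χ y = 1 := χ.eventuallyEq_one
    have h4 : Tendsto (realForm F) (𝓝 t) (𝓝 m) := sub_eq_zero.1 h0 ▸ hF.continuous.continuousAt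
    filter_upwards [h4.eventually h3] with x hx
    simp [hx]
  have h3 := (bddDeriv_kerInt_of_form_ne_zero m n h1 hη hc).add
    (bddDeriv_kerInt_of_ne_zero hG n h2 hη hc)
  convert! h3 using 2 with u
  rw [← add_div]
  congr 1
  unfold kerInt
  have hηG : Continuous fun t => η ((realForm F t - m) / u) :=
    hη.continuous.comp (hG.continuous.div_const u)
  rw [← integral_add
    (integrable_mul_of_compactSupport h1.smooth.continuous h1.compact hηG)
    (integrable_mul_of_compactSupport h2.smooth.continuous h2.compact hηG)]
  congr 1; ext t; ring

/-! ### The trapezoidal rule -/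

/-- The error of the trapezoidal rule on one interval, for a function given with a primitive `Φ`. -/
lemma trapezoid_step {Φ φ φ' φ'' : ℝ → ℝ} {a b M : ℝ} (hab : a < b)
    (h0 : ∀ u ∈ Set.Icc a b, HasDerivAt Φ (φ u) u)
    (h1 : ∀ u ∈ Set.Icc a b, HasDerivAt φ (φ' u) u)
    (h2 : ∀ u ∈ Set.Icc a b, HasDerivAt φ' (φ'' u) u)
    (hM : ∀ u ∈ Set.Icc a b, |φ'' u| ≤ M) :
    |Φ b - Φ a - (b - a) * (φ a + φ b) / 2| ≤ M * (b - a) ^ 3 := by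
  have hM0 : 0 ≤ M := (abs_nonneg _).trans (hM a ⟨le_rfl, hab.le⟩)
  set e : ℝ → ℝ := fun t => Φ t - Φ a - (t - a) * (φ a + φ t) / 2 with he
  have hed : ∀ u ∈ Set.Icc a b, HasDerivAt e ((φ u - φ a - (u - a) * φ' u) / 2) u := by
    intro u hu
    have := ((h0 u hu).sub_const (Φ a)).sub
      ((((hasDerivAt_id u).sub_const a).mul ((h1 u hu).const_add (φ a))).div_const 2)
    convert! this using 1
    simp only [id]
    ring
  obtain ⟨t, ht, het⟩ := exists_hasDerivAt_eq_slope e _ hab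
    (fun u hu => (hed u hu).continuousAt.continuousWithinAt)
    (fun u hu => hed u ⟨hu.1.le, hu.2.le⟩)
  obtain ⟨s, hs, hes⟩ := exists_hasDerivAt_eq_slope φ φ' ht.1
    (fun u hu => (h1 u ⟨hu.1, hu.2.trans ht.2.le⟩).continuousAt.continuousWithinAt)
    (fun u hu => h1 u ⟨hu.1.le, hu.2.le.trans ht.2.le⟩)
  obtain ⟨r, hr, her⟩ := exists_hasDerivAt_eq_slope φ' φ'' hs.2
    (fun u hu => (h2 u ⟨hs.1.le.trans hu.1, hu.2.trans ht.2.le⟩).continuousAt.continuousWithinAt)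
    (fun u hu => h2 u ⟨hs.1.le.trans hu.1.le, hu.2.le.trans ht.2.le⟩)
  have hb : |φ'' r| ≤ M := hM r ⟨hs.1.le.trans hr.1.le, hr.2.le.trans ht.2.le⟩
  have p1 : t - a ≠ 0 := (sub_pos.2 ht.1).ne'
  have p2 : t - s ≠ 0 := (sub_pos.2 hs.2).ne'
  have p3 : b - a ≠ 0 := (sub_pos.2 hab).ne'
  have e1 : φ t - φ a = φ' s * (t - a) := by rw [hes]; field_simp
  have e2 : φ' t - φ' s = φ'' r * (t - s) := by rw [her]; field_simp
  have e3 : e b - e a = (φ t - φ a - (t - a) * φ' t) / 2 * (b - a) := by rw [het]; field_simp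
  have e4 : e b - e a = -(φ'' r * ((t - s) * (t - a) * (b - a)) / 2) := by
    rw [e3, e1]
    linear_combination -((t - a) * (b - a)) / 2 * e2
  have e5 : Φ b - Φ a - (b - a) * (φ a + φ b) / 2 = e b - e a := by simp [he]
  have q1 : 0 < t - a := sub_pos.2 ht.1
  have q2 : 0 < t - s := sub_pos.2 hs.2
  have q3 : 0 < b - a := sub_pos.2 hab
  rw [e5, e4, abs_neg, abs_div, abs_mul,
    abs_of_pos (by positivity : 0 < (t - s) * (t - a) * (b - a)),
    abs_two]
  have k1 : (t - s) * (t - a) * (b - a) ≤ (b - a) ^ 3 := by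
    have l1 : t - s ≤ b - a := by linarith [hs.1, ht.2]
    have l2 : t - a ≤ b - a := by linarith [ht.2]
    calc (t - s) * (t - a) * (b - a) ≤ (b - a) * (b - a) * (b - a) := by gcongr
      _ = _ := by ring
  have k2 : |φ'' r| * ((t - s) * (t - a) * (b - a)) ≤ M * (b - a) ^ 3 := by gcongr
  have k3 : 0 ≤ |φ'' r| * ((t - s) * (t - a) * (b - a)) := by positivity
  linarith

/-- The trapezoidal rule on `[0, (n + 1) x]`, stated with primitives, for functions that are only
assumed to have limits at `0` and to vanish at the right end point. -/
lemma trapezoid_sum {Φ φ φ' φ'' : ℝ → ℝ} {M φ₀ x : ℝ} (n : ℕ) (hx : 0 < x)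
    (h0 : ∀ u > 0, HasDerivAt Φ (φ u) u) (h1 : ∀ u > 0, HasDerivAt φ (φ' u) u)
    (h2 : ∀ u > 0, HasDerivAt φ' (φ'' u) u) (hM : ∀ u > 0, u ≤ (n + 1) * x → |φ'' u| ≤ M)
    (hΦ0 : Tendsto Φ (𝓝[>] 0) (𝓝 0)) (hφ0 : Tendsto φ (𝓝[>] 0) (𝓝 φ₀))
    (hΦn : Φ ((n + 1) * x) = 0) (hφn : φ ((n + 1) * x) = 0) :
    |x * (∑ j ∈ Finset.range (n + 1), φ ((j + 1) * x) + φ₀ / 2)| ≤ (n + 1) * M * x ^ 3 := by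
  have first : |Φ x - 0 - (x - 0) * (φ₀ + φ x) / 2| ≤ M * (x - 0) ^ 3 := by
    have hid : Tendsto (fun ε : ℝ => ε) (𝓝[>] 0) (𝓝 0) :=
      tendsto_nhdsWithin_of_tendsto_nhds tendsto_id
    have l1 : Tendsto (fun ε => |Φ x - Φ ε - (x - ε) * (φ ε + φ x) / 2|) (𝓝[>] 0)
        (𝓝 |Φ x - 0 - (x - 0) * (φ₀ + φ x) / 2|) :=
      ((tendsto_const_nhds.sub hΦ0).sub (((tendsto_const_nhds.sub hid).mul
        (hφ0.add tendsto_const_nhds)).div_const 2)).abs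
    have l2 : Tendsto (fun ε => M * (x - ε) ^ 3) (𝓝[>] 0) (𝓝 (M * (x - 0) ^ 3)) :=
      ((tendsto_const_nhds.sub hid).pow 3).const_mul M
    refine le_of_tendsto_of_tendsto l1 l2 ?_
    filter_upwards [Ioo_mem_nhdsGT hx] with ε hε
    refine trapezoid_step hε.2 (fun u hu => h0 u (hε.1.trans_le hu.1))
      (fun u hu => h1 u (hε.1.trans_le hu.1)) (fun u hu => h2 u (hε.1.trans_le hu.1))
      (fun u hu => hM u (hε.1.trans_le hu.1) (hu.2.trans ?_))
    nlinarith [n.cast_nonneg (α := ℝ)]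
  have gen : ∀ m : ℕ, m ≤ n → |Φ ((m + 1) * x) - x * (∑ j ∈ Finset.range (m + 1), φ ((j + 1) * x)
      + φ₀ / 2 - φ ((m + 1) * x) / 2)| ≤ (m + 1) * M * x ^ 3 := by
    intro m
    induction m with
    | zero =>
      intro _
      have e : Φ x - 0 - (x - 0) * (φ₀ + φ x) / 2 = Φ x - x * (φ x + φ₀ / 2 - φ x / 2) := by ring
      rw [e] at first
      simpa using first
    | succ m ih =>
      intro hm
      have hp : (0 : ℝ) < (m + 1) * x := by positivity
      have hmn : ((m + 1 : ℕ) : ℝ) ≤ n := by exact_mod_cast hm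
      have st := trapezoid_step (a := (m + 1) * x) (b := (m + 1 + 1) * x) (by nlinarith)
        (fun u hu => h0 u (hp.trans_le hu.1)) (fun u hu => h1 u (hp.trans_le hu.1))
        (fun u hu => h2 u (hp.trans_le hu.1))
        (fun u hu => hM u (hp.trans_le hu.1) (hu.2.trans (by push_cast at hmn; gcongr)))
      have e : ((m : ℝ) + 1 + 1) * x - (m + 1) * x = x := by ring
      rw [e] at st
      rw [Finset.sum_range_succ]
      push_cast
      refine le_trans (le_of_eq ?_) ((abs_add_le _ _).trans
        ((add_le_add (ih (by omega)) st).trans (le_of_eq (by ring))))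
      congr 1
      ring
  have := gen n le_rfl
  rw [hΦn, hφn] at this
  rw [← abs_neg]
  convert this using 2
  ring

/-! ### The weight functions of the delta method -/

lemma bump_eq (x : ℝ) : bump x = expNegInvGlue (1 - x ^ 2) := by
  unfold bump expNegInvGlue
  have : |x| < 1 ↔ ¬ (1 - x ^ 2 ≤ 0) := by
    rw [not_le, sub_pos, sq_lt_one_iff_abs_lt_one]
  by_cases h : |x| < 1
  · rw [if_pos h, if_neg (this.1 h)]
  · rw [if_neg h, if_pos (not_not.1 (this.not.1 h))]

lemma bump_contDiff : ContDiff ℝ ∞ bump := by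
  rw [show bump = fun x => expNegInvGlue (1 - x ^ 2) from funext bump_eq]
  exact expNegInvGlue.contDiff.comp (contDiff_const.sub (contDiff_id.pow 2))

lemma bump_eq_zero {x : ℝ} (h : 1 ≤ |x|) : bump x = 0 := if_neg (not_lt.2 h)

lemma bump_integral_pos : 0 < ∫ t, bump t := by
  have hc : HasCompactSupport bump := by
    refine HasCompactSupport.intro (isCompact_Icc (a := (-1 : ℝ)) (b := 1)) fun x hx => ?_
    apply bump_eq_zero
    by_contra h
    exact hx ⟨(abs_lt.1 (not_le.1 h)).1.le, (abs_lt.1 (not_le.1 h)).2.le⟩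
  refine bump_contDiff.continuous.integral_pos_of_hasCompactSupport_nonneg_nonzero hc
    (fun x => by rw [bump_eq]; exact expNegInvGlue.nonneg _) (x := 0) ?_
  rw [bump_eq]
  exact (expNegInvGlue.pos_of_pos (by norm_num)).ne'

lemma omegaFun_contDiff : ContDiff ℝ ∞ omegaFun := by
  unfold omegaFun
  exact contDiff_const.mul
    (bump_contDiff.comp ((contDiff_const.mul contDiff_id).sub contDiff_const))

lemma omegaFun_eq_zero_of_le {z : ℝ} (h : z ≤ 1 / 2) : omegaFun z = 0 := by
  unfold omegaFun
  rw [bump_eq_zero, mul_zero]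
  rw [le_abs]; right; linarith

lemma omegaFun_eq_zero_of_ge {z : ℝ} (h : 1 ≤ z) : omegaFun z = 0 := by
  unfold omegaFun
  rw [bump_eq_zero, mul_zero]
  rw [le_abs]; left; linarith

lemma omegaFun_hasCompactSupport : HasCompactSupport omegaFun := by
  refine HasCompactSupport.intro (isCompact_Icc (a := (1 / 2 : ℝ)) (b := 1)) fun x hx => ?_
  by_cases h : x ≤ 1 / 2
  · exact omegaFun_eq_zero_of_le h
  · exact omegaFun_eq_zero_of_ge (by
      by_contra h1
      exact hx ⟨(not_le.1 h).le, (not_le.1 h1).le⟩)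

lemma integral_omegaFun : ∫ z, omegaFun z = 1 := by
  unfold omegaFun
  rw [integral_const_mul]
  have h := Measure.integral_comp_mul_left (fun z => bump (z - 3)) (4 : ℝ)
  rw [h, integral_sub_right_eq_self (μ := volume) bump 3]
  have := bump_integral_pos
  rw [abs_of_pos (by norm_num), smul_eq_mul]
  field_simp

/-- The even extension `ω(|z|)` of the weight `ω`. -/
def evenOmega (z : ℝ) : ℝ := omegaFun z + omegaFun (-z)

lemma evenOmega_eq (z : ℝ) : evenOmega z = omegaFun |z| := by
  unfold evenOmega
  rcases le_total 0 z with h | h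
  · rw [abs_of_nonneg h, omegaFun_eq_zero_of_le (z := -z) (by linarith), add_zero]
  · rw [abs_of_nonpos h, omegaFun_eq_zero_of_le (z := z) (by linarith), zero_add]

lemma evenOmega_contDiff : ContDiff ℝ ∞ evenOmega :=
  omegaFun_contDiff.add (omegaFun_contDiff.comp contDiff_neg)

lemma evenOmega_hasCompactSupport : HasCompactSupport evenOmega :=
  omegaFun_hasCompactSupport.add (omegaFun_hasCompactSupport.comp_homeomorph (Homeomorph.neg ℝ))

lemma integral_evenOmega : ∫ z, evenOmega z = 2 := by
  have hi : Integrable omegaFun :=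
    omegaFun_contDiff.continuous.integrable_of_hasCompactSupport omegaFun_hasCompactSupport
  unfold evenOmega
  rw [integral_add hi hi.comp_neg, integral_neg_eq_self, integral_omegaFun]
  norm_num

/-- `ω(z) / z`, a smooth function as `ω` vanishes near `0`. -/
def omegaDiv (z : ℝ) : ℝ := omegaFun z / z

lemma omegaDiv_contDiff : ContDiff ℝ ∞ omegaDiv := by
  rw [contDiff_iff_contDiffAt]
  intro z
  by_cases hz : z = 0
  · have : omegaDiv =ᶠ[𝓝 z] fun _ => 0 := by
      filter_upwards [Iio_mem_nhds (show z < 1 / 2 by rw [hz]; norm_num)] with y hy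
      simp [omegaDiv, omegaFun_eq_zero_of_le (le_of_lt hy)]
    exact contDiffAt_const.congr_of_eventuallyEq this
  · exact omegaFun_contDiff.contDiffAt.div contDiffAt_id hz

lemma omegaDiv_hasCompactSupport : HasCompactSupport omegaDiv := by
  unfold omegaDiv
  simp_rw [div_eq_mul_inv]
  exact omegaFun_hasCompactSupport.mul_right

/-- The primitive of `ω(z) / z` that vanishes near `0`. -/
def omegaPrim (v : ℝ) : ℝ := ∫ z in (0 : ℝ)..v, omegaDiv z

lemma hasDerivAt_omegaPrim (z : ℝ) : HasDerivAt omegaPrim (omegaDiv z) z :=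
  intervalIntegral.integral_hasDerivAt_right (omegaDiv_contDiff.continuous.intervalIntegrable _ _)
    omegaDiv_contDiff.continuous.stronglyMeasurable.stronglyMeasurableAtFilter
    omegaDiv_contDiff.continuous.continuousAt

lemma omegaPrim_contDiff : ContDiff ℝ ∞ omegaPrim := by
  rw [contDiff_infty_iff_deriv]
  refine ⟨fun z => (hasDerivAt_omegaPrim z).differentiableAt, ?_⟩
  rw [show deriv omegaPrim = omegaDiv from funext fun z => (hasDerivAt_omegaPrim z).deriv]
  exact omegaDiv_contDiff

lemma omegaPrim_eq_zero {v : ℝ} (h : v ≤ 1 / 2) : omegaPrim v = 0 := by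
  unfold omegaPrim
  have : Set.EqOn omegaDiv (fun _ => 0) (Set.uIcc 0 v) := by
    intro z hz
    have : z ≤ 1 / 2 := hz.2.trans (sup_le (by norm_num) h)
    simp [omegaDiv, omegaFun_eq_zero_of_le this]
  rw [intervalIntegral.integral_congr this]
  simp

lemma omegaPrim_eq_of_ge {v : ℝ} (h : 1 ≤ v) : omegaPrim v = omegaPrim 1 := by
  unfold omegaPrim
  have hi : ∀ a b, IntervalIntegrable omegaDiv volume a b := fun a b =>
    omegaDiv_contDiff.continuous.intervalIntegrable a b
  rw [← intervalIntegral.integral_add_adjacent_intervals (hi 0 1) (hi 1 v)]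
  have : Set.EqOn omegaDiv (fun _ => 0) (Set.uIcc 1 v) := by
    intro z hz
    rw [Set.uIcc_of_le h] at hz
    simp [omegaDiv, omegaFun_eq_zero_of_ge hz.1]
  rw [intervalIntegral.integral_congr this]
  simp

/-- The even, compactly supported function `∫_{|z|}^∞ ω(v) / v dv`. -/
def omegaTail (z : ℝ) : ℝ := omegaPrim 1 - (omegaPrim z + omegaPrim (-z))

lemma omegaTail_contDiff : ContDiff ℝ ∞ omegaTail :=
  contDiff_const.sub (omegaPrim_contDiff.add (omegaPrim_contDiff.comp contDiff_neg))

lemma omegaTail_hasCompactSupport : HasCompactSupport omegaTail := by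
  refine HasCompactSupport.intro (isCompact_Icc (a := (-1 : ℝ)) (b := 1)) fun x hx => ?_
  unfold omegaTail
  by_cases h : x ≤ 1
  · have h1 : x < -1 := by
      by_contra h2
      exact hx ⟨not_lt.1 h2, h⟩
    rw [omegaPrim_eq_zero (v := x) (by linarith), omegaPrim_eq_of_ge (v := -x) (by linarith)]
    ring
  · rw [omegaPrim_eq_zero (v := -x) (by linarith), omegaPrim_eq_of_ge (v := x) (by linarith)]
    ring

lemma omegaTail_eq_of_abs_le {z : ℝ} (h : |z| ≤ 1 / 2) : omegaTail z = omegaPrim 1 := by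
  unfold omegaTail
  rw [omegaPrim_eq_zero (abs_le.1 h).2, omegaPrim_eq_zero (v := -z) (by linarith [(abs_le.1 h).1])]
  ring

lemma mul_deriv_omegaTail (z : ℝ) : z * deriv omegaTail z = -evenOmega z := by
  have h : HasDerivAt omegaTail (-(omegaDiv z + omegaDiv (-z) * (-1))) z :=
    ((hasDerivAt_omegaPrim z).add
      ((hasDerivAt_omegaPrim (-z)).comp z (hasDerivAt_neg z))).const_sub _
  rw [h.deriv]
  unfold evenOmega omegaDiv
  by_cases hz : z = 0
  · simp [hz, omegaFun_eq_zero_of_le (show (0 : ℝ) ≤ 1 / 2 by norm_num)]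
  · field_simp

lemma bddDeriv_of_compactSupport (n : ℕ) : ∀ {η : ℝ → ℝ}, ContDiff ℝ ∞ η → HasCompactSupport η →
    BddDeriv n η := by
  induction n with
  | zero =>
    intro η hη hc
    obtain ⟨C, hC⟩ := exists_bound_of_compactSupport hη.continuous hc
    exact ⟨C, fun u _ => hC u⟩
  | succ n ih =>
    intro η hη hc
    obtain ⟨C, hC⟩ := exists_bound_of_compactSupport hη.continuous hc
    exact ⟨⟨C, fun u _ => hC u⟩, deriv η, fun u _ => (hη.differentiable (by simp) u).hasDerivAt,
      ih (contDiff_infty_iff_deriv.1 hη).2 hc.deriv⟩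

lemma BddDeriv.const_mul {n : ℕ} {k : ℝ → ℝ} (c : ℝ) (hk : BddDeriv n k) :
    BddDeriv n (fun u => c * k u) := by
  induction n generalizing k with
  | zero =>
    obtain ⟨C, hC⟩ := hk
    exact ⟨|c| * C, fun u hu => by rw [abs_mul]; gcongr; exact hC u hu⟩
  | succ n ih =>
    obtain ⟨⟨C, hC⟩, k', hk, hk'⟩ := hk
    exact ⟨⟨|c| * C, fun u hu => by rw [abs_mul]; gcongr; exact hC u hu⟩,
      _, fun u hu => (hk u hu).const_mul c, ih hk'⟩

section

/-! ### The average of the delta kernel over the level sets -/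

/-- The average `∫ w(t) h(x, F(t) - m) dt`. -/
def levelAvg (F : QuadraticForm ℤ (Fin 3 → ℤ)) (m : ℝ) (w : (Fin 3 → ℝ) → ℝ) (x : ℝ) : ℝ :=
  ∫ t, w t * hFun x (realForm F t - m)

/-- The function `g` for which the average of the delta kernel at `x` is `∑_{j ≥ 1} g(j x)`. -/
def avgSummand (F : QuadraticForm ℤ (Fin 3 → ℤ)) (m : ℝ) (w : (Fin 3 → ℝ) → ℝ) (u : ℝ) : ℝ :=
  (∫ t, w t) * omegaDiv u - kerInt w (fun t => realForm F t - m) evenOmega u / u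

/-- The primitive of `avgSummand` that vanishes at both ends of `(0, ∞)`. -/
def avgPrim (F : QuadraticForm ℤ (Fin 3 → ℤ)) (m : ℝ) (w : (Fin 3 → ℝ) → ℝ) (u : ℝ) : ℝ :=
  (∫ t, w t) * omegaPrim u - kerInt w (fun t => realForm F t - m) omegaTail u

lemma hFun_eq_sum {x y c : ℝ} (hx : 0 < x) (hc : 1 ≤ c) (hy : 2 * |y| ≤ c) {n : ℕ}
    (hn : c ≤ (n + 1) * x) :
    hFun x y = ∑ j ∈ Finset.range (n + 1), 1 / ((j + 1) * x) *
      (omegaFun ((j + 1) * x) - evenOmega (y / ((j + 1) * x))) := by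
  unfold hFun
  have e := tsum_pnat_eq_tsum_succ (f := fun j : ℕ => 1 / (x * (j : ℝ)) *
    (omegaFun (x * (j : ℝ)) - omegaFun (|y| / (x * (j : ℝ)))))
  rw [e, tsum_eq_sum (s := Finset.range (n + 1))]
  · refine Finset.sum_congr rfl fun j _ => ?_
    have hp : 0 < ((j : ℝ) + 1) * x := by positivity
    rw [evenOmega_eq, abs_div, abs_of_pos hp]
    push_cast
    rw [mul_comm x]
  · intro j hj
    rw [Finset.mem_range, not_lt] at hj
    have hj' : ((n : ℝ) + 1) ≤ j := by exact_mod_cast hj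
    have hcx : c ≤ x * ((j + 1 : ℕ) : ℝ) := by
      push_cast
      nlinarith
    rw [omegaFun_eq_zero_of_ge (hc.trans hcx), omegaFun_eq_zero_of_le, sub_zero, mul_zero]
    rw [div_le_iff₀ (by linarith)]
    linarith

variable {F : QuadraticForm ℤ (Fin 3 → ℤ)} {m c : ℝ} {w : (Fin 3 → ℝ) → ℝ}

lemma continuous_level : Continuous fun t => realForm F t - m :=
  (realForm_contDiff F).continuous.sub continuous_const

lemma exists_level_bound (F : QuadraticForm ℤ (Fin 3 → ℤ)) (m : ℝ) (hwc : HasCompactSupport w) :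
    ∃ c, 1 ≤ c ∧ ∀ t, w t ≠ 0 → 2 * |realForm F t - m| ≤ c := by
  obtain ⟨C, hC⟩ := IsCompact.exists_bound_of_continuousOn hwc
    (continuous_level (F := F) (m := m)).continuousOn
  refine ⟨max 1 (2 * C), le_max_left _ _, fun t ht => ?_⟩
  have := hC t (subset_tsupport w ht)
  rw [Real.norm_eq_abs] at this
  exact le_trans (by linarith) (le_max_right _ _)

lemma kerInt_omegaFun_integrable (hw : Continuous w) (hwc : HasCompactSupport w) {η : ℝ → ℝ}
    (hη : Continuous η) (u : ℝ) : Integrable fun t => w t * η ((realForm F t - m) / u) :=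
  integrable_mul_of_compactSupport hw hwc (hη.comp (continuous_level.div_const u))

lemma levelAvg_eq_sum (hw : Continuous w) (hwc : HasCompactSupport w) (hc : 1 ≤ c)
    (hcw : ∀ t, w t ≠ 0 → 2 * |realForm F t - m| ≤ c) {x : ℝ} (hx : 0 < x) {n : ℕ}
    (hn : c ≤ (n + 1) * x) :
    levelAvg F m w x = ∑ j ∈ Finset.range (n + 1), avgSummand F m w ((j + 1) * x) := by
  have hi : Integrable w := hw.integrable_of_hasCompactSupport hwc
  have hk := fun u => kerInt_omegaFun_integrable (F := F) (m := m) hw hwc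
    evenOmega_contDiff.continuous u
  have e : ∀ t, w t * hFun x (realForm F t - m) = ∑ j ∈ Finset.range (n + 1),
      (w t * omegaDiv ((j + 1) * x) - w t * evenOmega ((realForm F t - m) / ((j + 1) * x)) *
        ((j + 1) * x)⁻¹) := by
    intro t
    by_cases ht : w t = 0
    · simp [ht]
    · rw [hFun_eq_sum hx hc (hcw t ht) hn, Finset.mul_sum]
      refine Finset.sum_congr rfl fun j _ => ?_
      unfold omegaDiv
      field_simp
  unfold levelAvg
  simp only [e]
  have hij : ∀ j : ℕ, Integrable fun t => w t * omegaDiv ((j + 1) * x) -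
      w t * evenOmega ((realForm F t - m) / ((j + 1) * x)) * ((j + 1) * x)⁻¹ :=
    fun j => (hi.mul_const _).sub ((hk _).mul_const _)
  rw [integral_finsetSum _ fun j _ => hij j]
  refine Finset.sum_congr rfl fun j _ => ?_
  rw [integral_sub (hi.mul_const _) ((hk _).mul_const _), integral_mul_const, integral_mul_const]
  rfl

lemma avgSummand_eq_zero (hc : 1 ≤ c) (hcw : ∀ t, w t ≠ 0 → 2 * |realForm F t - m| ≤ c)
    {u : ℝ} (hu : c ≤ u) : avgSummand F m w u = 0 := by
  have h1 : kerInt w (fun t => realForm F t - m) evenOmega u = 0 := by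
    unfold kerInt
    rw [show (fun t => w t * evenOmega ((realForm F t - m) / u)) = fun _ => (0 : ℝ) from ?_]
    · simp
    ext t
    by_cases ht : w t = 0
    · simp [ht]
    · rw [evenOmega_eq, omegaFun_eq_zero_of_le, mul_zero]
      rw [abs_div, abs_of_pos (by linarith : 0 < u), div_le_iff₀ (by linarith)]
      linarith [hcw t ht]
  unfold avgSummand omegaDiv
  rw [h1, omegaFun_eq_zero_of_ge (hc.trans hu)]
  simp

lemma avgPrim_eq_zero (hc : 1 ≤ c) (hcw : ∀ t, w t ≠ 0 → 2 * |realForm F t - m| ≤ c)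
    {u : ℝ} (hu : c ≤ u) : avgPrim F m w u = 0 := by
  unfold avgPrim kerInt
  rw [omegaPrim_eq_of_ge (hc.trans hu),
    show (fun t => w t * omegaTail ((realForm F t - m) / u)) = fun t => w t * omegaPrim 1 from ?_]
  · rw [integral_mul_const, sub_self]
  ext t
  by_cases ht : w t = 0
  · simp [ht]
  · rw [omegaTail_eq_of_abs_le]
    rw [abs_div, abs_of_pos (by linarith : 0 < u), div_le_iff₀ (by linarith)]
    linarith [hcw t ht]

lemma levelAvg_eq_zero (hw : Continuous w) (hwc : HasCompactSupport w) (hc : 1 ≤ c)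
    (hcw : ∀ t, w t ≠ 0 → 2 * |realForm F t - m| ≤ c) {x : ℝ} (hx : c ≤ x) :
    levelAvg F m w x = 0 := by
  rw [levelAvg_eq_sum hw hwc hc hcw (by linarith) (n := 0) (by simpa using hx)]
  simp [avgSummand_eq_zero hc hcw hx]

lemma hasDerivAt_avgPrim (hw : Continuous w) (hwc : HasCompactSupport w) {u : ℝ} (hu : 0 < u) :
    HasDerivAt (avgPrim F m w) (avgSummand F m w u) u := by
  have h1 := hasDerivAt_kerInt hw hwc (continuous_level (F := F) (m := m))
    (omegaTail_contDiff.of_le (by simp)) hu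
  have := ((hasDerivAt_omegaPrim u).const_mul (∫ t, w t)).sub h1
  convert! this using 1
  unfold avgSummand kerInt
  congr 1
  rw [div_eq_mul_inv, ← integral_mul_const]
  congr 1; ext t
  have := mul_deriv_omegaTail ((realForm F t - m) / u)
  rw [show evenOmega ((realForm F t - m) / u) = -((realForm F t - m) / u *
    deriv omegaTail ((realForm F t - m) / u)) by rw [this]; ring]
  field_simp

lemma bddDeriv_avgSummand (hm : m ≠ 0) (hw : ContDiff ℝ ∞ w) (hwc : HasCompactSupport w) (n : ℕ) :
    BddDeriv n (avgSummand F m w) := by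
  have h1 := (bddDeriv_of_compactSupport n omegaDiv_contDiff omegaDiv_hasCompactSupport).const_mul
    (∫ t, w t)
  have h2 :=
    (bddDeriv_kerInt F hm hw hwc evenOmega_contDiff evenOmega_hasCompactSupport n).const_mul
    (-1)
  convert! h1.add h2 using 2 with u
  unfold avgSummand
  ring

lemma tendsto_zero_of_le {f : ℝ → ℝ} {D : ℝ} {g : ℝ → ℝ} (hg : Tendsto g (𝓝[>] 0) (𝓝 0))
    (h : ∀ᶠ u in 𝓝[>] (0 : ℝ), |f u| ≤ D * |g u|) : Tendsto f (𝓝[>] 0) (𝓝 0) := by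
  have : Tendsto (fun u => D * |g u|) (𝓝[>] 0) (𝓝 0) := by
    simpa using hg.abs.const_mul D
  exact squeeze_zero_norm' (by simpa using h) this

lemma tendsto_id_nhdsGT : Tendsto (fun u : ℝ => u) (𝓝[>] 0) (𝓝 0) :=
  tendsto_nhdsWithin_of_tendsto_nhds tendsto_id

lemma tendsto_avgPrim (hm : m ≠ 0) (hw : ContDiff ℝ ∞ w) (hwc : HasCompactSupport w) :
    Tendsto (avgPrim F m w) (𝓝[>] 0) (𝓝 0) := by
  obtain ⟨D, hD⟩ := (bddDeriv_kerInt F hm hw hwc omegaTail_contDiff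
    omegaTail_hasCompactSupport 0).bdd
  refine tendsto_zero_of_le (D := D) tendsto_id_nhdsGT ?_
  filter_upwards [Ioo_mem_nhdsGT (show (0 : ℝ) < 1 / 2 by norm_num)] with u hu
  have h := hD u hu.1
  unfold avgPrim
  rw [omegaPrim_eq_zero hu.2.le, mul_zero, zero_sub, abs_neg]
  rw [abs_div, div_le_iff₀ (abs_pos.2 hu.1.ne')] at h
  exact h

/-- The average of the delta kernel has a bounded derivative: by the trapezoidal rule, the sum
`∑ j g'(j x)` equals `x⁻²` times the integral of `u g'(u)`, which is zero, up to a bounded error. -/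
lemma exists_levelAvg_deriv_bound (hm : m ≠ 0) (hw : ContDiff ℝ ∞ w) (hwc : HasCompactSupport w)
    (hc : 1 ≤ c) (hcw : ∀ t, w t ≠ 0 → 2 * |realForm F t - m| ≤ c) :
    ∃ Λ, ∀ x, 0 < x → x ≤ c → ∃ d, HasDerivAt (levelAvg F m w) d x ∧ |d| ≤ Λ := by
  obtain ⟨⟨A0, hA0⟩, g1, h1, ⟨A1, hA1⟩, g2, h2, ⟨A2, hA2⟩, g3, h3, A3, hA3⟩ :=
    bddDeriv_avgSummand (F := F) hm hw hwc 3
  set g := avgSummand F m w with hg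
  have hA3' : 0 ≤ A3 := (abs_nonneg _).trans (hA3 1 one_pos)
  have hA2' : 0 ≤ A2 := (abs_nonneg _).trans (hA2 1 one_pos)
  refine ⟨4 * c * (2 * A2 + 4 * c * A3), fun x hx hxc => ?_⟩
  -- the sum may be cut at any `n` with `n x` between `2 c` and `4 c`
  obtain ⟨n, hn⟩ : ∃ n : ℕ, 2 * c < (n + 1) * x ∧ (n + 1) * x ≤ 4 * c := by
    refine ⟨⌊2 * c / x⌋₊, ?_, ?_⟩
    · have := Nat.lt_floor_add_one (2 * c / x)
      rwa [div_lt_iff₀ hx] at this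
    · have := Nat.floor_le (show 0 ≤ 2 * c / x by positivity)
      rw [le_div_iff₀ hx] at this
      linarith
  have hg1 : g1 ((n + 1) * x) = 0 := by
    have e : g =ᶠ[𝓝 ((n + 1) * x)] fun _ => 0 := by
      filter_upwards [Ioi_mem_nhds (show c < (n + 1) * x by linarith)] with u hu
      exact avgSummand_eq_zero hc hcw (le_of_lt hu)
    exact ((h1 _ (by positivity)).congr_of_eventuallyEq e.symm).unique (hasDerivAt_const _ _)
  have hg0 : g ((n + 1) * x) = 0 := avgSummand_eq_zero hc hcw (by linarith)
  have hsum : HasDerivAt (levelAvg F m w)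
      (∑ j ∈ Finset.range (n + 1), g1 ((j + 1) * x) * (j + 1)) x := by
    have : HasDerivAt (fun y => ∑ j ∈ Finset.range (n + 1), g ((j + 1) * y))
        (∑ j ∈ Finset.range (n + 1), g1 ((j + 1) * x) * (j + 1)) x := by
      refine HasDerivAt.fun_sum fun j _ => ?_
      have hd := (h1 ((j + 1) * x) (by positivity)).comp x
          ((hasDerivAt_id x).const_mul ((j : ℝ) + 1))
      rw [mul_one] at hd
      exact hd
    refine this.congr_of_eventuallyEq ?_
    filter_upwards [Ioi_mem_nhds (show x / 2 < x by linarith)] with y hy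
    have hy' : x / 2 < y := hy
    refine levelAvg_eq_sum hw.continuous hwc hc hcw (by linarith) ?_
    have : (0 : ℝ) ≤ n := n.cast_nonneg
    nlinarith [hn.1]
  refine ⟨_, hsum, ?_⟩
  have key := trapezoid_sum (Φ := fun u => u * g u - avgPrim F m w u) (φ := fun u => u * g1 u)
    (φ' := fun u => g1 u + u * g2 u) (φ'' := fun u => g2 u + (g2 u + u * g3 u))
    (M := 2 * A2 + 4 * c * A3) (φ₀ := 0) n hx ?_ ?_ ?_ ?_ ?_ ?_ ?_ ?_
  · have e : ∑ j ∈ Finset.range (n + 1), ((j : ℝ) + 1) * x * g1 ((j + 1) * x) + 0 / 2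
        = x * ∑ j ∈ Finset.range (n + 1), g1 ((j + 1) * x) * (j + 1) := by
      rw [Finset.mul_sum, zero_div, add_zero]
      exact Finset.sum_congr rfl fun j _ => by ring
    rw [e, ← mul_assoc, abs_mul, abs_of_pos (mul_pos hx hx)] at key
    have k2 : ((n : ℝ) + 1) * (2 * A2 + 4 * c * A3) * x ^ 3
        ≤ x * x * (4 * c * (2 * A2 + 4 * c * A3)) := by
      have : 0 ≤ (2 * A2 + 4 * c * A3) * (x * x) := by positivity
      nlinarith [mul_le_mul_of_nonneg_right hn.2 this]
    exact le_of_mul_le_mul_left (key.trans k2) (mul_pos hx hx)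
  · intro u hu
    have := ((hasDerivAt_id u).mul (h1 u hu)).sub
      (hasDerivAt_avgPrim (F := F) (m := m) hw.continuous hwc hu)
    convert! this using 1
    simp [hg]
  · intro u hu
    have := (hasDerivAt_id u).mul (h2 u hu)
    convert! this using 1
    simp
  · intro u hu
    have := (h2 u hu).add ((hasDerivAt_id u).mul (h3 u hu))
    convert! this using 1
    simp
  · intro u hu hun
    have b2 := hA2 u hu
    have b3 := hA3 u hu
    have : |u * g3 u| ≤ 4 * c * A3 := by
      rw [abs_mul, abs_of_pos hu]
      exact mul_le_mul (hun.trans hn.2) b3 (abs_nonneg _) (by linarith)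
    calc |g2 u + (g2 u + u * g3 u)| ≤ |g2 u| + (|g2 u| + |u * g3 u|) :=
          (abs_add_le _ _).trans (add_le_add le_rfl (abs_add_le _ _))
      _ ≤ _ := by linarith
  · have t1 : Tendsto (fun u => u * g u) (𝓝[>] 0) (𝓝 0) := by
      refine tendsto_zero_of_le (D := A0) tendsto_id_nhdsGT ?_
      filter_upwards [self_mem_nhdsWithin] with u hu
      rw [abs_mul, mul_comm]
      gcongr
      exact hA0 u hu
    simpa using t1.sub (tendsto_avgPrim hm hw hwc)
  · refine tendsto_zero_of_le (D := A1) tendsto_id_nhdsGT ?_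
    filter_upwards [self_mem_nhdsWithin] with u hu
    rw [abs_mul, mul_comm]
    gcongr
    exact hA1 u hu
  · simp only [hg0, avgPrim_eq_zero hc hcw (show c ≤ (n + 1) * x by linarith)]
    simp
  · simp only [hg1, mul_zero]

/-- The value at `0` of the average of the delta kernel, by the trapezoidal rule. -/
lemma exists_levelAvg_sub_bound (hm : m ≠ 0) (hw : ContDiff ℝ ∞ w) (hwc : HasCompactSupport w)
    (hc : 1 ≤ c) (hcw : ∀ t, w t ≠ 0 → 2 * |realForm F t - m| ≤ c) {k : ℝ}
    (hk : Tendsto (fun u => kerInt w (fun t => realForm F t - m) evenOmega u / u) (𝓝[>] 0) (𝓝 k)) :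
    ∃ Λ, ∀ x, 0 < x → x ≤ c → |levelAvg F m w x - k / 2| ≤ Λ * x := by
  obtain ⟨-, g1, h1, -, g2, h2, A2, hA2⟩ := bddDeriv_avgSummand (F := F) hm hw hwc 2
  set g := avgSummand F m w with hg
  have hA2' : 0 ≤ A2 := (abs_nonneg _).trans (hA2 1 one_pos)
  refine ⟨4 * c * A2, fun x hx hxc => ?_⟩
  obtain ⟨n, hn⟩ : ∃ n : ℕ, 2 * c < (n + 1) * x ∧ (n + 1) * x ≤ 4 * c := by
    refine ⟨⌊2 * c / x⌋₊, ?_, ?_⟩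
    · have := Nat.lt_floor_add_one (2 * c / x)
      rwa [div_lt_iff₀ hx] at this
    · have := Nat.floor_le (show 0 ≤ 2 * c / x by positivity)
      rw [le_div_iff₀ hx] at this
      linarith
  have t0 : Tendsto g (𝓝[>] 0) (𝓝 (-k)) := by
    have : Tendsto (fun u => 0 - kerInt w (fun t => realForm F t - m) evenOmega u / u)
        (𝓝[>] 0) (𝓝 (0 - k)) := tendsto_const_nhds.sub hk
    rw [zero_sub] at this
    refine this.congr' ?_
    filter_upwards [Ioo_mem_nhdsGT (show (0 : ℝ) < 1 / 2 by norm_num)] with u hu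
    simp [hg, avgSummand, omegaDiv, omegaFun_eq_zero_of_le hu.2.le]
  have key := trapezoid_sum (M := A2) n hx
    (fun u hu => hasDerivAt_avgPrim (F := F) (m := m) hw.continuous hwc hu) h1 h2
    (fun u hu _ => hA2 u hu) (tendsto_avgPrim hm hw hwc) t0
    (avgPrim_eq_zero hc hcw (by linarith)) (avgSummand_eq_zero hc hcw (by linarith))
  rw [← levelAvg_eq_sum hw.continuous hwc hc hcw hx (by linarith), abs_mul, abs_of_pos hx] at key
  have k2 : ((n : ℝ) + 1) * A2 * x ^ 3 ≤ x * (4 * c * A2 * x) := by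
    have : 0 ≤ A2 * (x * x) := by positivity
    nlinarith [mul_le_mul_of_nonneg_right hn.2 this]
  have := le_of_mul_le_mul_left (key.trans k2) hx
  rwa [neg_div, ← sub_eq_add_neg] at this

end

section

/-! ### Decay of the oscillatory integral of the quadratic phase -/

/-- The phase `e(θ F(t))`. -/
def phase (F : QuadraticForm ℤ (Fin 3 → ℤ)) (θ : ℝ) (t : Fin 3 → ℝ) : ℂ :=
  Complex.exp (2 * Real.pi * Complex.I * θ * realForm F t)

/-- The oscillatory integral `∫ v(t) e(θ F(t)) dt`. -/
def phaseInt (F : QuadraticForm ℤ (Fin 3 → ℤ)) (v : (Fin 3 → ℝ) → ℂ) (θ : ℝ) : ℂ :=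
  ∫ t, v t * phase F θ t

/-- The partial derivative `∂_i v`. -/
def pderiv (i : Fin 3) (v : (Fin 3 → ℝ) → ℂ) (t : Fin 3 → ℝ) : ℂ :=
  fderiv ℝ v t (Pi.single i 1)

/-- Smooth, compactly supported complex weights. -/
def IsTest (v : (Fin 3 → ℝ) → ℂ) : Prop := ContDiff ℝ ∞ v ∧ HasCompactSupport v

lemma IsTest.pderiv {v : (Fin 3 → ℝ) → ℂ} (hv : IsTest v) (i : Fin 3) :
    IsTest (Ternary.pderiv i v) :=
  ⟨(hv.1.fderiv_right (m := ∞) (by simp)).clm_apply contDiff_const, hv.2.fderiv_apply (𝕜 := ℝ) _⟩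

lemma IsTest.mul_left {v f : (Fin 3 → ℝ) → ℂ} (hv : IsTest v) (hf : ContDiff ℝ ∞ f) :
    IsTest (fun t => f t * v t) :=
  ⟨hf.mul hv.1, hv.2.mul_left⟩

lemma IsTest.sum {ι : Type*} {s : Finset ι} {v : ι → (Fin 3 → ℝ) → ℂ} (hv : ∀ i ∈ s, IsTest (v i)) :
    IsTest (fun t => ∑ i ∈ s, v i t) := by
  classical
  induction s using Finset.induction_on with
  | empty =>
    simp only [Finset.sum_empty]
    exact ⟨contDiff_const, HasCompactSupport.zero⟩
  | insert a s ha ih =>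
    simp only [Finset.sum_insert ha]
    have h1 := hv a (Finset.mem_insert_self _ _)
    have h2 := ih fun i hi => hv i (Finset.mem_insert_of_mem hi)
    exact ⟨h1.1.add h2.1, h1.2.add h2.2⟩

lemma IsTest.integrable {v f : (Fin 3 → ℝ) → ℂ} (hv : IsTest v) (hf : Continuous f) :
    Integrable fun t => v t * f t :=
  (hv.1.continuous.mul hf).integrable_of_hasCompactSupport hv.2.mul_right

variable {F : QuadraticForm ℤ (Fin 3 → ℤ)} {v : (Fin 3 → ℝ) → ℂ}

lemma ofReal_realForm_contDiff : ContDiff ℝ ∞ fun t => (realForm F t : ℂ) :=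
  Complex.ofRealCLM.contDiff.comp (realForm_contDiff F)

lemma gradForm_contDiff (i : Fin 3) : ContDiff ℝ ∞ (gradForm F i) := by
  unfold gradForm
  fun_prop

lemma phase_contDiff (θ : ℝ) : ContDiff ℝ ∞ (phase F θ) :=
  (contDiff_const.mul ofReal_realForm_contDiff).cexp

lemma norm_phase (θ : ℝ) (t : Fin 3 → ℝ) : ‖phase F θ t‖ = 1 := by
  have : (2 * Real.pi * Complex.I * θ * realForm F t : ℂ)
      = ((2 * Real.pi * θ * realForm F t : ℝ) : ℂ) * Complex.I := by push_cast; ring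
  rw [phase, this, Complex.norm_exp_ofReal_mul_I]

lemma fderiv_phase (θ : ℝ) (t : Fin 3 → ℝ) (i : Fin 3) :
    fderiv ℝ (phase F θ) t (Pi.single i 1)
      = 2 * Real.pi * Complex.I * θ * gradForm F i t * phase F θ t := by
  have h1 : HasFDerivAt (fun t => (realForm F t : ℂ))
      (Complex.ofRealCLM.comp (fderiv ℝ (realForm F) t)) t :=
    Complex.ofRealCLM.hasFDerivAt.comp t
      ((realForm_contDiff F).differentiable (by simp) t).hasFDerivAt
  have h2 := (h1.const_mul (2 * Real.pi * Complex.I * θ : ℂ)).cexp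
  rw [show phase F θ = fun t => Complex.exp (2 * Real.pi * Complex.I * θ * realForm F t) from rfl,
    h2.fderiv]
  have h3 : fderiv ℝ (realForm F) t (Pi.single i 1) = gradForm F i t := by
    rw [fderiv_realForm]
    simp [Pi.single_apply]
  simp [h3]
  ring

/-- Integration by parts against the quadratic phase. -/
lemma phaseInt_grad (hv : IsTest v) (θ : ℝ) (i : Fin 3) :
    2 * Real.pi * Complex.I * θ * phaseInt F (fun t => gradForm F i t * v t) θ
      = -phaseInt F (pderiv i v) θ := by
  have hg : ContDiff ℝ ∞ fun t => (gradForm F i t : ℂ) :=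
    Complex.ofRealCLM.contDiff.comp (gradForm_contDiff i)
  have hp := phase_contDiff (F := F) θ
  have h := integral_mul_fderiv_eq_neg_fderiv_mul_of_integrable (𝕜 := ℂ) (μ := volume)
    (f := v) (g := phase F θ) (v := Pi.single i 1) ?_ ?_ ?_ ?_ ?_
  · unfold phaseInt
    rw [← integral_const_mul]
    simp only [fderiv_phase] at h
    unfold pderiv
    rw [← h]
    congr 1; ext t; ring
  · exact (hv.pderiv i).integrable hp.continuous
  · simp only [fderiv_phase]
    exact hv.integrable ((continuous_const.mul hg.continuous).mul hp.continuous)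
  · exact hv.integrable hp.continuous
  · exact fun x _ => hv.1.differentiable (by simp) x
  · exact fun x _ => hp.differentiable (by simp) x

lemma phaseInt_sum {ι : Type*} {s : Finset ι} {v : ι → (Fin 3 → ℝ) → ℂ}
    (hv : ∀ i ∈ s, IsTest (v i)) (θ : ℝ) :
    phaseInt F (fun t => ∑ i ∈ s, v i t) θ = ∑ i ∈ s, phaseInt F (v i) θ := by
  unfold phaseInt
  simp only [Finset.sum_mul]
  exact integral_finsetSum _ fun i hi => (hv i hi).integrable (phase_contDiff θ).continuous

lemma phaseInt_const_mul (c : ℂ) (θ : ℝ) :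
    phaseInt F (fun t => c * v t) θ = c * phaseInt F v θ := by
  unfold phaseInt
  rw [← integral_const_mul]
  congr 1; ext t; ring

lemma hasDerivAt_phaseInt (hv : IsTest v) (θ : ℝ) :
    HasDerivAt (phaseInt F v)
      (2 * Real.pi * Complex.I * phaseInt F (fun t => realForm F t * v t) θ) θ := by
  have hFv : IsTest fun t => (realForm F t : ℂ) * v t := hv.mul_left ofReal_realForm_contDiff
  have h := hasDerivAt_integral_of_dominated_loc_of_deriv_le (μ := volume) (𝕜 := ℝ)
    (F := fun θ t => v t * phase F θ t)
    (F' := fun θ t => (2 * Real.pi * Complex.I) * ((realForm F t * v t) * phase F θ t))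
    (bound := fun t => ‖(2 * Real.pi * Complex.I : ℂ)‖ * ‖(realForm F t : ℂ) * v t‖)
    (x₀ := θ) (s := Set.univ) univ_mem ?_ ?_ ?_ ?_ ?_ ?_
  · have h2 := h.2
    rw [integral_const_mul] at h2
    exact h2
  · exact Eventually.of_forall fun θ => (hv.integrable (phase_contDiff θ).continuous).1
  · exact hv.integrable (phase_contDiff θ).continuous
  · exact ((hFv.integrable (phase_contDiff θ).continuous).const_mul _).1
  · refine Eventually.of_forall fun t θ _ => ?_
    rw [norm_mul, norm_mul _ (phase F θ t), norm_phase, mul_one]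
  · exact (hFv.1.continuous.integrable_of_hasCompactSupport hFv.2).norm.const_mul _
  · refine Eventually.of_forall fun t θ _ => ?_
    have h1 : HasDerivAt (fun θ : ℝ => (2 * Real.pi * Complex.I * θ * realForm F t : ℂ))
        (2 * Real.pi * Complex.I * realForm F t) θ := by
      have := ((Complex.ofRealCLM.hasDerivAt (x := θ)).const_mul
        (2 * Real.pi * Complex.I : ℂ)).mul_const (realForm F t : ℂ)
      simpa using this
    have := h1.cexp.const_mul (v t)
    convert! this using 1
    simp only [phase]
    ring

/-- The second order operator `∑ B_{k i} ∂_i ∂_k`, where `B` is the inverse of the polar matrix. -/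
def dualLaplacian (F : QuadraticForm ℤ (Fin 3 → ℤ)) (v : (Fin 3 → ℝ) → ℂ) (t : Fin 3 → ℝ) : ℂ :=
  ∑ k, ∑ i, ((((polarMatrix F).map (Int.cast : ℤ → ℝ))⁻¹ k i : ℝ) : ℂ) * pderiv i (pderiv k v) t

lemma IsTest.dualLaplacian (hv : IsTest v) : IsTest (dualLaplacian F v) := by
  unfold Ternary.dualLaplacian
  exact IsTest.sum fun k _ => IsTest.sum fun i _ =>
    ((hv.pderiv k).pderiv i).mul_left contDiff_const

lemma det_real_ne_zero (hF : discr F ≠ 0) :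
    ((polarMatrix F).map (Int.cast : ℤ → ℝ)).det ≠ 0 := by
  have h1 : ((polarMatrix F).map (Int.cast : ℤ → ℝ)).det = ((polarMatrix F).det : ℝ) :=
    ((Int.castRingHom ℝ).map_det (polarMatrix F)).symm
  rw [h1]
  have : (polarMatrix F).det ≠ 0 := by
    intro h0
    apply hF
    simp [discr, h0]
  exact_mod_cast this

lemma coord_eq_sum_grad (hF : discr F ≠ 0) (t : Fin 3 → ℝ) (k : Fin 3) :
    t k = ∑ i, ((polarMatrix F).map (Int.cast : ℤ → ℝ))⁻¹ k i * gradForm F i t := by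
  set A := (polarMatrix F).map (Int.cast : ℤ → ℝ) with hA
  have h : A⁻¹.mulVec (A.mulVec t) = t := by
    rw [Matrix.mulVec_mulVec, Matrix.nonsing_inv_mul A (isUnit_iff_ne_zero.2 (det_real_ne_zero hF)),
      Matrix.one_mulVec]
  conv_lhs => rw [← h]
  rfl

lemma coord_contDiff (k : Fin 3) : ContDiff ℝ ∞ fun t : Fin 3 → ℝ => (t k : ℂ) :=
  Complex.ofRealCLM.contDiff.comp (contDiff_apply ℝ ℝ k)

/-- As a function of `θ`, the integral solves a Schrödinger type equation: this combines Euler's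
identity `t · ∇F = 2 F` with two integrations by parts. -/
lemma phaseInt_ode (hF : discr F ≠ 0) (hv : IsTest v) {θ : ℝ} (hθ : θ ≠ 0) :
    θ * (2 * Real.pi * Complex.I * phaseInt F (fun t => realForm F t * v t) θ)
      = -(3 / 2) * phaseInt F v θ
        + phaseInt F (dualLaplacian F v) θ / (4 * Real.pi * Complex.I * θ) := by
  set c : ℂ := 2 * Real.pi * Complex.I * θ with hc
  have hc0 : c ≠ 0 := by
    have : (θ : ℂ) ≠ 0 := by exact_mod_cast hθ
    simp [hc, Real.pi_ne_zero, this]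
  -- the Euler field applied to `v`, integrated against the phase
  set e : ℂ := phaseInt F (fun t => ∑ k, (t k : ℂ) * pderiv k v t) θ with he
  have hg : ∀ i, ContDiff ℝ ∞ fun t => (gradForm F i t : ℂ) := fun i =>
    Complex.ofRealCLM.contDiff.comp (gradForm_contDiff i)
  have hgr : ∀ i {u}, IsTest u →
      c * phaseInt F (fun t => gradForm F i t * u t) θ = -phaseInt F (pderiv i u) θ :=
    fun i _ hu => phaseInt_grad hu θ i
  have s1 : c * (2 * phaseInt F (fun t => realForm F t * v t) θ) = -(3 * phaseInt F v θ + e) := by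
    have hp : ∀ i t, pderiv i (fun t : Fin 3 → ℝ => (t i : ℂ) * v t) t
        = v t + t i * pderiv i v t := by
      intro i t
      have h1 : HasFDerivAt (fun t : Fin 3 → ℝ => (t i : ℂ))
          (Complex.ofRealCLM.comp (ContinuousLinearMap.proj i)) t :=
        (Complex.ofRealCLM.comp (ContinuousLinearMap.proj (R := ℝ) (φ := fun _ : Fin 3 => ℝ)
          i)).hasFDerivAt
      have h2 := (h1.fun_mul (hv.1.differentiable (by simp) t).hasFDerivAt)
      unfold pderiv
      rw [h2.fderiv]
      simp
      ring
    have h1 : (fun t => 2 * ((realForm F t : ℂ) * v t))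
        = fun t => ∑ i, (gradForm F i t : ℂ) * ((t i : ℂ) * v t) := by
      ext t
      have := sum_gradForm_mul F t
      have h' : (2 * (realForm F t : ℂ)) = ∑ i, (gradForm F i t : ℂ) * (t i : ℂ) := by
        rw [← Complex.ofReal_ofNat, ← Complex.ofReal_mul, ← this]
        push_cast
        rfl
      rw [← mul_assoc, h', Finset.sum_mul]
      exact Finset.sum_congr rfl fun i _ => by ring
    have ht : ∀ i, IsTest fun t : Fin 3 → ℝ => (t i : ℂ) * v t := fun i =>
      hv.mul_left (coord_contDiff i)
    rw [← phaseInt_const_mul, h1, phaseInt_sum fun i _ => (ht i).mul_left (hg i), Finset.mul_sum]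
    simp only [fun i => hgr i (ht i)]
    rw [Finset.sum_neg_distrib, ← phaseInt_sum fun i _ => (ht i).pderiv i]
    congr 1
    simp only [hp]
    unfold phaseInt at he ⊢
    rw [he, ← integral_const_mul, ← integral_add]
    · congr 1; ext t
      beta_reduce
      rw [Finset.sum_add_distrib]
      simp
      ring
    · exact (hv.integrable (phase_contDiff θ).continuous).const_mul _
    · exact (IsTest.sum fun k _ => (hv.pderiv k).mul_left (coord_contDiff k)).integrable
        (phase_contDiff θ).continuous
  have s2 : c * e = -phaseInt F (dualLaplacian F v) θ := by
    have hk : ∀ k, c * phaseInt F (fun t => (t k : ℂ) * pderiv k v t) θ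
        = -phaseInt F (fun t => ∑ i, ((((polarMatrix F).map (Int.cast : ℤ → ℝ))⁻¹ k i : ℝ) : ℂ)
          * pderiv i (pderiv k v) t) θ := by
      intro k
      have h1 : (fun t => (t k : ℂ) * pderiv k v t) = fun t =>
          ∑ i, ((((polarMatrix F).map (Int.cast : ℤ → ℝ))⁻¹ k i : ℝ) : ℂ) *
            ((gradForm F i t : ℂ) * pderiv k v t) := by
        ext t
        rw [coord_eq_sum_grad hF t k]
        push_cast
        rw [Finset.sum_mul]
        exact Finset.sum_congr rfl fun i _ => by ring
      rw [h1, phaseInt_sum fun i _ => ((hv.pderiv k).mul_left (hg i)).mul_left contDiff_const,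
        phaseInt_sum fun i _ => ((hv.pderiv k).pderiv i).mul_left contDiff_const, Finset.mul_sum,
        ← Finset.sum_neg_distrib]
      refine Finset.sum_congr rfl fun i _ => ?_
      rw [phaseInt_const_mul, phaseInt_const_mul, mul_left_comm, hgr i (hv.pderiv k), mul_neg]
    rw [he, phaseInt_sum fun k _ => (hv.pderiv k).mul_left (coord_contDiff k), Finset.mul_sum]
    simp only [hk]
    unfold dualLaplacian
    rw [phaseInt_sum fun k _ => IsTest.sum fun i _ =>
      ((hv.pderiv k).pderiv i).mul_left contDiff_const, Finset.sum_neg_distrib]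
  have h4 : (4 * Real.pi * Complex.I * θ : ℂ) = 2 * c := by rw [hc]; ring
  have h5 : phaseInt F (dualLaplacian F v) θ = -(c * e) := by rw [s2, neg_neg]
  rw [h4, h5]
  field_simp
  linear_combination s1

lemma norm_phaseInt_le (hv : IsTest v) : ∃ C, ∀ θ, ‖phaseInt F v θ‖ ≤ C := by
  refine ⟨∫ t, ‖v t‖, fun θ => norm_integral_le_of_norm_le
    (hv.1.continuous.integrable_of_hasCompactSupport hv.2).norm (Eventually.of_forall fun t => ?_)⟩
  rw [norm_mul, norm_phase, mul_one]

lemma continuous_phaseInt (hv : IsTest v) : Continuous (phaseInt F v) :=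
  continuous_iff_continuousAt.2 fun θ => (hasDerivAt_phaseInt hv θ).continuousAt

/-- One step of the bootstrap: a bound for the integral of `dualLaplacian F v` improves the one
for the integral of `v`, since `θ ^ (3 / 2) * phaseInt F v θ` has derivative
`θ ^ (-1 / 2) * phaseInt F (dualLaplacian F v) θ / (4 π i)`. -/
lemma phaseInt_bootstrap (hF : discr F ≠ 0) (hv : IsTest v) {B B' : ℝ → ℝ}
    (hB : ∀ θ, 1 ≤ θ → HasDerivAt B (B' θ) θ) (hB1 : 0 ≤ B 1)
    (hL : ∀ θ, 1 ≤ θ → θ ^ (-1 / 2 : ℝ) * ‖phaseInt F (dualLaplacian F v) θ‖ ≤ B' θ) :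
    ∀ θ, 1 ≤ θ → θ ^ (3 / 2 : ℝ) * ‖phaseInt F v θ‖ ≤ ‖phaseInt F v 1‖ + B θ := by
  intro θ hθ
  have hd : ∀ x, 1 ≤ x → HasDerivAt (fun x : ℝ => ((x ^ (3 / 2 : ℝ) : ℝ) : ℂ) * phaseInt F v x)
      (((x ^ (-1 / 2 : ℝ) : ℝ) : ℂ)
        * (phaseInt F (dualLaplacian F v) x / (4 * Real.pi * Complex.I)))
      x := by
    intro x hx
    have hx0 : 0 < x := by linarith
    have h1 : HasDerivAt (fun x : ℝ => ((x ^ (3 / 2 : ℝ) : ℝ) : ℂ))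
        (((3 / 2 * x ^ (3 / 2 - 1 : ℝ) : ℝ)) : ℂ) x :=
      (Real.hasDerivAt_rpow_const (Or.inl hx0.ne')).ofReal_comp
    have h2 := h1.fun_mul (hasDerivAt_phaseInt (F := F) hv x)
    convert! h2 using 1
    have ode := phaseInt_ode hF hv hx0.ne'
    have e1 : x ^ (3 / 2 : ℝ) = x ^ (-1 / 2 : ℝ) * x * x := by
      rw [← Real.rpow_add_one hx0.ne', ← Real.rpow_add_one hx0.ne']
      norm_num
    have e2 : x ^ (3 / 2 - 1 : ℝ) = x ^ (-1 / 2 : ℝ) * x := by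
      rw [← Real.rpow_add_one hx0.ne']
      norm_num
    rw [e1, e2]
    have hx' : (x : ℂ) ≠ 0 := by exact_mod_cast hx0.ne'
    have hpi : (Real.pi : ℂ) ≠ 0 := by exact_mod_cast Real.pi_ne_zero
    push_cast
    have e3 : phaseInt F (dualLaplacian F v) x / (4 * Real.pi * Complex.I)
        = x * (phaseInt F (dualLaplacian F v) x / (4 * Real.pi * Complex.I * x)) := by
      field_simp
    rw [e3]
    linear_combination -(((x ^ (-1 / 2 : ℝ) : ℝ) : ℂ)) * x * ode
  have key := image_norm_le_of_norm_deriv_right_le_deriv_boundary'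
    (f := fun x : ℝ => ((x ^ (3 / 2 : ℝ) : ℝ) : ℂ) * phaseInt F v x) (a := 1) (b := θ)
    (B := fun x => ‖phaseInt F v 1‖ + B x) (B' := B')
    (fun x hx => (hd x hx.1).continuousAt.continuousWithinAt)
    (fun x hx => (hd x hx.1).hasDerivWithinAt) (by simpa using hB1)
    (fun x hx => ((hB x hx.1).continuousAt.const_add _).continuousWithinAt)
    (fun x hx => ((hB x hx.1).const_add _).hasDerivWithinAt) ?_ ⟨hθ, le_rfl⟩
  · have hθ0 : 0 < θ := by linarith
    have e1 : ‖((θ ^ (3 / 2 : ℝ) : ℝ) : ℂ)‖ = θ ^ (3 / 2 : ℝ) := by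
      rw [Complex.norm_real, Real.norm_of_nonneg (by positivity)]
    rwa [norm_mul, e1] at key
  · intro x hx
    have hx0 : 0 < x := by linarith [hx.1]
    have e1 : ‖((x ^ (-1 / 2 : ℝ) : ℝ) : ℂ)‖ = x ^ (-1 / 2 : ℝ) := by
      rw [Complex.norm_real, Real.norm_of_nonneg (by positivity)]
    have e2 : ‖(4 * Real.pi * Complex.I : ℂ)‖ = 4 * Real.pi := by
      simp [abs_of_pos Real.pi_pos]
    refine le_trans ?_ (hL x hx.1)
    rw [norm_mul, e1, norm_div, e2]
    gcongr
    exact div_le_self (norm_nonneg _) (by linarith [Real.pi_gt_three])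

/-- Two bootstrap steps: the trivial bound gives the decay `θ⁻¹`, which makes the bound for
`dualLaplacian F v` integrable against `θ ^ (-1 / 2)` and gives the decay `θ ^ (-3 / 2)`. -/
lemma phaseInt_decay_pos (hF : discr F ≠ 0) (hv : IsTest v) :
    ∃ C, ∀ θ, 1 ≤ θ → ‖phaseInt F v θ‖ ≤ C * θ ^ (-3 / 2 : ℝ) := by
  have weak : ∀ {v}, IsTest v → ∃ C, 0 ≤ C ∧ ∀ θ, 1 ≤ θ → ‖phaseInt F v θ‖ ≤ C * θ⁻¹ := by
    intro v hv
    obtain ⟨C, hC⟩ := norm_phaseInt_le (F := F) (hv.dualLaplacian (F := F))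
    have hC0 : 0 ≤ C := (norm_nonneg _).trans (hC 0)
    have h := phaseInt_bootstrap hF hv (B := fun x => 2 * C * x ^ (1 / 2 : ℝ))
      (B' := fun x => 2 * C * (1 / 2 * x ^ (1 / 2 - 1 : ℝ)))
      (fun x hx => (Real.hasDerivAt_rpow_const (Or.inl (by positivity))).const_mul _)
      (by positivity) ?_
    · refine ⟨‖phaseInt F v 1‖ + 2 * C, by positivity, fun θ hθ => ?_⟩
      have hθ0 : 0 < θ := by linarith
      have h1 := h θ hθ
      have e1 : θ ^ (3 / 2 : ℝ) = θ * θ ^ (1 / 2 : ℝ) := by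
        rw [← Real.rpow_one_add' hθ0.le (by norm_num)]; norm_num
      have h2 : 1 ≤ θ ^ (1 / 2 : ℝ) := Real.one_le_rpow hθ (by norm_num)
      have h3 : θ ^ (3 / 2 : ℝ) * ‖phaseInt F v θ‖
          ≤ (‖phaseInt F v 1‖ + 2 * C) * θ ^ (1 / 2 : ℝ) := by
        nlinarith [norm_nonneg (phaseInt F v 1)]
      rw [e1] at h3
      rw [← div_eq_mul_inv, le_div_iff₀ hθ0]
      refine le_of_mul_le_mul_right ?_ (by positivity : 0 < θ ^ (1 / 2 : ℝ))
      linarith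
    · intro x hx
      have e : (1 / 2 - 1 : ℝ) = -1 / 2 := by norm_num
      rw [e]
      have := mul_le_mul_of_nonneg_left (hC x) (by positivity : 0 ≤ x ^ (-1 / 2 : ℝ))
      linarith
  obtain ⟨C, hC0, hC⟩ := weak (hv.dualLaplacian (F := F))
  have h := phaseInt_bootstrap hF hv (B := fun x => 2 * C - 2 * C * x ^ (-1 / 2 : ℝ))
    (B' := fun x => -(2 * C * (-1 / 2 * x ^ (-1 / 2 - 1 : ℝ))))
    (fun x hx => ((Real.hasDerivAt_rpow_const (Or.inl (by positivity))).const_mul _).const_sub _)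
    (by simp) ?_
  · refine ⟨‖phaseInt F v 1‖ + 2 * C, fun θ hθ => ?_⟩
    have hθ0 : 0 < θ := by linarith
    have h1 := h θ hθ
    have h2 : 0 ≤ 2 * C * θ ^ (-1 / 2 : ℝ) := by positivity
    rw [show (-3 / 2 : ℝ) = -(3 / 2) by norm_num, Real.rpow_neg hθ0.le, ← div_eq_mul_inv,
      le_div_iff₀ (by positivity)]
    linarith
  · intro x hx
    have hx0 : 0 < x := by linarith
    have e : x ^ (-1 / 2 - 1 : ℝ) = x ^ (-1 / 2 : ℝ) * x⁻¹ := by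
      rw [Real.rpow_sub_one hx0.ne', div_eq_mul_inv]
    rw [e]
    have := mul_le_mul_of_nonneg_left (hC x hx) (by positivity : 0 ≤ x ^ (-1 / 2 : ℝ))
    linarith

lemma phaseInt_neg (θ : ℝ) :
    phaseInt F v (-θ) = starRingEnd ℂ (phaseInt F (fun t => starRingEnd ℂ (v t)) θ) := by
  unfold phaseInt
  rw [← integral_conj]
  congr 1; ext t
  rw [map_mul, Complex.conj_conj]
  congr 1
  unfold phase
  rw [← Complex.exp_conj]
  congr 1
  simp [map_ofNat]

/-- Negative `θ` are reduced to positive ones by complex conjugation. -/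
lemma phaseInt_decay (hF : discr F ≠ 0) (hv : IsTest v) :
    ∃ C, ∀ θ, ‖phaseInt F v θ‖ ≤ C * (1 + ‖θ‖) ^ (-(3 / 2) : ℝ) := by
  have hv' : IsTest fun t => starRingEnd ℂ (v t) :=
    ⟨Complex.conjCLE.contDiff.comp hv.1, hv.2.comp_left (map_zero _)⟩
  obtain ⟨C1, h1⟩ := phaseInt_decay_pos hF hv
  obtain ⟨C2, h2⟩ := phaseInt_decay_pos hF hv'
  obtain ⟨C3, h3⟩ := norm_phaseInt_le (F := F) hv
  have hC : ∀ θ, 1 ≤ |θ| → ‖phaseInt F v θ‖ ≤ max C1 C2 * |θ| ^ (-3 / 2 : ℝ) := by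
    intro θ hθ
    rcases le_total 0 θ with h | h
    · rw [abs_of_nonneg h] at hθ ⊢
      exact (h1 θ hθ).trans (by gcongr; exact le_max_left _ _)
    · rw [abs_of_nonpos h] at hθ ⊢
      have := h2 (-θ) hθ
      rw [← RCLike.norm_conj, ← phaseInt_neg, neg_neg] at this
      exact this.trans (by gcongr; exact le_max_right _ _)
  set M := max (max C1 C2) (max C3 0) with hM
  refine ⟨M * 2 ^ (3 / 2 : ℝ), fun θ => ?_⟩
  have hM0 : 0 ≤ M := (le_max_right _ _).trans (le_max_right _ _)
  have key : ‖phaseInt F v θ‖ ≤ M * (max 1 |θ|) ^ (-(3 / 2) : ℝ) := by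
    rcases le_total 1 |θ| with h | h
    · rw [max_eq_right h]
      refine (hC θ h).trans ?_
      rw [show (-3 / 2 : ℝ) = -(3 / 2) by norm_num]
      gcongr
      exact le_max_left _ _
    · rw [max_eq_left h, Real.one_rpow, mul_one]
      exact (h3 θ).trans ((le_max_left _ _).trans (le_max_right _ _))
  refine key.trans ?_
  rw [mul_assoc]
  gcongr
  rw [Real.rpow_neg (by positivity), Real.rpow_neg (by positivity), ← div_eq_mul_inv,
    inv_le_comm₀ (by positivity) (by positivity), inv_div,
    ← Real.div_rpow (by positivity) (by norm_num)]
  gcongr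
  rw [Real.norm_eq_abs, div_le_iff₀ (by norm_num)]
  linarith [le_max_left 1 |θ|, le_max_right 1 |θ|]

lemma singIntInner_eq (m₀ : ℤ) (w : (Fin 3 → ℝ) → ℝ) (θ : ℝ) :
    singIntInner F m₀ w θ
      = phaseInt F (fun t => (w t : ℂ)) θ
        * Complex.exp ((-(2 * Real.pi * θ * m₀) : ℝ) * Complex.I) := by
  unfold singIntInner phaseInt
  rw [← integral_mul_const]
  congr 1; ext t
  rw [mul_assoc]
  congr 1
  unfold expo phase
  rw [← Complex.exp_add]
  congr 1
  push_cast
  ring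

lemma isTest_ofReal {w : (Fin 3 → ℝ) → ℝ} (hw : ContDiff ℝ ∞ w) (hwc : HasCompactSupport w) :
    IsTest fun t => (w t : ℂ) :=
  ⟨Complex.ofRealCLM.contDiff.comp hw, hwc.comp_left Complex.ofReal_zero⟩

lemma integrable_singIntInner (hF : discr F ≠ 0) (m₀ : ℤ) {w : (Fin 3 → ℝ) → ℝ}
    (hw : ContDiff ℝ ∞ w) (hwc : HasCompactSupport w) : Integrable (singIntInner F m₀ w) := by
  obtain ⟨C, hC⟩ := phaseInt_decay hF (isTest_ofReal hw hwc)
  have hi : Integrable fun θ : ℝ => C * (1 + ‖θ‖) ^ (-(3 / 2) : ℝ) :=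
    (integrable_one_add_norm (by simp; norm_num)).const_mul C
  refine hi.mono' ?_ (Eventually.of_forall fun θ => ?_)
  · rw [show singIntInner F m₀ w = _ from funext fun θ => singIntInner_eq m₀ w θ]
    refine ((continuous_phaseInt (isTest_ofReal hw hwc)).mul ?_).aestronglyMeasurable
    fun_prop
  · rw [singIntInner_eq, norm_mul, Complex.norm_exp_ofReal_mul_I, mul_one]
    exact hC θ

end

section

/-! ### The singular integral as a limit of kernel averages -/

open FourierTransform in
/-- Fourier inversion for the even extension of the weight. The transform takes the value `2` at
`0`, the integral of `evenOmega` over both halves of the line. -/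
lemma exists_fourier_evenOmega : ∃ E : ℝ → ℂ, Continuous E ∧ Integrable E ∧ (∃ C, ∀ ξ, ‖E ξ‖ ≤ C) ∧
    E 0 = 2 ∧ ∀ z : ℝ, (evenOmega z : ℂ)
      = ∫ ξ : ℝ, Complex.exp ((2 * Real.pi * (ξ * z) : ℝ) * Complex.I) * E ξ := by
  have hs : ContDiff ℝ ∞ fun z => (evenOmega z : ℂ) :=
    Complex.ofRealCLM.contDiff.comp evenOmega_contDiff
  have hc : HasCompactSupport fun z => (evenOmega z : ℂ) :=
    evenOmega_hasCompactSupport.comp_left Complex.ofReal_zero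
  set S : SchwartzMap ℝ ℂ := hc.toSchwartzMap hs with hS
  have hfun : (S : ℝ → ℂ) = fun z => (evenOmega z : ℂ) := rfl
  refine ⟨(𝓕 S : SchwartzMap ℝ ℂ), (𝓕 S).continuous, (𝓕 S).integrable, ?_, ?_, fun z => ?_⟩
  · obtain ⟨C, hC⟩ := (𝓕 S).decay 0 0
    exact ⟨C, fun ξ => by simpa using hC.2 ξ⟩
  · rw [SchwartzMap.fourier_coe, Real.fourier_real_eq_integral_exp_smul, hfun]
    simp only [mul_zero, Complex.ofReal_zero, zero_mul, Complex.exp_zero, one_smul]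
    rw [integral_complex_ofReal, integral_evenOmega]
    simp
  · have h := congrFun (S.continuous.fourierInv_fourier_eq S.integrable (𝓕 S).integrable) z
    rw [Real.fourierInv_eq'] at h
    rw [show (evenOmega z : ℂ) = S z from rfl, ← h]
    congr 1; ext ξ
    rw [smul_eq_mul]
    congr 3
    simp [mul_comm]

variable {F : QuadraticForm ℤ (Fin 3 → ℤ)} {w : (Fin 3 → ℝ) → ℝ}

lemma expo_one (x : ℝ) : expo 1 x = Complex.exp ((2 * Real.pi * x : ℝ) * Complex.I) := by
  unfold expo
  congr 1
  push_cast
  ring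

/-- Fourier inversion for the kernel followed by Fubini's theorem; the factor `1 / u` is absorbed by
rescaling the frequency. -/
lemma kerInt_eq_integral_singIntInner {m₀ : ℤ}
    (hw : ContDiff ℝ ∞ w) (hwc : HasCompactSupport w) {E : ℝ → ℂ} (hE : Continuous E)
    (hEi : Integrable E) (hEf : ∀ z : ℝ, (evenOmega z : ℂ)
      = ∫ ξ : ℝ, Complex.exp ((2 * Real.pi * (ξ * z) : ℝ) * Complex.I) * E ξ) {u : ℝ} (hu : 0 < u) :
    ((kerInt w (fun t => realForm F t - m₀) evenOmega u / u : ℝ) : ℂ)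
      = ∫ θ, E (u * θ) * singIntInner F m₀ w θ := by
  have hG : Continuous fun t => realForm F t - (m₀ : ℝ) := continuous_level
  have h1 : ∀ y : ℝ, ((evenOmega (y / u) / u : ℝ) : ℂ)
      = ∫ θ : ℝ, expo 1 (θ * y) * E (u * θ) := by
    intro y
    have := Measure.integral_comp_mul_left
      (fun ξ : ℝ => Complex.exp ((2 * Real.pi * (ξ * (y / u)) : ℝ) * Complex.I) * E ξ) u
    rw [← hEf, abs_of_pos (inv_pos.2 hu)] at this
    push_cast
    rw [div_eq_inv_mul, ← Complex.ofReal_inv, ← Complex.real_smul]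
    rw [← this]
    congr 1; ext θ
    rw [expo_one]
    congr 4
    field_simp
  have hEu : Integrable fun θ : ℝ => E (u * θ) := hEi.comp_mul_left' hu.ne'
  have hwi : Integrable fun t => (w t : ℂ) :=
    (hw.continuous.integrable_of_hasCompactSupport hwc).ofReal
  have hprod : Integrable (Function.uncurry fun (t : Fin 3 → ℝ) (θ : ℝ) =>
      (w t : ℂ) * (expo 1 (θ * (realForm F t - m₀)) * E (u * θ))) (volume.prod volume) := by
    refine (hwi.mul_prod hEu).mono ?_ (Eventually.of_forall fun z => ?_)
    · have : Continuous (Function.uncurry fun (t : Fin 3 → ℝ) (θ : ℝ) =>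
          (w t : ℂ) * (expo 1 (θ * (realForm F t - m₀)) * E (u * θ))) := by
        have hr := (realForm_contDiff F).continuous
        have hwc' := hw.continuous
        unfold expo Function.uncurry
        fun_prop
      exact this.aestronglyMeasurable
    · simp only [Function.uncurry, norm_mul]
      rw [expo_one, Complex.norm_exp_ofReal_mul_I, one_mul]
  unfold kerInt
  rw [div_eq_mul_inv, ← integral_mul_const, ← integral_complex_ofReal]
  have e : ∀ t, ((w t * evenOmega ((realForm F t - m₀) / u) * u⁻¹ : ℝ) : ℂ)
      = ∫ θ : ℝ, (w t : ℂ) * (expo 1 (θ * (realForm F t - m₀)) * E (u * θ)) := by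
    intro t
    rw [integral_const_mul, ← h1]
    push_cast
    ring
  simp only [e]
  rw [integral_integral_swap hprod]
  congr 1; ext θ
  unfold singIntInner
  rw [← integral_const_mul]
  congr 1; ext t; ring

/-- Dominated convergence as the width `u` of the kernel tends to `0`, with the decay of the phase
integral as majorant. The limit is twice the singular integral because `evenOmega` has integral `2`.
-/
lemma tendsto_kerInt_singInt (hF : discr F ≠ 0) (m₀ : ℤ)
    (hw : ContDiff ℝ ∞ w) (hwc : HasCompactSupport w) :
    ∃ σ : ℝ, singInt F m₀ w = σ ∧
      Tendsto (fun u => kerInt w (fun t => realForm F t - m₀) evenOmega u / u) (𝓝[>] 0)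
        (𝓝 (2 * σ)) := by
  obtain ⟨E, hE, hEi, ⟨C, hC⟩, hE0, hEf⟩ := exists_fourier_evenOmega
  have hI := integrable_singIntInner hF m₀ hw hwc
  have hlim : Tendsto (fun u : ℝ => ∫ θ, E (u * θ) * singIntInner F m₀ w θ) (𝓝[>] 0)
      (𝓝 (∫ θ, 2 * singIntInner F m₀ w θ)) := by
    refine tendsto_integral_filter_of_dominated_convergence (fun θ => C * ‖singIntInner F m₀ w θ‖)
      ?_ ?_ (hI.norm.const_mul C) ?_
    · exact Eventually.of_forall fun u =>
        (hE.comp (continuous_const.mul continuous_id)).aestronglyMeasurable.mul hI.1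
    · refine Eventually.of_forall fun u => Eventually.of_forall fun θ => ?_
      rw [norm_mul]
      gcongr
      exact hC _
    · refine Eventually.of_forall fun θ => ?_
      refine Tendsto.mul_const _ ?_
      have : Tendsto (fun u : ℝ => E (u * θ)) (𝓝 0) (𝓝 (E (0 * θ))) :=
        (hE.comp (continuous_id.mul continuous_const)).tendsto 0
      rw [zero_mul, hE0] at this
      exact tendsto_nhdsWithin_of_tendsto_nhds this
  rw [integral_const_mul] at hlim
  have hlim' : Tendsto (fun u : ℝ =>
      ((kerInt w (fun t => realForm F t - m₀) evenOmega u / u : ℝ) : ℂ)) (𝓝[>] 0)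
      (𝓝 (2 * singInt F m₀ w)) := by
    refine hlim.congr' ?_
    filter_upwards [self_mem_nhdsWithin] with u hu
    exact (kerInt_eq_integral_singIntInner hw hwc hE hEi hEf hu).symm
  have him : (2 * singInt F m₀ w).im = 0 := by
    have := (Complex.continuous_im.tendsto _).comp hlim'
    simp only [Function.comp_def, Complex.ofReal_im] at this
    exact (tendsto_nhds_unique tendsto_const_nhds this).symm
  refine ⟨(singInt F m₀ w).re, ?_, ?_⟩
  · apply Complex.ext
    · simp
    · simpa using him
  · have := (Complex.continuous_re.tendsto _).comp hlim'
    simpa [Function.comp_def, -Complex.ofReal_div] using this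

/-- The average of the delta kernel vanishes for large `x`, is Lipschitz on `(0, ∞)`, and tends to
the singular integral as `x` tends to `0`. -/
theorem levelAvg_lipschitz (hF : discr F ≠ 0) {m₀ : ℤ} (hm : m₀ ≠ 0)
    (hw : ContDiff ℝ ∞ w) (hwc : HasCompactSupport w) :
    ∃ σ c Λ : ℝ, singInt F m₀ w = σ ∧ 1 ≤ c ∧ 0 ≤ Λ ∧ (∀ x, c ≤ x → levelAvg F m₀ w x = 0) ∧
      (∀ x, 0 < x → |levelAvg F m₀ w x - σ| ≤ Λ * x) ∧
      (∀ x y, 0 < x → x ≤ y → |levelAvg F m₀ w x - levelAvg F m₀ w y| ≤ Λ * (y - x)) := by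
  have hm' : (m₀ : ℝ) ≠ 0 := by exact_mod_cast hm
  obtain ⟨σ, hσ, hlim⟩ := tendsto_kerInt_singInt hF m₀ hw hwc
  obtain ⟨c, hc, hcw⟩ := exists_level_bound F (m₀ : ℝ) hwc
  obtain ⟨Λ₁, h1⟩ := exists_levelAvg_sub_bound hm' hw hwc hc hcw hlim
  obtain ⟨Λ₂, h2⟩ := exists_levelAvg_deriv_bound hm' hw hwc hc hcw
  have hc0 : 0 < c := by linarith
  have hz : ∀ x, c ≤ x → levelAvg F m₀ w x = 0 := fun x hx =>
    levelAvg_eq_zero hw.continuous hwc hc hcw hx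
  set Λ := max (max Λ₁ Λ₂) 0 with hΛ
  have b1 : Λ₁ ≤ Λ := (le_max_left _ _).trans (le_max_left _ _)
  have b2 : Λ₂ ≤ Λ := (le_max_right _ _).trans (le_max_left _ _)
  have b0 : 0 ≤ Λ := le_max_right _ _
  have hlip : ∀ x y, 0 < x → x ≤ y → y ≤ c →
      |levelAvg F m₀ w x - levelAvg F m₀ w y| ≤ Λ * (y - x) := by
    intro x y hx hxy hyc
    choose! d hd using h2
    have := Convex.norm_image_sub_le_of_norm_hasDerivWithin_le (f := levelAvg F m₀ w)
      (f' := d) (s := Set.Ioc 0 c) (C := Λ) (x := x) (y := y)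
      (fun z hz => ((hd z hz.1 hz.2).1).hasDerivWithinAt)
      (fun z hz => (hd z hz.1 hz.2).2.trans b2) (convex_Ioc 0 c) ⟨hx, hxy.trans hyc⟩
      ⟨hx.trans_le hxy, hyc⟩
    rw [Real.norm_eq_abs, Real.norm_eq_abs, abs_of_nonneg (sub_nonneg.2 hxy), abs_sub_comm] at this
    exact this
  refine ⟨σ, c, Λ, hσ, hc, b0, hz, fun x hx => ?_, fun x y hx hxy => ?_⟩
  · have h1' : ∀ x, 0 < x → x ≤ c → |levelAvg F m₀ w x - σ| ≤ Λ * x := by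
      intro x hx hxc
      have := h1 x hx hxc
      rw [mul_div_cancel_left₀ σ (two_ne_zero)] at this
      exact this.trans (by gcongr)
    rcases le_total x c with h | h
    · exact h1' x hx h
    · have := h1' c hc0 le_rfl
      rw [hz c le_rfl] at this
      rw [hz x h]
      exact this.trans (by gcongr)
  · rcases le_total y c with h | h
    · exact hlip x y hx hxy h
    · rcases le_total x c with h' | h'
      · have := hlip x c hx h' le_rfl
        rw [hz c le_rfl] at this
        rw [hz y h]
        exact this.trans (by gcongr)
      · rw [hz x h', hz y h, sub_self, abs_zero]
        exact mul_nonneg b0 (sub_nonneg.2 hxy)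

lemma realForm_smul (a : ℝ) (t : Fin 3 → ℝ) :
    realForm F (fun i => a * t i) = a ^ 2 * realForm F t := by
  simp only [realForm, Fin.sum_univ_three]
  ring

/-- At `c = 0` the substitution `t = (L s + λ_N) / P` turns the oscillatory integral into an average
of the delta kernel over the level sets. -/
lemma oscInt_zero (m₀ : ℤ) {L P : ℕ} (hL : 0 < L) (hP : 0 < P) (lam : Fin 3 → ℤ)
    (w : (Fin 3 → ℝ) → ℝ) (q : ℕ) :
    oscInt F m₀ L (P ^ 2) ((P : ℤ) • lam) w q 0
      = (((P : ℝ) / L) ^ 3 * levelAvg F m₀ w (q * L / P) : ℝ) := by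
  have hL' : (0 : ℝ) < L := by exact_mod_cast hL
  have hP' : (0 : ℝ) < P := by exact_mod_cast hP
  have hsq : √((P ^ 2 : ℕ) : ℝ) = P := by
    push_cast
    exact Real.sqrt_sq hP'.le
  set f : (Fin 3 → ℝ) → ℝ := fun t => w t * hFun (q * L / P) (realForm F t - m₀) with hf
  have e : ∀ s : Fin 3 → ℝ,
      (w (fun i => ((L : ℝ) * s i + (((P : ℤ) • lam) i : ℝ)) / √((P ^ 2 : ℕ) : ℝ)) : ℂ)
      * (hFun ((q : ℝ) / (√((P ^ 2 : ℕ) : ℝ) / (L : ℝ)))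
          ((realForm F (fun i => (L : ℝ) * s i + (((P : ℤ) • lam) i : ℝ))
            - (m₀ : ℝ) * ((P ^ 2 : ℕ) : ℝ))
            / ((L : ℝ) * (√((P ^ 2 : ℕ) : ℝ) / (L : ℝ))) ^ 2) : ℂ)
      * expo ((q : ℝ) * (L : ℝ)) (-(∑ i, ((0 : Fin 3 → ℤ) i : ℝ) * s i))
      = (f (((L : ℝ) / P) • s + fun i => (lam i : ℝ)) : ℂ) := by
    intro s
    rw [hsq]
    have e1 : (fun i => ((L : ℝ) * s i + (((P : ℤ) • lam) i : ℝ)) / (P : ℝ))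
        = ((L : ℝ) / P) • s + fun i => (lam i : ℝ) := by
      ext i
      simp
      field_simp
    have e2 : (fun i => (L : ℝ) * s i + (((P : ℤ) • lam) i : ℝ))
        = fun i => (P : ℝ) * (((L : ℝ) / P) • s + fun i => (lam i : ℝ)) i := by
      ext i
      simp
      field_simp
    have e3 : expo ((q : ℝ) * (L : ℝ)) (-(∑ i, ((0 : Fin 3 → ℤ) i : ℝ) * s i)) = 1 := by
      simp [expo]
    rw [e1, e2, realForm_smul, e3, mul_one, hf]
    push_cast
    congr 3
    · field_simp
    · field_simp
  unfold oscInt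
  simp only [e]
  rw [integral_complex_ofReal]
  congr 1
  have h1 := Measure.integral_comp_smul (μ := (volume : Measure (Fin 3 → ℝ)))
    (fun t => f (t + fun i => (lam i : ℝ))) ((L : ℝ) / P)
  rw [h1, integral_add_right_eq_self (μ := volume) f]
  simp only [Module.finrank_fin_fun, smul_eq_mul]
  rw [abs_of_pos (by positivity), ← inv_pow, inv_div]
  rfl

end

/-! ### Averages of periodic functions on `ℤ ^ 3` -/

/-- The average of `f` over a complete system of residues modulo `M`. -/
def avg (M : ℕ) (f : (Fin 3 → ℤ) → ℝ) : ℝ := (∑ x ∈ residues M, f x) / (M : ℝ) ^ 3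

/-- `f` is periodic modulo `M`. -/
def Per (M : ℕ) (f : (Fin 3 → ℤ) → ℝ) : Prop :=
  ∀ x y : Fin 3 → ℤ, (∀ i, x i ≡ y i [ZMOD M]) → f x = f y

open Classical in
/-- The indicator function of a proposition. -/
def ind (A : Prop) : ℝ := if A then 1 else 0

lemma ind_of {A : Prop} (h : A) : ind A = 1 := if_pos h

lemma ind_of_not {A : Prop} (h : ¬ A) : ind A = 0 := if_neg h

lemma ind_congr {A B : Prop} (h : A ↔ B) : ind A = ind B := by rw [propext h]

lemma ind_and (A B : Prop) : ind (A ∧ B) = ind A * ind B := by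
  unfold ind
  by_cases hA : A <;> by_cases hB : B <;> simp [hA, hB]

lemma ind_nonneg (A : Prop) : 0 ≤ ind A := by
  unfold ind
  split_ifs <;> norm_num

lemma ind_mono {A B : Prop} (h : A → B) : ind A ≤ ind B := by
  by_cases hA : A
  · rw [ind_of hA, ind_of (h hA)]
  · rw [ind_of_not hA]; exact ind_nonneg _

lemma mem_residues {n : ℕ} {x : Fin 3 → ℤ} : x ∈ residues n ↔ ∀ i, 0 ≤ x i ∧ x i < n := by
  simp [residues, Fintype.mem_piFinset]

lemma card_residues (n : ℕ) : (residues n).card = n ^ 3 := by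
  simp [residues, Fintype.card_piFinset]

lemma Per.mono {M N : ℕ} {f : (Fin 3 → ℤ) → ℝ} (h : Per M f) (hMN : M ∣ N) : Per N f :=
  fun x y hxy => h x y fun i => (hxy i).of_dvd (by exact_mod_cast hMN)

lemma Per.mul {M : ℕ} {f g : (Fin 3 → ℤ) → ℝ} (hf : Per M f) (hg : Per M g) :
    Per M fun x => f x * g x := fun x y hxy => by
  beta_reduce
  rw [hf x y hxy, hg x y hxy]

lemma avg_nonneg {M : ℕ} {f : (Fin 3 → ℤ) → ℝ} (h : ∀ x, 0 ≤ f x) : 0 ≤ avg M f :=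
  div_nonneg (Finset.sum_nonneg fun x _ => h x) (by positivity)

lemma avg_mono {M : ℕ} {f g : (Fin 3 → ℤ) → ℝ} (h : ∀ x, f x ≤ g x) : avg M f ≤ avg M g := by
  unfold avg
  gcongr with x
  exact h x

lemma avg_congr {M : ℕ} {f g : (Fin 3 → ℤ) → ℝ} (h : ∀ x, f x = g x) : avg M f = avg M g := by
  rw [funext h]

lemma avg_sum {ι : Type*} (s : Finset ι) {M : ℕ} (f : ι → (Fin 3 → ℤ) → ℝ) :
    avg M (fun x => ∑ i ∈ s, f i x) = ∑ i ∈ s, avg M (f i) := by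
  unfold avg
  rw [Finset.sum_comm, Finset.sum_div]

lemma avg_add {M : ℕ} (f g : (Fin 3 → ℤ) → ℝ) :
    avg M (fun x => f x + g x) = avg M f + avg M g := by
  unfold avg
  rw [Finset.sum_add_distrib, add_div]

lemma avg_const_mul {M : ℕ} (c : ℝ) (f : (Fin 3 → ℤ) → ℝ) :
    avg M (fun x => c * f x) = c * avg M f := by
  unfold avg
  rw [← Finset.mul_sum, mul_div_assoc]

/-- Every residue modulo `a b` is uniquely `r + a y` with residues `r` modulo `a` and `y` modulo
`b`. -/
lemma sum_residues_mul {a b : ℕ} (ha : 0 < a) (f : (Fin 3 → ℤ) → ℝ) :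
    ∑ x ∈ residues (a * b), f x
      = ∑ r ∈ residues a, ∑ y ∈ residues b, f (fun i => r i + a * y i) := by
  rw [← Finset.sum_product']
  have ha' : (0 : ℤ) < a := by exact_mod_cast ha
  refine Finset.sum_nbij' (fun x => (fun i => x i % a, fun i => x i / a))
    (fun z i => z.1 i + a * z.2 i) ?_ ?_ ?_ ?_ ?_
  · intro x hx
    rw [mem_residues] at hx
    rw [Finset.mem_product, mem_residues, mem_residues]
    refine ⟨fun i => ⟨Int.emod_nonneg _ ha'.ne', Int.emod_lt_of_pos _ ha'⟩, fun i =>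
      ⟨Int.ediv_nonneg (hx i).1 ha'.le, Int.ediv_lt_of_lt_mul ha' ?_⟩⟩
    have := (hx i).2
    push_cast at this
    linarith
  · intro z hz
    rw [Finset.mem_product, mem_residues, mem_residues] at hz
    rw [mem_residues]
    intro i
    have h1 := hz.1 i
    have h2 := hz.2 i
    push_cast
    constructor
    · nlinarith
    · nlinarith
  · intro x _
    ext i
    exact Int.emod_add_mul_ediv _ _
  · intro z hz
    rw [Finset.mem_product, mem_residues, mem_residues] at hz
    ext i
    · simp only [Int.add_mul_emod_self_left]
      exact Int.emod_eq_of_lt (hz.1 i).1 (hz.1 i).2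
    · simp only
      rw [Int.add_mul_ediv_left _ _ ha'.ne', Int.ediv_eq_zero_of_lt (hz.1 i).1 (hz.1 i).2, zero_add]
  · intro x _
    congr 1
    ext i
    exact (Int.emod_add_mul_ediv _ _).symm

lemma avg_mul_right {M k : ℕ} (hM : 0 < M) (hk : 0 < k) {f : (Fin 3 → ℤ) → ℝ} (hf : Per M f) :
    avg (M * k) f = avg M f := by
  unfold avg
  rw [sum_residues_mul hM]
  have : ∀ r ∈ residues M, ∑ y ∈ residues k, f (fun i => r i + M * y i) = (k : ℝ) ^ 3 * f r := by
    intro r _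
    have h : ∀ y ∈ residues k, f (fun i => r i + M * y i) = f r := fun y _ =>
      hf _ _ fun i => by simp
    rw [Finset.sum_congr rfl h, Finset.sum_const, card_residues, nsmul_eq_mul]
    push_cast
    rfl
  rw [Finset.sum_congr rfl this, ← Finset.mul_sum]
  have h1 : (M : ℝ) ≠ 0 := by positivity
  have h2 : (k : ℝ) ≠ 0 := by positivity
  push_cast
  field_simp

lemma avg_eq_of_dvd {M N : ℕ} (hN : 0 < N) (hMN : M ∣ N) {f : (Fin 3 → ℤ) → ℝ} (hf : Per M f) :
    avg N f = avg M f := by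
  obtain ⟨k, rfl⟩ := hMN
  exact avg_mul_right (Nat.pos_of_mul_pos_right hN) (Nat.pos_of_mul_pos_left hN) hf

/-- Averages are invariant under affine substitutions with invertible linear part. -/
lemma avg_affine {M : ℕ} (hM : 0 < M) {u : ℤ} (hu : IsCoprime u (M : ℤ)) (ν : Fin 3 → ℤ)
    {f : (Fin 3 → ℤ) → ℝ} (hf : Per M f) :
    avg M (fun x => f (fun i => u * x i + ν i)) = avg M f := by
  unfold avg
  congr 1
  obtain ⟨v, b, hv⟩ := hu
  have hM' : (0 : ℤ) < M := by exact_mod_cast hM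
  have hvu : v * u ≡ 1 [ZMOD M] := by
    rw [Int.modEq_iff_dvd]
    exact ⟨b, by linarith⟩
  refine Finset.sum_nbij' (fun x i => (u * x i + ν i) % M) (fun y i => (v * (y i - ν i)) % M)
    ?_ ?_ ?_ ?_ ?_
  · intro x _
    rw [mem_residues]
    exact fun i => ⟨Int.emod_nonneg _ hM'.ne', Int.emod_lt_of_pos _ hM'⟩
  · intro x _
    rw [mem_residues]
    exact fun i => ⟨Int.emod_nonneg _ hM'.ne', Int.emod_lt_of_pos _ hM'⟩
  · intro x hx
    rw [mem_residues] at hx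
    ext i
    have h1 : v * ((u * x i + ν i) % M - ν i) ≡ x i [ZMOD M] := by
      calc v * ((u * x i + ν i) % M - ν i) ≡ v * ((u * x i + ν i) - ν i) [ZMOD M] :=
            Int.ModEq.mul_left _ ((Int.mod_modEq _ _).sub_right _)
        _ = (v * u) * x i := by ring
        _ ≡ 1 * x i [ZMOD M] := hvu.mul_right _
        _ = x i := one_mul _
    have h2 : v * ((u * x i + ν i) % M - ν i) % M = x i % M := h1
    rw [h2, Int.emod_eq_of_lt (hx i).1 (hx i).2]
  · intro y hy
    rw [mem_residues] at hy
    ext i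
    have h1 : u * (v * (y i - ν i) % M) + ν i ≡ y i [ZMOD M] := by
      calc u * (v * (y i - ν i) % M) + ν i ≡ u * (v * (y i - ν i)) + ν i [ZMOD M] :=
            (Int.ModEq.mul_left _ (Int.mod_modEq _ _)).add_right _
        _ = (v * u) * (y i - ν i) + ν i := by ring
        _ ≡ 1 * (y i - ν i) + ν i [ZMOD M] := (hvu.mul_right _).add_right _
        _ = y i := by ring
    have h2 : (u * (v * (y i - ν i) % M) + ν i) % M = y i % M := h1
    rw [h2, Int.emod_eq_of_lt (hy i).1 (hy i).2]
  · intro x _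
    exact hf _ _ fun i => (Int.mod_modEq _ _).symm

/-- Chinese remainder theorem: averages to coprime moduli are independent. -/
lemma avg_mul_of_coprime {m n : ℕ} (hm : 0 < m) (hn : 0 < n) (h : Nat.Coprime m n)
    {f g : (Fin 3 → ℤ) → ℝ} (hf : Per m f) (hg : Per n g) :
    avg (m * n) (fun x => f x * g x) = avg m f * avg n g := by
  have h1 : ∀ r ∈ residues m, ∑ y ∈ residues n,
      f (fun i => r i + m * y i) * g (fun i => r i + m * y i) = f r * ∑ y ∈ residues n, g y := by
    intro r _
    have e1 : ∀ y ∈ residues n, f (fun i => r i + m * y i) * g (fun i => r i + m * y i)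
        = f r * g (fun i => r i + m * y i) := fun y _ => by
      rw [hf (fun i => r i + m * y i) r fun i => by simp]
    rw [Finset.sum_congr rfl e1, ← Finset.mul_sum]
    have e2 := avg_affine hn (Nat.isCoprime_iff_coprime.2 h) r hg
    have hn' : (n : ℝ) ^ 3 ≠ 0 := by positivity
    unfold avg at e2
    rw [div_left_inj' hn'] at e2
    rw [← e2]
    congr 1
    exact Finset.sum_congr rfl fun y _ => by congr 1; ext i; ring
  unfold avg
  rw [sum_residues_mul hm, Finset.sum_congr rfl h1, ← Finset.sum_mul]
  push_cast
  rw [mul_pow, mul_div_mul_comm]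

/-- Restricting to a residue class modulo a divisor `a` of the modulus. -/
lemma avg_ind_modEq_mul {a b : ℕ} (ha : 0 < a) (hb : 0 < b) (ν : Fin 3 → ℤ)
    {f : (Fin 3 → ℤ) → ℝ} (hf : Per (a * b) f) :
    avg (a * b) (fun x => ind (∀ i, x i ≡ ν i [ZMOD a]) * f x)
      = ((a : ℝ) ^ 3)⁻¹ * avg (a * b) (fun y => f (fun i => a * y i + ν i)) := by
  have hP : Per (a * b) fun x => ind (∀ i, x i ≡ ν i [ZMOD a]) := by
    intro x y hxy
    refine ind_congr (forall_congr' fun i => ?_)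
    have : x i ≡ y i [ZMOD a] := (hxy i).of_dvd (by simp)
    exact ⟨fun h => this.symm.trans h, fun h => this.trans h⟩
  have h1 := avg_affine (Nat.mul_pos ha hb) (u := 1) isCoprime_one_left ν (hP.mul hf)
  have hb' : Per b fun y => f (fun i => a * y i + ν i) := by
    intro x y hxy
    refine hf _ _ fun i => Int.ModEq.add_right _ ?_
    push_cast
    exact (hxy i).mul_left'
  have h0 : (0 : Fin 3 → ℤ) ∈ residues a := by
    rw [mem_residues]
    exact fun i => ⟨le_rfl, by simpa using ha⟩
  rw [← h1, mul_comm a b, avg_mul_right hb ha hb', mul_comm b a]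
  unfold avg
  rw [sum_residues_mul ha, Finset.sum_eq_single_of_mem 0 h0]
  · have e : ∀ y ∈ residues b,
        (ind (∀ i, 1 * ((0 : Fin 3 → ℤ) i + a * y i) + ν i ≡ ν i [ZMOD a]) *
          f (fun i => 1 * ((0 : Fin 3 → ℤ) i + a * y i) + ν i)) = f (fun i => a * y i + ν i) := by
      intro y _
      rw [ind_of, one_mul]
      · congr 1; ext i; simp
      · intro i; simp
    rw [Finset.sum_congr rfl e]
    have : (a : ℝ) ≠ 0 := by positivity
    have : (b : ℝ) ≠ 0 := by positivity
    push_cast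
    field_simp
  · intro r hr hr0
    refine Finset.sum_eq_zero fun y _ => ?_
    rw [ind_of_not, zero_mul]
    intro h
    apply hr0
    rw [mem_residues] at hr
    ext i
    have h2 := h i
    rw [Int.modEq_iff_dvd] at h2
    have h3 : (a : ℤ) ∣ r i := by
      have h4 : ν i - (1 * (r i + a * y i) + ν i) = -(r i + a * y i) := by ring
      rw [h4, dvd_neg] at h2
      exact (dvd_add_left (dvd_mul_right _ _)).1 h2
    have := Int.eq_zero_of_dvd_of_nonneg_of_lt (hr i).1 (hr i).2 h3
    simpa using this

/-- If averaging `f` over `p` measure preserving maps gives `g`, then `p` times the average of `f`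
is the average of `g`. -/
lemma avg_of_orbit {M p : ℕ} {f g : (Fin 3 → ℤ) → ℝ} (T : ℕ → (Fin 3 → ℤ) → (Fin 3 → ℤ))
    (hT : ∀ τ, avg M (fun x => f (T τ x)) = avg M f)
    (h : ∀ x, ∑ τ ∈ Finset.range p, f (T τ x) = g x) : p * avg M f = avg M g := by
  rw [← avg_congr h, avg_sum]
  simp [hT]

section

/-! ### Densities of solutions of congruences -/

lemma form_add_smul (F : QuadraticForm ℤ (Fin 3 → ℤ)) (x z : Fin 3 → ℤ) (n : ℤ) :
    F (x + n • z) = F x + n ^ 2 * F z + n * QuadraticMap.polar F x z := by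
  rw [QuadraticMap.map_add F x (n • z), QuadraticMap.map_smul, QuadraticMap.polar_smul_right]
  simp only [smul_eq_mul]
  ring

lemma form_modEq (F : QuadraticForm ℤ (Fin 3 → ℤ)) {n : ℤ} {x y : Fin 3 → ℤ}
    (h : ∀ i, x i ≡ y i [ZMOD n]) : F x ≡ F y [ZMOD n] := by
  choose z hz using fun i => (h i).dvd
  have : y = x + n • z := by
    ext i
    have := hz i
    simp
    linarith
  rw [this, form_add_smul, Int.modEq_iff_dvd]
  exact ⟨n * F z + QuadraticMap.polar F x z, by ring⟩

/-- The density of the `σ` with `n ∣ F(L σ + ν) - m`. -/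
def solDens (F : QuadraticForm ℤ (Fin 3 → ℤ)) (m : ℤ) (L : ℕ) (ν : Fin 3 → ℤ) (n : ℕ) : ℝ :=
  avg n fun x => ind ((n : ℤ) ∣ F ((L : ℤ) • x + ν) - m)

variable {F : QuadraticForm ℤ (Fin 3 → ℤ)} {m : ℤ} {L : ℕ} {ν : Fin 3 → ℤ}

lemma per_ind_dvd (F : QuadraticForm ℤ (Fin 3 → ℤ)) (m : ℤ) (n : ℕ) :
    Per n fun x => ind ((n : ℤ) ∣ F x - m) := by
  intro x y hxy
  exact ind_congr (Int.ModEq.dvd_iff ((form_modEq F hxy).sub_right m))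

lemma Per.comp_affine {n : ℕ} {f : (Fin 3 → ℤ) → ℝ} (hf : Per n f) (L : ℤ) (ν : Fin 3 → ℤ) :
    Per n fun x => f (L • x + ν) := fun x y hxy =>
  hf _ _ fun i => by
    simpa using ((hxy i).mul_left L).add_right (ν i)

lemma solDens_nonneg (n : ℕ) : 0 ≤ solDens F m L ν n := avg_nonneg fun _ => ind_nonneg _

lemma solDens_one : solDens F m L ν 1 = 1 := by
  unfold solDens avg
  have : ∀ x ∈ residues 1, ind (((1 : ℕ) : ℤ) ∣ F ((L : ℤ) • x + ν) - m) = 1 :=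
    fun x _ => ind_of (by simp)
  rw [Finset.sum_congr rfl this, Finset.sum_const, card_residues]
  simp

lemma solDens_eq_avg {n N : ℕ} (hN : 0 < N) (h : n ∣ N) :
    avg N (fun x => ind ((n : ℤ) ∣ F ((L : ℤ) • x + ν) - m)) = solDens F m L ν n :=
  avg_eq_of_dvd hN h ((per_ind_dvd F m n).comp_affine L ν)

lemma solDens_antitone {a b : ℕ} (hb : 0 < b) (h : a ∣ b) :
    solDens F m L ν b ≤ solDens F m L ν a := by
  rw [← solDens_eq_avg hb h]
  exact avg_mono fun x => ind_mono fun h' => (Int.natCast_dvd_natCast.2 h).trans h'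

lemma solDens_mul {a b : ℕ} (ha : 0 < a) (hb : 0 < b) (h : Nat.Coprime a b) :
    solDens F m L ν (a * b) = solDens F m L ν a * solDens F m L ν b := by
  unfold solDens
  rw [← avg_mul_of_coprime ha hb h ((per_ind_dvd F m a).comp_affine L ν)
    ((per_ind_dvd F m b).comp_affine L ν)]
  refine avg_congr fun x => ?_
  rw [← ind_and]
  refine ind_congr ?_
  push_cast
  exact ⟨fun h' => ⟨dvd_of_mul_right_dvd h', dvd_of_mul_left_dvd h'⟩,
    fun h' => (Nat.isCoprime_iff_coprime.2 h).mul_dvd h'.1 h'.2⟩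

/-- Scaling the residue class and the value by a unit does not change the density. -/
lemma solDens_scale {n P : ℕ} (hn : 0 < n) (h : Nat.Coprime P n) :
    solDens F (m * (P : ℤ) ^ 2) L ((P : ℤ) • ν) n = solDens F m L ν n := by
  unfold solDens
  rw [← avg_affine hn (Nat.isCoprime_iff_coprime.2 h) 0
    ((per_ind_dvd F (m * (P : ℤ) ^ 2) n).comp_affine L ((P : ℤ) • ν))]
  refine avg_congr fun x => ind_congr ?_
  have e : ((L : ℤ) • (fun i => (P : ℤ) * x i + (0 : Fin 3 → ℤ) i) + (P : ℤ) • ν)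
      = (P : ℤ) • ((L : ℤ) • x + ν) := by
    ext i
    simp
    ring
  rw [e, QuadraticMap.map_smul]
  have e2 : ((P : ℤ) * P) • F ((L : ℤ) • x + ν) - m * (P : ℤ) ^ 2
      = (P : ℤ) ^ 2 * (F ((L : ℤ) • x + ν) - m) := by
    rw [smul_eq_mul]; ring
  rw [e2]
  exact ⟨(IsCoprime.pow_right (Nat.isCoprime_iff_coprime.2 h.symm)).dvd_of_dvd_mul_left,
    fun h' => Dvd.dvd.mul_left h' _⟩

/-- To a modulus prime to `L` that divides `m`, the density is that of the cone `F = 0`. -/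
lemma solDens_cone {n : ℕ} (hn : 0 < n) (h : Nat.Coprime L n) (hm : (n : ℤ) ∣ m) :
    solDens F m L ν n = solDens F 0 1 0 n := by
  unfold solDens
  rw [← avg_affine hn (Nat.isCoprime_iff_coprime.2 h) ν
    ((per_ind_dvd F 0 n).comp_affine ((1 : ℕ) : ℤ) 0)]
  refine avg_congr fun x => ind_congr ?_
  have e : (((1 : ℕ) : ℤ) • (fun i => (L : ℤ) * x i + ν i) + (0 : Fin 3 → ℤ))
      = (L : ℤ) • x + ν := by
    ext i; simp
  rw [e, sub_zero]
  exact (dvd_sub_left hm)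

lemma localCount_eq_avg {p k : ℕ} (hp : p.Prime) :
    localCount F m L ν p k = (p : ℝ) ^ k * avg (p ^ k) fun x =>
      ind (∀ i, x i ≡ ν i [ZMOD ((p ^ padicValNat p L : ℕ) : ℤ)]) *
        ind (((p ^ k : ℕ) : ℤ) ∣ F x - m) := by
  have hp0 : (p : ℝ) ≠ 0 := by exact_mod_cast hp.ne_zero
  unfold localCount avg
  have e : ((p : ℝ) ^ (2 * k)) = ((p ^ k : ℕ) : ℝ) ^ 3 / (p : ℝ) ^ k := by
    push_cast
    rw [← pow_mul, eq_div_iff (pow_ne_zero _ hp0), ← pow_add]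
    congr 1; ring
  rw [e, div_div_eq_mul_div, mul_comm _ ((p : ℝ) ^ k), mul_div_assoc]
  congr 2
  rw [Finset.card_filter]
  push_cast
  refine Finset.sum_congr rfl fun x _ => ?_
  rw [← ind_and]
  unfold ind
  congr 1
  rw [eq_iff_iff, Int.modEq_comm, Int.modEq_iff_dvd]
  constructor
  · rintro ⟨h1, h2⟩; exact ⟨h2, h1⟩
  · rintro ⟨h1, h2⟩; exact ⟨h2, h1⟩

/-- Only the `p`-part of `L` matters for densities to powers of `p`, up to the volume of the residue
class. -/
lemma localCount_eq {p k : ℕ} (hp : p.Prime) (hL : 0 < L) (hk : padicValNat p L ≤ k) :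
    localCount F m L ν p k
      = (p : ℝ) ^ k * ((p : ℝ) ^ (3 * padicValNat p L))⁻¹ * solDens F m L ν (p ^ k) := by
  have : Fact p.Prime := ⟨hp⟩
  set l := padicValNat p L with hl
  have hpk : 0 < p ^ k := pow_pos hp.pos k
  obtain ⟨b, hb⟩ := Nat.exists_eq_add_of_le hk
  have hb' : p ^ k = p ^ l * p ^ b := by rw [hb, pow_add]
  obtain ⟨L', hL'⟩ : p ^ l ∣ L := pow_padicValNat_dvd
  have hcop : Nat.Coprime L' (p ^ k) := by
    refine Nat.Coprime.pow_right k ((Nat.Prime.coprime_iff_not_dvd hp).2 fun hd => ?_).symm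
    refine pow_succ_padicValNat_not_dvd (p := p) hL.ne' ?_
    rw [← hl, pow_succ]
    rw [hL']
    exact Nat.mul_dvd_mul_left _ hd
  have h1 := avg_ind_modEq_mul (pow_pos hp.pos l) (pow_pos hp.pos b) ν
    (f := fun x => ind (((p ^ k : ℕ) : ℤ) ∣ F x - m)) (by rw [← hb']; exact per_ind_dvd F m (p ^ k))
  rw [← hb'] at h1
  have h2 : solDens F m L ν (p ^ k) = avg (p ^ k) fun y =>
      ind (((p ^ k : ℕ) : ℤ) ∣ F (fun i => ((p ^ l : ℕ) : ℤ) * y i + ν i) - m) := by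
    unfold solDens
    rw [← avg_affine hpk (Nat.isCoprime_iff_coprime.2 hcop) 0
      (f := fun y => ind (((p ^ k : ℕ) : ℤ) ∣ F (fun i => ((p ^ l : ℕ) : ℤ) * y i + ν i) - m))]
    · refine avg_congr fun x => ?_
      congr 4
      ext i
      rw [hL']
      simp
      ring
    · convert! (per_ind_dvd F m (p ^ k)).comp_affine ((p ^ l : ℕ) : ℤ) ν using 1
  rw [h2, show (p : ℝ) ^ k * ((p : ℝ) ^ (3 * l))⁻¹ *
      (avg (p ^ k) fun y =>
        ind (((p ^ k : ℕ) : ℤ) ∣ F (fun i => ((p ^ l : ℕ) : ℤ) * y i + ν i) - m))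
      = (p : ℝ) ^ k * ((((p ^ l : ℕ) : ℝ) ^ 3)⁻¹ *
      (avg (p ^ k) fun y =>
        ind (((p ^ k : ℕ) : ℤ) ∣ F (fun i => ((p ^ l : ℕ) : ℤ) * y i + ν i) - m)))
      by push_cast; rw [mul_assoc, ← pow_mul, mul_comm 3 l], ← h1]
  exact localCount_eq_avg hp

/-- The density to the modulus `n` in the limit where the `p₀`-part of the equation degenerates to
the cone `F = 0`. -/
def limDens (F : QuadraticForm ℤ (Fin 3 → ℤ)) (m : ℤ) (L : ℕ) (ν : Fin 3 → ℤ) (p₀ n : ℕ) : ℝ :=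
  solDens F 0 1 0 (p₀ ^ n.factorization p₀) * solDens F m L ν (n / p₀ ^ n.factorization p₀)

lemma limDens_one (p₀ : ℕ) : limDens F m L ν p₀ 1 = 1 := by
  simp [limDens, solDens_one]

lemma limDens_mul {p₀ a b : ℕ} (ha : 0 < a) (hb : 0 < b) (h : Nat.Coprime a b) :
    limDens F m L ν p₀ (a * b) = limDens F m L ν p₀ a * limDens F m L ν p₀ b := by
  unfold limDens
  have h1 : p₀ ^ a.factorization p₀ ∣ a := Nat.ordProj_dvd a p₀
  have h2 : p₀ ^ b.factorization p₀ ∣ b := Nat.ordProj_dvd b p₀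
  rw [Nat.ordCompl_mul, Nat.ordProj_mul p₀ ha.ne' hb.ne',
    solDens_mul (Nat.ordProj_pos a p₀) (Nat.ordProj_pos b p₀)
      ((h.coprime_dvd_left h1).coprime_dvd_right h2),
    solDens_mul (Nat.ordCompl_pos p₀ ha.ne') (Nat.ordCompl_pos p₀ hb.ne')
      ((h.coprime_dvd_left (Nat.ordCompl_dvd a p₀)).coprime_dvd_right (Nat.ordCompl_dvd b p₀))]
  ring

lemma limDens_nonneg (p₀ n : ℕ) : 0 ≤ limDens F m L ν p₀ n :=
  mul_nonneg (solDens_nonneg _) (solDens_nonneg _)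

lemma limDens_antitone {p₀ a b : ℕ} (hb : 0 < b) (h : a ∣ b) :
    limDens F m L ν p₀ b ≤ limDens F m L ν p₀ a := by
  have ha : 0 < a := Nat.pos_of_dvd_of_pos h hb
  unfold limDens
  refine mul_le_mul (solDens_antitone (Nat.ordProj_pos b p₀) ?_)
    (solDens_antitone (Nat.ordCompl_pos p₀ hb.ne') (Nat.ordCompl_dvd_ordCompl_of_dvd h p₀))
    (solDens_nonneg _) (solDens_nonneg _)
  exact Nat.ordProj_dvd_ordProj_of_dvd hb.ne' h p₀

lemma limDens_p₀_pow {p₀ : ℕ} (hp₀ : p₀.Prime) (k : ℕ) :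
    limDens F m L ν p₀ (p₀ ^ k) = solDens F 0 1 0 (p₀ ^ k) := by
  unfold limDens
  rw [hp₀.factorization_pow]
  simp [Nat.div_self (pow_pos hp₀.pos k), solDens_one]

lemma limDens_of_not_dvd {p₀ n : ℕ} (h : ¬ p₀ ∣ n) :
    limDens F m L ν p₀ n = solDens F m L ν n := by
  unfold limDens
  rw [Nat.factorization_eq_zero_of_not_dvd h]
  simp [solDens_one]

/-- For moduli with `p₀`-part at most `p₀ ^ (2 h)` the density attached to `p₀ ^ h • ν` has already
reached its limit. -/
lemma solDens_eq_limDens {p₀ h n : ℕ} (hp₀ : p₀.Prime) (hL : ¬ p₀ ∣ L) (hn : 0 < n)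
    (hv : n.factorization p₀ ≤ 2 * h) :
    solDens F (m * ((p₀ ^ h : ℕ) : ℤ) ^ 2) L (((p₀ ^ h : ℕ) : ℤ) • ν) n = limDens F m L ν p₀ n := by
  have hc : Nat.Coprime p₀ (n / p₀ ^ n.factorization p₀) := Nat.coprime_ordCompl hp₀ hn.ne'
  conv_lhs => rw [← Nat.ordProj_mul_ordCompl_eq_self n p₀]
  rw [solDens_mul (Nat.ordProj_pos n p₀) (Nat.ordCompl_pos p₀ hn.ne') (Nat.Coprime.pow_left _ hc),
    solDens_scale (Nat.ordCompl_pos p₀ hn.ne') (Nat.Coprime.pow_left _ hc),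
    solDens_cone (Nat.ordProj_pos n p₀)
      (Nat.Coprime.pow_right _ ((Nat.Prime.coprime_iff_not_dvd hp₀).2 hL).symm)]
  · rfl
  · refine Dvd.dvd.mul_left ?_ _
    push_cast
    rw [← pow_mul, mul_comm h 2]
    exact pow_dvd_pow _ hv

/-! ### The exponential sum in terms of densities -/

/-- Orthogonality of the additive characters modulo `d`. -/
lemma sum_exp_eq (d : ℕ) (hd : 0 < d) (M : ℤ) :
    ∑ a ∈ Finset.range d, Complex.exp (2 * Real.pi * Complex.I * (a * M / d))
      = (d : ℂ) * (ind ((d : ℤ) ∣ M) : ℝ) := by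
  set z := Complex.exp (2 * Real.pi * Complex.I * (M / d)) with hz
  have hd' : (d : ℂ) ≠ 0 := by exact_mod_cast hd.ne'
  have h1 : ∀ a ∈ Finset.range d, Complex.exp (2 * Real.pi * Complex.I * (a * M / d)) = z ^ a := by
    intro a _
    rw [hz, ← Complex.exp_nat_mul]
    congr 1
    ring
  have hzd : z ^ d = 1 := by
    rw [hz, ← Complex.exp_nat_mul, Complex.exp_eq_one_iff]
    exact ⟨M, by field_simp⟩
  rw [Finset.sum_congr rfl h1]
  by_cases h : (d : ℤ) ∣ M
  · obtain ⟨k, rfl⟩ := h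
    have : z = 1 := by
      rw [hz, Complex.exp_eq_one_iff]
      exact ⟨k, by push_cast; field_simp⟩
    simp [this, ind_of]
  · rw [ind_of_not h, Complex.ofReal_zero, mul_zero]
    have hz1 : z - 1 ≠ 0 := by
      rw [sub_ne_zero]
      intro h1
      rw [hz, Complex.exp_eq_one_iff] at h1
      obtain ⟨k, hk⟩ := h1
      apply h
      refine ⟨k, ?_⟩
      have h2 : (M : ℂ) / d = k := by
        have h3 : (2 * Real.pi * Complex.I : ℂ) ≠ 0 := Complex.two_pi_I_ne_zero
        exact mul_left_cancel₀ h3 (by rw [hk]; ring)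
      rw [div_eq_iff hd'] at h2
      have : (M : ℂ) = ((k * d : ℤ) : ℂ) := by push_cast; exact h2
      rw [mul_comm]
      exact_mod_cast this
    have := mul_geom_sum z d
    rw [hzd, sub_self] at this
    exact (mul_eq_zero.1 this).resolve_left hz1

open ArithmeticFunction in
/-- The evaluation of Ramanujan's sum. -/
lemma ramanujan_sum (q : ℕ) (hq : 0 < q) (M : ℤ) :
    ∑ a ∈ (Finset.range q).filter (fun a => Nat.Coprime a q),
      Complex.exp (2 * Real.pi * Complex.I * (a * M / q))
      = ∑ z ∈ q.divisorsAntidiagonal, (moebius z.1 : ℂ)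
        * ((z.2 : ℂ) * (ind ((z.2 : ℤ) ∣ M) : ℝ)) := by
  have h1 : ∀ a : ℕ, (if Nat.Coprime a q then (1 : ℂ) else 0)
      = ∑ e ∈ q.divisors, if e ∣ a then (moebius e : ℂ) else 0 := by
    intro a
    have hg : 0 < Nat.gcd a q := Nat.gcd_pos_of_pos_right a hq
    have h2 : ∑ e ∈ (Nat.gcd a q).divisors, (moebius e : ℤ)
        = if Nat.gcd a q = 1 then 1 else 0 := by
      rw [← coe_mul_zeta_apply, moebius_mul_coe_zeta, one_apply]
    have h3 : (Nat.gcd a q).divisors = q.divisors.filter fun e => e ∣ a := by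
      ext e
      simp only [Nat.mem_divisors, Finset.mem_filter, Nat.dvd_gcd_iff]
      constructor
      · rintro ⟨⟨h, h'⟩, -⟩; exact ⟨⟨h', hq.ne'⟩, h⟩
      · rintro ⟨⟨h, -⟩, h'⟩; exact ⟨⟨h', h⟩, hg.ne'⟩
    rw [h3, Finset.sum_filter] at h2
    have := congrArg (Int.cast : ℤ → ℂ) h2
    push_cast at this
    exact this.symm
  rw [Finset.sum_filter]
  have h4 : ∀ a ∈ Finset.range q, (if Nat.Coprime a q then
      Complex.exp (2 * Real.pi * Complex.I * (a * M / q)) else 0)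
      = ∑ e ∈ q.divisors, if e ∣ a then
        (moebius e : ℂ) * Complex.exp (2 * Real.pi * Complex.I * (a * M / q)) else 0 := by
    intro a _
    have := congrArg (· * Complex.exp (2 * Real.pi * Complex.I * (a * M / q))) (h1 a)
    simp only [Finset.sum_mul, ite_mul, one_mul, zero_mul] at this
    exact this
  rw [Finset.sum_congr rfl h4, Finset.sum_comm,
    Nat.sum_divisorsAntidiagonal fun a b : ℕ =>
      (moebius a : ℂ) * ((b : ℂ) * (ind ((b : ℤ) ∣ M) : ℝ))]
  refine Finset.sum_congr rfl fun e he => ?_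
  obtain ⟨⟨d, rfl⟩, -⟩ := Nat.mem_divisors.1 he
  have he0 : 0 < e := Nat.pos_of_mul_pos_right hq
  have hd0 : 0 < d := Nat.pos_of_mul_pos_left hq
  rw [Nat.mul_div_cancel_left d he0, ← sum_exp_eq d hd0 M, ← Finset.sum_filter, ← Finset.mul_sum]
  congr 1
  refine Finset.sum_nbij' (fun a => a / e) (fun b => e * b) ?_ ?_ ?_ ?_ ?_
  · intro a ha
    rw [Finset.mem_filter, Finset.mem_range] at ha
    rw [Finset.mem_range]
    exact Nat.div_lt_of_lt_mul ha.1
  · intro b hb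
    rw [Finset.mem_range] at hb
    rw [Finset.mem_filter, Finset.mem_range]
    exact ⟨Nat.mul_lt_mul_of_pos_left hb he0, dvd_mul_right _ _⟩
  · intro a ha
    rw [Finset.mem_filter] at ha
    exact Nat.mul_div_cancel' ha.2
  · intro b _
    exact Nat.mul_div_cancel_left b he0
  · intro a ha
    rw [Finset.mem_filter] at ha
    obtain ⟨b, rfl⟩ := ha.2
    rw [Nat.mul_div_cancel_left b he0]
    congr 2
    have : (e : ℂ) ≠ 0 := by exact_mod_cast he0.ne'
    push_cast
    field_simp

open ArithmeticFunction in
/-- At `c = 0` Ramanujan's sum turns the exponential sum into a Möbius convolution of the densities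
to the moduli `d L ^ 2`. -/
lemma expSum_zero_div {N q : ℕ} (hL : 0 < L) (hq : 0 < q) :
    expSum F m L N ν q 0 / ((q : ℂ) * (L : ℂ)) ^ 3
      = ((∑ z ∈ q.divisorsAntidiagonal, (moebius z.1 : ℝ) *
          (z.2 * solDens F (m * N) L ν (z.2 * L ^ 2)) : ℝ) : ℂ) := by
  classical
  have hL' : (L : ℂ) ≠ 0 := by exact_mod_cast hL.ne'
  have hq' : (q : ℂ) ≠ 0 := by exact_mod_cast hq.ne'
  have hLz : (L : ℤ) ^ 2 ≠ 0 := by positivity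
  have h1 : expSum F m L N ν q 0 = ∑ σ ∈ residues (q * L), ∑ z ∈ q.divisorsAntidiagonal,
      (((moebius z.1 : ℝ) *
        (z.2 * ind (((z.2 * L ^ 2 : ℕ) : ℤ) ∣ F ((L : ℤ) • σ + ν) - m * N)) : ℝ) : ℂ) := by
    unfold expSum
    rw [Finset.sum_comm, Finset.sum_filter]
    refine Finset.sum_congr rfl fun σ _ => ?_
    split_ifs with h
    · obtain ⟨M, hM⟩ := h
      have e1 : ∀ a ∈ (Finset.range q).filter (fun a => Nat.Coprime a q),
          expo ((q : ℝ) * (L : ℝ))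
            ((a : ℝ) * (((F ((L : ℤ) • σ + ν) - m * (N : ℤ) : ℤ) : ℝ) / (L : ℝ))
            + ((∑ i, (0 : Fin 3 → ℤ) i * σ i : ℤ) : ℝ))
          = Complex.exp (2 * Real.pi * Complex.I * (a * M / q)) := by
        intro a _
        unfold expo
        congr 1
        rw [hM]
        simp
        field_simp
      rw [Finset.sum_congr rfl e1, ramanujan_sum q hq M]
      refine Finset.sum_congr rfl fun z _ => ?_
      push_cast
      congr 3
      rw [hM, mul_comm (z.2 : ℤ)]
      exact ind_congr (mul_dvd_mul_iff_left hLz).symm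
    · symm
      refine Finset.sum_eq_zero fun z _ => ?_
      rw [ind_of_not]
      · simp
      · intro h'
        apply h
        push_cast at h'
        exact dvd_of_mul_left_dvd h'
  rw [h1, ← Complex.ofReal_natCast, ← Complex.ofReal_natCast L]
  simp only [← Complex.ofReal_sum]
  rw [← Complex.ofReal_mul, ← Complex.ofReal_pow, ← Complex.ofReal_div]
  congr 1
  have h2 : ((q : ℝ) * (L : ℝ)) ^ 3 = ((q * L : ℕ) : ℝ) ^ 3 := by push_cast; rfl
  rw [h2]
  change avg (q * L) _ = _
  rw [avg_sum]
  refine Finset.sum_congr rfl fun z hz => ?_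
  rw [avg_const_mul, avg_const_mul]
  congr 2
  have hz1 : z.1 * z.2 = q := (Nat.mem_divisorsAntidiagonal.1 hz).1
  have hz2 : 0 < z.2 := Nat.pos_of_mul_pos_left (hz1 ▸ hq)
  -- as a condition on `σ`, divisibility by `z.2 * L ^ 2` is already periodic modulo `z.2 * L`
  have hper : Per (z.2 * L) fun x =>
      ind (((z.2 * L ^ 2 : ℕ) : ℤ) ∣ F ((L : ℤ) • x + ν) - m * N) := by
    intro x y hxy
    refine per_ind_dvd F (m * N) (z.2 * L ^ 2) _ _ fun i => ?_
    have h := (hxy i).mul_left' (c := (L : ℤ))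
    have e : (((z.2 * L ^ 2 : ℕ)) : ℤ) = (L : ℤ) * ((z.2 * L : ℕ) : ℤ) := by push_cast; ring
    rw [e]
    simpa using h.add_right (ν i)
  rw [avg_eq_of_dvd (Nat.mul_pos hq hL) (Nat.mul_dvd_mul_right (hz1 ▸ dvd_mul_left _ _) L) hper,
    ← avg_eq_of_dvd (Nat.mul_pos hz2 (pow_pos hL 2))
      (Nat.mul_dvd_mul_left _ (Dvd.intro L (sq L).symm))
      hper]
  rfl

end

section

/-! ### Stabilisation of the local densities -/

lemma sum_ind_dvd_add_mul {p : ℕ} (hp : p.Prime) (c : ℤ) {d : ℤ} (hd : ¬ (p : ℤ) ∣ d) :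
    ∑ τ ∈ Finset.range p, ind ((p : ℤ) ∣ c + τ * d) = 1 := by
  have : Fact p.Prime := ⟨hp⟩
  have hd' : (d : ZMod p) ≠ 0 := by rwa [Ne, ZMod.intCast_zmod_eq_zero_iff_dvd]
  have key : ∀ τ : ℕ, (p : ℤ) ∣ c + τ * d ↔ (τ : ZMod p) = -c / d := by
    intro τ
    rw [← ZMod.intCast_zmod_eq_zero_iff_dvd, eq_div_iff hd', eq_neg_iff_add_eq_zero, add_comm]
    push_cast
    rfl
  rw [Finset.sum_eq_single_of_mem ((-c / d : ZMod p).val) (Finset.mem_range.2 (ZMod.val_lt _))]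
  · exact ind_of ((key _).2 (ZMod.natCast_zmod_val _))
  · intro τ hτ hne
    refine ind_of_not fun h => hne ?_
    rw [← (key τ).1 h, ZMod.val_natCast_of_lt (Finset.mem_range.1 hτ)]

lemma ind_pow_succ_dvd {p k : ℕ} (hp : p.Prime) {a b c : ℤ}
    (h : a ≡ ((p ^ k : ℕ) : ℤ) * c + b [ZMOD ((p ^ (k + 1) : ℕ) : ℤ)]) (hb : b = 0) :
    ind (((p ^ (k + 1) : ℕ) : ℤ) ∣ a) = ind ((p : ℤ) ∣ c) := by
  subst hb
  rw [add_zero] at h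
  refine ind_congr ((Int.ModEq.dvd_iff h).trans ?_)
  have e : ((p ^ (k + 1) : ℕ) : ℤ) = ((p ^ k : ℕ) : ℤ) * p := by push_cast; ring
  rw [e]
  exact mul_dvd_mul_iff_left (by exact_mod_cast (pow_pos hp.pos k).ne')

variable {F : QuadraticForm ℤ (Fin 3 → ℤ)} {m : ℤ} {L : ℕ} {ν : Fin 3 → ℤ}

/-- A version of Hensel's lemma. For `2 m = p ^ v m'` with `p ∤ m'`, among the multiples
`(1 + p ^ i τ) x` of a solution modulo `p ^ (i + v)`, with `τ` modulo `p`, exactly one is a solution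
modulo `p ^ (i + v + 1)`. -/
lemma localCount_succ {p : ℕ} (hp : p.Prime) {v i : ℕ} {m' : ℤ} (hm : 2 * m = (p : ℤ) ^ v * m')
    (hm' : ¬ (p : ℤ) ∣ m') (hi : 1 ≤ i) (hl : padicValNat p L ≤ i) (hv : v + 1 ≤ i) :
    localCount F m L ν p (i + v + 1) = localCount F m L ν p (i + v) := by
  have hp0 : (p : ℝ) ≠ 0 := by exact_mod_cast hp.ne_zero
  set l := padicValNat p L with hldef
  set k := i + v with hk
  rw [localCount_eq_avg hp, localCount_eq_avg hp, ← hldef]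
  have hcond : Per (p ^ k) fun x => ind (∀ i, x i ≡ ν i [ZMOD ((p ^ l : ℕ) : ℤ)]) := by
    intro x y hxy
    refine ind_congr (forall_congr' fun j => ?_)
    have : x j ≡ y j [ZMOD ((p ^ l : ℕ) : ℤ)] := (hxy j).of_dvd
      (by exact_mod_cast pow_dvd_pow p (by omega : l ≤ k))
    exact ⟨fun h => this.symm.trans h, fun h => this.trans h⟩
  have hf : Per (p ^ (k + 1)) fun x => ind (∀ i, x i ≡ ν i [ZMOD ((p ^ l : ℕ) : ℤ)]) *
        ind (((p ^ (k + 1) : ℕ) : ℤ) ∣ F x - m) :=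
    (hcond.mono (pow_dvd_pow p (Nat.le_succ k))).mul (per_ind_dvd F m _)
  have key := avg_of_orbit (M := p ^ (k + 1)) (p := p)
    (f := fun x => ind (∀ i, x i ≡ ν i [ZMOD ((p ^ l : ℕ) : ℤ)]) *
        ind (((p ^ (k + 1) : ℕ) : ℤ) ∣ F x - m))
    (g := fun x => ind (∀ i, x i ≡ ν i [ZMOD ((p ^ l : ℕ) : ℤ)]) *
        ind (((p ^ k : ℕ) : ℤ) ∣ F x - m))
    (fun τ x j => (1 + (p : ℤ) ^ i * τ) * x j + (0 : Fin 3 → ℤ) j) ?_ ?_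
  · rw [avg_eq_of_dvd (pow_pos hp.pos _) (pow_dvd_pow p (Nat.le_succ k))
      (hcond.mul (per_ind_dvd F m _))] at key
    rw [← key, pow_succ]
    ring
  · intro τ
    refine avg_affine (pow_pos hp.pos _) ?_ 0 hf
    push_cast
    refine IsCoprime.pow_right ⟨1, -((p : ℤ) ^ (i - 1) * τ), ?_⟩
    obtain ⟨j, rfl⟩ := Nat.exists_eq_add_of_le' hi
    rw [Nat.add_sub_cancel, pow_succ]
    ring
  · intro x
    have hclass : ∀ τ : ℕ, ind (∀ j, (1 + (p : ℤ) ^ i * τ) * x j + (0 : Fin 3 → ℤ) j ≡ ν j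
        [ZMOD ((p ^ l : ℕ) : ℤ)]) = ind (∀ j, x j ≡ ν j [ZMOD ((p ^ l : ℕ) : ℤ)]) := by
      intro τ
      refine ind_congr (forall_congr' fun j => ?_)
      have : (1 + (p : ℤ) ^ i * τ) * x j + (0 : Fin 3 → ℤ) j ≡ x j [ZMOD ((p ^ l : ℕ) : ℤ)] := by
        rw [Int.modEq_comm, Int.modEq_iff_dvd]
        have : (1 + (p : ℤ) ^ i * τ) * x j + (0 : Fin 3 → ℤ) j - x j = (p : ℤ) ^ i * (τ * x j) := by
          simp; ring
        rw [this]
        push_cast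
        exact (pow_dvd_pow _ hl).mul_right _
      exact ⟨fun h => this.symm.trans h, fun h => this.trans h⟩
    simp only [hclass]
    rw [← Finset.mul_sum]
    congr 1
    have hFT : ∀ τ : ℕ, F (fun j => (1 + (p : ℤ) ^ i * τ) * x j + (0 : Fin 3 → ℤ) j)
        = (1 + (p : ℤ) ^ i * τ) ^ 2 * F x := by
      intro τ
      have : (fun j => (1 + (p : ℤ) ^ i * τ) * x j + (0 : Fin 3 → ℤ) j)
          = (1 + (p : ℤ) ^ i * τ) • x := by ext j; simp
      rw [this, QuadraticMap.map_smul, smul_eq_mul]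
      ring
    obtain ⟨i', hi'⟩ := Nat.exists_eq_add_of_le hv
    by_cases hx : ((p ^ k : ℕ) : ℤ) ∣ F x - m
    · rw [ind_of hx]
      obtain ⟨c, hc⟩ := hx
      rw [← sum_ind_dvd_add_mul hp c hm']
      refine Finset.sum_congr rfl fun τ _ => ?_
      refine ind_pow_succ_dvd hp (b := 0) ?_ rfl
      rw [hFT, Int.modEq_comm, Int.modEq_iff_dvd]
      have hFx : F x = m + ((p ^ k : ℕ) : ℤ) * c := by linarith
      obtain ⟨i'', hi''⟩ := Nat.exists_eq_add_of_le' hi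
      refine ⟨(p : ℤ) ^ i'' * (2 * τ * c) + (p : ℤ) ^ i' * τ ^ 2 * F x, ?_⟩
      have e1 : (p : ℤ) ^ (k + 1) = (p : ℤ) ^ k * p := pow_succ _ _
      have e2 : (p : ℤ) ^ i = (p : ℤ) ^ i'' * p := by rw [hi'', pow_succ]
      have e3 : (p : ℤ) ^ i * (p : ℤ) ^ i = (p : ℤ) ^ (k + 1) * (p : ℤ) ^ i' := by
        rw [← pow_add, ← pow_add]; congr 1; omega
      have e4 : (p : ℤ) ^ k = (p : ℤ) ^ i * (p : ℤ) ^ v := by rw [hk, pow_add]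
      push_cast at hFx ⊢
      have : (1 + (p : ℤ) ^ i * τ) ^ 2 * F x - m - ((p : ℤ) ^ k * (c + τ * m') + 0)
          = (F x - m - (p : ℤ) ^ k * c) + 2 * (p : ℤ) ^ i * τ * (F x - m)
            + τ * (p : ℤ) ^ i * (2 * m - (p : ℤ) ^ v * m')
            + τ * m' * ((p : ℤ) ^ i * (p : ℤ) ^ v - (p : ℤ) ^ k)
            + ((p : ℤ) ^ i * (p : ℤ) ^ i) * τ ^ 2 * F x := by ring
      rw [this, hm, ← e4, e3]
      have h1 : F x - m = (p : ℤ) ^ k * c := by linarith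
      rw [h1]
      calc _ = 2 * (p : ℤ) ^ i * τ * ((p : ℤ) ^ k * c)
            + ((p : ℤ) ^ (k + 1) * (p : ℤ) ^ i') * τ ^ 2 * F x := by ring
        _ = _ := by rw [e2, e1]; ring
    · rw [ind_of_not hx]
      refine Finset.sum_eq_zero fun τ _ => ind_of_not fun h => hx ?_
      rw [hFT] at h
      set u : ℤ := 1 + (p : ℤ) ^ i * τ with hu
      have hk1 : (p : ℤ) ^ k ∣ u ^ 2 * F x - m :=
        (pow_dvd_pow _ (Nat.le_succ k)).trans (by exact_mod_cast h)
      have hcop : IsCoprime ((p : ℤ) ^ v) (u ^ 2) := by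
        refine IsCoprime.pow (IsCoprime.symm ⟨1, -((p : ℤ) ^ (i - 1) * τ), ?_⟩)
        obtain ⟨j, rfl⟩ := Nat.exists_eq_add_of_le' hi
        rw [Nat.add_sub_cancel, hu, pow_succ]
        ring
      have h2 : (p : ℤ) ^ v ∣ 2 * F x := by
        refine hcop.dvd_of_dvd_mul_left ?_
        have h3 : (p : ℤ) ^ v ∣ u ^ 2 * F x - m :=
          (pow_dvd_pow _ (by omega : v ≤ k)).trans hk1
        have e : u ^ 2 * (2 * F x) = 2 * (u ^ 2 * F x - m) + 2 * m := by ring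
        rw [e, hm]
        exact dvd_add (h3.mul_left _) (dvd_mul_right _ _)
      obtain ⟨y, hy⟩ := h2
      have e : F x - m = (u ^ 2 * F x - m) - ((p : ℤ) ^ i * τ * (2 * F x)
          + ((p : ℤ) ^ i * (p : ℤ) ^ i) * (τ ^ 2 * F x)) := by rw [hu]; ring
      push_cast
      rw [e, hy]
      refine dvd_sub hk1 (dvd_add ⟨τ * y, by rw [hk, pow_add]; ring⟩ ?_)
      rw [← pow_add]
      exact (pow_dvd_pow _ (by omega : k ≤ i + i)).mul_right _

lemma exists_localCount_eq {p : ℕ} (hp : p.Prime) (hm : m ≠ 0) :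
    ∃ k₀, ∀ k, k₀ ≤ k → localCount F m L ν p k = localCount F m L ν p k₀ := by
  obtain ⟨v, m', hm', h⟩ := (Int.finiteMultiplicity_iff.2
    ⟨by simpa using hp.ne_one, by simpa using hm⟩ :
      FiniteMultiplicity (p : ℤ) (2 * m)).exists_eq_pow_mul_and_not_dvd
      |>.elim fun c hc => (⟨_, c, hc.2, hc.1⟩ : ∃ v m', ¬ (p : ℤ) ∣ m' ∧ 2 * m = (p : ℤ) ^ v * m')
  refine ⟨padicValNat p L + v + 1 + v, fun k hk => ?_⟩
  induction k, hk using Nat.le_induction with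
  | base => rfl
  | succ k hk ih =>
    rw [← ih]
    obtain ⟨i, rfl⟩ : ∃ i, k = i + v := ⟨k - v, by omega⟩
    exact localCount_succ hp h hm' (by omega) (by omega) (by omega)

lemma localCount_good {p : ℕ} (hp : p.Prime) (hm : ¬ (p : ℤ) ∣ 2 * m) (hL : ¬ p ∣ L) {k : ℕ}
    (hk : 1 ≤ k) : localCount F m L ν p k = localCount F m L ν p 1 := by
  induction k, hk using Nat.le_induction with
  | base => rfl
  | succ k hk ih =>
    rw [← ih]
    exact localCount_succ (v := 0) hp (by simp) hm hk
      (by rw [padicValNat.eq_zero_of_not_dvd hL]; omega) (by omega)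

/-! ### The density of the cone -/

lemma polar_eq_sum (F : QuadraticForm ℤ (Fin 3 → ℤ)) (x y : Fin 3 → ℤ) :
    QuadraticMap.polar F x y = ∑ i, ∑ j, polarMatrix F i j * x i * y j := by
  have hx : ∀ x : Fin 3 → ℤ, x = ∑ i, x i • (Pi.single i 1 : Fin 3 → ℤ) := by
    intro x
    ext j
    simp [Finset.sum_apply, Pi.single_apply]
  have h : QuadraticMap.polar F x y = QuadraticMap.polarBilin F x y := rfl
  rw [h]
  conv_lhs => rw [hx x, hx y]
  simp only [map_sum, LinearMap.sum_apply, map_smul, LinearMap.smul_apply,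
    QuadraticMap.polarBilin_apply_apply, smul_eq_mul]
  rw [Finset.sum_comm]
  refine Finset.sum_congr rfl fun j _ => ?_
  rw [Finset.mul_sum]
  refine Finset.sum_congr rfl fun i _ => ?_
  change _ = QuadraticMap.polar F (Pi.single i 1) (Pi.single j 1) * x i * y j
  ring

/-- The `i`-th column of the adjugate is a direction along which the differential of `F` at `x` is
`det * x i`. -/
lemma polar_adjugate (F : QuadraticForm ℤ (Fin 3 → ℤ)) (x : Fin 3 → ℤ) (i : Fin 3) :
    QuadraticMap.polar F x (fun j => (polarMatrix F).adjugate j i) = (polarMatrix F).det * x i := by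
  rw [polar_eq_sum]
  have h : ∀ k, ∑ j, polarMatrix F k j * (polarMatrix F).adjugate j i
      = if k = i then (polarMatrix F).det else 0 := by
    intro k
    have := congrFun (congrFun (Matrix.mul_adjugate (polarMatrix F)) k) i
    rw [Matrix.mul_apply] at this
    rw [this]
    simp [Matrix.one_apply]
  have h2 : ∀ k, ∑ j, polarMatrix F k j * x k * (polarMatrix F).adjugate j i
      = x k * if k = i then (polarMatrix F).det else 0 := by
    intro k
    rw [← h, Finset.mul_sum]
    exact Finset.sum_congr rfl fun j _ => by ring
  rw [Finset.sum_congr rfl fun k _ => h2 k]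
  simp [mul_comm]

/-- The density of the primitive solutions of `F(x) ≡ 0` modulo `p ^ t`. -/
def primDens (F : QuadraticForm ℤ (Fin 3 → ℤ)) (p t : ℕ) : ℝ :=
  avg (p ^ t) fun x => ind (¬ ∀ i, (p : ℤ) ∣ x i) * ind (((p ^ t : ℕ) : ℤ) ∣ F x)

lemma solDens_zero (n : ℕ) :
    solDens F 0 1 0 n = avg n fun x => ind ((n : ℤ) ∣ F x) := by
  unfold solDens
  refine avg_congr fun x => ?_
  simp

lemma per_ind_dvd' (F : QuadraticForm ℤ (Fin 3 → ℤ)) (n : ℕ) :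
    Per n fun x => ind ((n : ℤ) ∣ F x) := by
  have := per_ind_dvd F 0 n
  simpa using this

lemma per_of_mod_p {p t : ℕ} (ht : 1 ≤ t) {C : (Fin 3 → ℤ) → Prop}
    (hC : ∀ x y : Fin 3 → ℤ, (∀ i, x i ≡ y i [ZMOD p]) → (C x ↔ C y)) :
    Per (p ^ t) fun x => ind (C x) := fun x y hxy =>
  ind_congr (hC x y fun i => (hxy i).of_dvd (by
    push_cast
    exact dvd_pow_self _ (by omega)))

/-- Moving `x` along a column of the adjugate, by multiples of `p ^ s`, shifts `F x` through all
lifts of its residue class modulo `p ^ (s + δ)`, as long as the corresponding coordinate is prime to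
`p`. -/
lemma primDens_succ_aux {p : ℕ} (hp : p.Prime) {δ s : ℕ} {d : ℤ}
    (hd : (polarMatrix F).det = (p : ℤ) ^ δ * d) (hpd : ¬ (p : ℤ) ∣ d) (hs : δ + 1 ≤ s) (i : Fin 3)
    {C : (Fin 3 → ℤ) → Prop}
    (hC : ∀ x y : Fin 3 → ℤ, (∀ i, x i ≡ y i [ZMOD p]) → (C x ↔ C y))
    (hCi : ∀ x, C x → ¬ (p : ℤ) ∣ x i) :
    p * avg (p ^ (s + δ + 1)) (fun x => ind (C x) * ind (((p ^ (s + δ + 1) : ℕ) : ℤ) ∣ F x))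
      = avg (p ^ (s + δ)) fun x => ind (C x) * ind (((p ^ (s + δ) : ℕ) : ℤ) ∣ F x) := by
  set t := s + δ with ht
  have hper1 : Per (p ^ (t + 1)) fun x => ind (C x) * ind (((p ^ (t + 1) : ℕ) : ℤ) ∣ F x) :=
    (per_of_mod_p (by omega) hC).mul (per_ind_dvd' F _)
  have hper : Per (p ^ t) fun x => ind (C x) * ind (((p ^ t : ℕ) : ℤ) ∣ F x) :=
    (per_of_mod_p (by omega) hC).mul (per_ind_dvd' F _)
  rw [← avg_eq_of_dvd (pow_pos hp.pos (t + 1)) (pow_dvd_pow p (Nat.le_succ t)) hper]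
  set b : Fin 3 → ℤ := fun j => (polarMatrix F).adjugate j i with hb
  refine avg_of_orbit (fun τ x j => 1 * x j + ((p : ℤ) ^ s * τ) * b j)
    (fun τ => avg_affine (pow_pos hp.pos _) isCoprime_one_left _ hper1) fun x => ?_
  have hclass : ∀ τ : ℕ, ind (C fun j => 1 * x j + ((p : ℤ) ^ s * τ) * b j) = ind (C x) := by
    intro τ
    refine ind_congr (hC _ _ fun j => ?_)
    rw [Int.modEq_comm, Int.modEq_iff_dvd]
    have : 1 * x j + ((p : ℤ) ^ s * τ) * b j - x j = (p : ℤ) ^ s * (τ * b j) := by ring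
    rw [this]
    exact (dvd_pow_self _ (by omega)).mul_right _
  simp only [hclass]
  rw [← Finset.mul_sum]
  by_cases hCx : C x
  · congr 1
    have hFT : ∀ τ : ℕ, F (fun j => 1 * x j + ((p : ℤ) ^ s * τ) * b j)
        = F x + ((p : ℤ) ^ s * τ) ^ 2 * F b + (p : ℤ) ^ t * (τ * (d * x i)) := by
      intro τ
      have : (fun j => 1 * x j + ((p : ℤ) ^ s * τ) * b j) = x + ((p : ℤ) ^ s * τ) • b := by
        ext j; simp
      rw [this, form_add_smul, polar_adjugate, hd, ht, pow_add]
      ring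
    have hdx : ¬ (p : ℤ) ∣ d * x i := fun h =>
      ((Nat.prime_iff_prime_int.1 hp).dvd_or_dvd h).elim hpd (hCi x hCx)
    obtain ⟨s', hs'⟩ := Nat.exists_eq_add_of_le hs
    have e3 : (p : ℤ) ^ s * (p : ℤ) ^ s = (p : ℤ) ^ (t + 1) * (p : ℤ) ^ s' := by
      rw [← pow_add, ← pow_add]; congr 1; omega
    by_cases hx : ((p ^ t : ℕ) : ℤ) ∣ F x
    · rw [ind_of hx]
      obtain ⟨c, hc⟩ := hx
      rw [← sum_ind_dvd_add_mul hp c hdx]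
      refine Finset.sum_congr rfl fun τ _ => ind_pow_succ_dvd hp (b := 0) ?_ rfl
      rw [hFT, hc, Int.modEq_comm, Int.modEq_iff_dvd]
      refine ⟨(p : ℤ) ^ s' * τ ^ 2 * F b, ?_⟩
      push_cast
      linear_combination τ ^ 2 * F b * e3
    · rw [ind_of_not hx]
      refine Finset.sum_eq_zero fun τ _ => ind_of_not fun h => hx ?_
      rw [hFT] at h
      push_cast at h ⊢
      have h1 : (p : ℤ) ^ t ∣ F x + ((p : ℤ) ^ s * τ) ^ 2 * F b + (p : ℤ) ^ t * (τ * (d * x i)) :=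
        (pow_dvd_pow _ (Nat.le_succ t)).trans h
      have h2 : (p : ℤ) ^ t ∣ ((p : ℤ) ^ s * τ) ^ 2 * F b := by
        rw [mul_pow, sq ((p : ℤ) ^ s), ← pow_add]
        exact ((pow_dvd_pow _ (by omega : t ≤ s + s)).mul_right _).mul_right _
      have h3 := (dvd_add_left (dvd_mul_right _ _)).1 h1
      exact (dvd_add_left h2).1 h3
  · rw [ind_of_not hCx, zero_mul, zero_mul]

/-- For large exponents the density of primitive solutions drops by the factor `p` at each step. -/
lemma primDens_succ {p : ℕ} (hp : p.Prime) {δ s : ℕ} {d : ℤ}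
    (hd : (polarMatrix F).det = (p : ℤ) ^ δ * d) (hpd : ¬ (p : ℤ) ∣ d) (hs : δ + 1 ≤ s) :
    p * primDens F p (s + δ + 1) = primDens F p (s + δ) := by
  -- split the primitive vectors according to the first coordinate that is prime to `p`
  let C : Fin 3 → (Fin 3 → ℤ) → Prop := fun i x => ¬ (p : ℤ) ∣ x i ∧ ∀ j < i, (p : ℤ) ∣ x j
  have hsplit : ∀ x : Fin 3 → ℤ, ind (¬ ∀ i, (p : ℤ) ∣ x i) = ∑ i, ind (C i x) := by
    intro x
    simp only [Fin.sum_univ_three, C, Fin.forall_fin_succ, Fin.lt_def]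
    by_cases h0 : (p : ℤ) ∣ x 0 <;> by_cases h1 : (p : ℤ) ∣ x 1 <;> by_cases h2 : (p : ℤ) ∣ x 2 <;>
      simp [h0, h1, h2, ind]
  have e : ∀ t, primDens F p t
      = ∑ i, avg (p ^ t) fun x => ind (C i x) * ind (((p ^ t : ℕ) : ℤ) ∣ F x) := by
    intro t
    unfold primDens
    simp only [hsplit, Finset.sum_mul]
    exact avg_sum _ _
  rw [e, e, Finset.mul_sum]
  refine Finset.sum_congr rfl fun i _ => primDens_succ_aux hp hd hpd hs i ?_ fun x hx => hx.1
  intro x y hxy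
  have h : ∀ j, (p : ℤ) ∣ x j ↔ (p : ℤ) ∣ y j := fun j => Int.ModEq.dvd_iff (hxy j)
  simp only [C, h]

/-- Solutions on the cone are either primitive or `p` times a solution modulo `p ^ t`. -/
lemma coneDens_recursion {p : ℕ} (hp : p.Prime) (t : ℕ) :
    solDens F 0 1 0 (p ^ (t + 2))
      = primDens F p (t + 2) + ((p : ℝ) ^ 3)⁻¹ * solDens F 0 1 0 (p ^ t) := by
  have hsplit : ∀ x : Fin 3 → ℤ, ind (((p ^ (t + 2) : ℕ) : ℤ) ∣ F x)
      = ind (¬ ∀ i, (p : ℤ) ∣ x i) * ind (((p ^ (t + 2) : ℕ) : ℤ) ∣ F x)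
        + ind (∀ i, x i ≡ (0 : Fin 3 → ℤ) i [ZMOD p]) * ind (((p ^ (t + 2) : ℕ) : ℤ) ∣ F x) := by
    intro x
    have : (∀ i, x i ≡ (0 : Fin 3 → ℤ) i [ZMOD p]) ↔ ∀ i, (p : ℤ) ∣ x i := by
      refine forall_congr' fun i => ?_
      simp [Int.modEq_zero_iff_dvd]
    rw [ind_congr this]
    by_cases h : ∀ i, (p : ℤ) ∣ x i
    · rw [ind_of h, ind_of_not (not_not.2 h)]; ring
    · rw [ind_of_not h, ind_of h]; ring
  rw [solDens_zero, avg_congr hsplit, avg_add, solDens_zero]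
  congr 1
  have e : p ^ (t + 2) = p * p ^ (t + 1) := by ring
  have h := avg_ind_modEq_mul hp.pos (pow_pos hp.pos (t + 1)) (0 : Fin 3 → ℤ)
    (f := fun x => ind (((p ^ (t + 2) : ℕ) : ℤ) ∣ F x)) (by rw [← e]; exact per_ind_dvd' F _)
  rw [← e] at h
  rw [h]
  congr 1
  rw [← avg_eq_of_dvd (pow_pos hp.pos (t + 2)) (pow_dvd_pow p (by omega : t ≤ t + 2))
    (per_ind_dvd' F (p ^ t))]
  refine avg_congr fun y => ind_congr ?_
  have e2 : (fun i => (p : ℤ) * y i + (0 : Fin 3 → ℤ) i) = (p : ℤ) • y := by ext i; simp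
  rw [e2, QuadraticMap.map_smul, smul_eq_mul]
  push_cast
  rw [show (p : ℤ) ^ (t + 2) = (p : ℤ) * p * p ^ t by ring]
  have : (p : ℤ) * p ≠ 0 := by
    have : (p : ℤ) ≠ 0 := by exact_mod_cast hp.ne_zero
    positivity
  exact mul_dvd_mul_iff_left this

/-- The normalised densities of the cone converge geometrically: their differences satisfy
`s (t + 2) = s t / p` for large `t`. -/
lemma coneDens_diff_bound (hF : discr F ≠ 0) {p : ℕ} (hp : p.Prime) :
    ∃ C, ∀ t, |(p : ℝ) ^ (t + 1) * solDens F 0 1 0 (p ^ (t + 1))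
      - (p : ℝ) ^ t * solDens F 0 1 0 (p ^ t)| ≤ C * (√(p : ℝ))⁻¹ ^ t := by
  have hp0 : (0 : ℝ) < p := by exact_mod_cast hp.pos
  have hdet : (polarMatrix F).det ≠ 0 := by
    intro h0
    apply hF
    simp [discr, h0]
  obtain ⟨δ, d, hpd, hd⟩ := (Int.finiteMultiplicity_iff.2
    ⟨by simpa using hp.ne_one, hdet⟩ :
      FiniteMultiplicity (p : ℤ) (polarMatrix F).det).exists_eq_pow_mul_and_not_dvd
      |>.elim fun c hc => (⟨_, c, hc.2, hc.1⟩ :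
        ∃ v m', ¬ (p : ℤ) ∣ m' ∧ (polarMatrix F).det = (p : ℤ) ^ v * m')
  set u : ℕ → ℝ := fun t => (p : ℝ) ^ t * solDens F 0 1 0 (p ^ t) with hu
  set t₀ := δ + 1 + δ with ht₀
  have hrec : ∀ t, t₀ ≤ t → u (t + 3) - u (t + 2) = (u (t + 1) - u t) / p := by
    intro t ht
    have h1 := coneDens_recursion (F := F) hp t
    have h2 := coneDens_recursion (F := F) hp (t + 1)
    have h3 := primDens_succ (F := F) hp hd hpd (s := t + 2 - δ) (by omega)
    rw [show t + 2 - δ + δ = t + 2 by omega] at h3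
    simp only [hu]
    rw [show t + 3 = t + 1 + 2 by ring] at *
    rw [h1, h2, ← h3]
    field_simp
    ring
  set r : ℝ := (√(p : ℝ))⁻¹ with hr
  have hr0 : 0 < r := inv_pos.2 (Real.sqrt_pos.2 hp0)
  have hr2 : r ^ 2 = (p : ℝ)⁻¹ := by rw [hr, inv_pow, Real.sq_sqrt hp0.le]
  set C := ∑ t ∈ Finset.range (t₀ + 2), |u (t + 1) - u t| / r ^ t with hC
  refine ⟨C, fun t => ?_⟩
  change |u (t + 1) - u t| ≤ C * r ^ t
  induction t using Nat.strong_induction_on with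
  | _ t ih =>
    rcases lt_or_ge t (t₀ + 2) with h | h
    · rw [← div_le_iff₀ (pow_pos hr0 t)]
      exact Finset.single_le_sum (f := fun t => |u (t + 1) - u t| / r ^ t)
        (fun _ _ => by positivity) (Finset.mem_range.2 h)
    · obtain ⟨s, rfl⟩ := Nat.exists_eq_add_of_le' (show 2 ≤ t by omega)
      have := ih s (by omega)
      rw [show s + 2 + 1 = s + 3 by ring, hrec s (by omega), abs_div, abs_of_pos hp0,
        div_eq_mul_inv, ← hr2, pow_add, ← mul_assoc]
      gcongr

end

section

/-! ### Solutions modulo a prime of good reduction -/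

section FiniteField

variable {K : Type*} [Field K] [Fintype K] [DecidableEq K]

lemma sum_comp_sq (hK : ringChar K ≠ 2) (f : K → ℤ) :
    ∑ y, f (y ^ 2) = ∑ u, (1 + quadraticChar K u) * f u := by
  have h : ∀ y : K, f (y ^ 2) = ∑ u, if y ^ 2 = u then f u else 0 := fun y => by simp
  rw [Finset.sum_congr rfl fun y _ => h y, Finset.sum_comm]
  refine Finset.sum_congr rfl fun u _ => ?_
  rw [← Finset.sum_filter, Finset.sum_const, nsmul_eq_mul, add_comm (1 : ℤ),
    ← quadraticChar_card_sqrts hK u]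
  congr 3
  ext y
  simp

lemma quadraticChar_mul_self {a : K} (ha : a ≠ 0) : quadraticChar K a * quadraticChar K a = 1 := by
  rw [← sq, quadraticChar_sq_one ha]

/-- The character sum of a quadratic polynomial without linear term. -/
lemma sum_quadraticChar_quadratic (hK : ringChar K ≠ 2) {a : K} (ha : a ≠ 0) (b : K) :
    ∑ y, quadraticChar K (a * y ^ 2 + b)
      = quadraticChar K a * ((if b = 0 then (Fintype.card K : ℤ) else 0) - 1) := by
  rw [sum_comp_sq hK fun u => quadraticChar K (a * u + b)]
  simp only [add_mul, one_mul, Finset.sum_add_distrib]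
  have h1 : ∑ u, quadraticChar K (a * u + b) = 0 := by
    rw [← quadraticChar_sum_zero hK]
    exact Fintype.sum_equiv ((Equiv.mulLeft₀ a ha).trans (Equiv.addRight b)) _ _ fun u => by simp
  rw [h1, zero_add]
  split_ifs with hb
  · have h2 : ∀ u : K, quadraticChar K u * quadraticChar K (a * u + b)
        = quadraticChar K a * (1 - if u = 0 then 1 else 0) := by
      intro u
      split_ifs with hu
      · simp [hu]
      · rw [hb, add_zero, map_mul, mul_left_comm, quadraticChar_mul_self hu]
        ring
    rw [Finset.sum_congr rfl fun u _ => h2 u, ← Finset.mul_sum, Finset.sum_sub_distrib]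
    simp
  · -- substituting `u = -(b / a) v` gives a Jacobi sum
    have hba : -(b / a) ≠ 0 := neg_ne_zero.2 (div_ne_zero hb ha)
    have h2 : ∑ u, quadraticChar K u * quadraticChar K (a * u + b)
        = ∑ v, quadraticChar K (-a) * (quadraticChar K v * quadraticChar K (1 - v)) := by
      symm
      refine Fintype.sum_equiv (Equiv.mulLeft₀ _ hba) _ _ fun v => ?_
      have e : a * (-(b / a) * v) + b = b * (1 - v) := by field_simp; ring
      have e2 : quadraticChar K (-(b / a)) = quadraticChar K (-a) * quadraticChar K b := by
        rw [← map_mul]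
        have : -(b / a) = (-a * b) * (a⁻¹) ^ 2 := by field_simp
        rw [this, map_mul, map_pow, quadraticChar_sq_one (inv_ne_zero ha), mul_one]
      simp only [Equiv.mulLeft₀_apply]
      rw [e, map_mul, map_mul, e2]
      linear_combination (-quadraticChar K (-a) * quadraticChar K v * quadraticChar K (1 - v))
        * quadraticChar_mul_self hb
    have h3 := jacobiSum_nontrivial_inv (quadraticChar_ne_one hK)
    rw [(quadraticChar_isQuadratic K).inv] at h3
    rw [h2, ← Finset.mul_sum]
    have h4 : ∑ v, quadraticChar K v * quadraticChar K (1 - v) = -quadraticChar K (-1) := h3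
    have h5 : quadraticChar K (-a) = quadraticChar K (-1) * quadraticChar K a := by
      rw [← map_mul]; simp
    rw [h4, h5]
    linear_combination (-quadraticChar K a)
      * quadraticChar_mul_self (neg_ne_zero.2 (one_ne_zero (α := K)))

omit [Field K] [DecidableEq K] in
lemma sum_fin_three (f : (Fin 3 → K) → ℤ) : ∑ x, f x = ∑ a, ∑ b, ∑ c, f ![a, b, c] := by
  rw [← Fintype.sum_prod_type' fun a b => ∑ c, f ![a, b, c],
    ← Fintype.sum_prod_type' fun (a : K × K) c => f ![a.1, a.2, c]]
  refine Fintype.sum_equiv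
    ⟨fun x => ((x 0, x 1), x 2), fun y => ![y.1.1, y.1.2, y.2], fun x => ?_, fun y => ?_⟩ _ _
    fun x => ?_
  · ext i; fin_cases i <;> rfl
  · rfl
  · congr 1
    ext i; fin_cases i <;> rfl

/-- The number of points of a nondegenerate diagonal affine quadric in three variables. -/
lemma card_diagonal (hK : ringChar K ≠ 2) {u v w m : K} (hu : u ≠ 0) (hv : v ≠ 0) (hw : w ≠ 0) :
    ((Finset.univ.filter fun x : Fin 3 → K => u * x 0 ^ 2 + v * x 1 ^ 2 + w * x 2 ^ 2 = m).card : ℤ)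
      = (Fintype.card K : ℤ) ^ 2 + Fintype.card K * quadraticChar K (-(u * v * w * m)) := by
  rw [Finset.card_filter]
  push_cast
  rw [sum_fin_three]
  change (∑ a : K, ∑ b : K, ∑ c : K,
    if u * a ^ 2 + v * b ^ 2 + w * c ^ 2 = m then (1 : ℤ) else 0) = _
  have h0 : ∀ d : K, d ≠ 0 → ∀ e : K, (∑ c : K, if d * c ^ 2 = e then (1 : ℤ) else 0)
      = 1 + quadraticChar K (d * e) := by
    intro d hd e
    rw [sum_comp_sq hK fun t => if d * t = e then (1 : ℤ) else 0]
    have : ∀ t : K, ((1 + quadraticChar K t) * if d * t = e then (1 : ℤ) else 0)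
        = if t = e / d then (1 + quadraticChar K t) else 0 := by
      intro t
      have : d * t = e ↔ t = e / d := by rw [eq_div_iff hd, mul_comm]
      simp [this]
    rw [Finset.sum_congr rfl fun t _ => this t]
    simp only [Finset.sum_ite_eq', Finset.mem_univ, if_true]
    have : e / d = d * e * (d⁻¹) ^ 2 := by field_simp
    rw [this, map_mul, map_pow, quadraticChar_sq_one (inv_ne_zero hd), mul_one]
  have h1 : ∀ a b : K, (∑ c : K, if u * a ^ 2 + v * b ^ 2 + w * c ^ 2 = m then (1 : ℤ) else 0)
      = 1 + quadraticChar K (-(w * v) * b ^ 2 + w * (m - u * a ^ 2)) := by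
    intro a b
    have : ∀ c : K, u * a ^ 2 + v * b ^ 2 + w * c ^ 2 = m ↔ w * c ^ 2 = m - u * a ^ 2 - v * b ^ 2 :=
      fun c => ⟨fun h => by linear_combination h, fun h => by linear_combination h⟩
    simp only [this]
    rw [h0 w hw]
    congr 2
    ring
  have h2 : ∀ a : K, (w * (m - u * a ^ 2) = 0) ↔ u * a ^ 2 = m := by
    intro a
    rw [mul_eq_zero, or_iff_right hw, sub_eq_zero, eq_comm]
  simp only [h1, Finset.sum_add_distrib, sum_quadraticChar_quadratic hK
    (neg_ne_zero.2 (mul_ne_zero hw hv)), h2, ← Finset.mul_sum, Finset.sum_sub_distrib]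
  have h3 : (∑ a : K, if u * a ^ 2 = m then (Fintype.card K : ℤ) else 0)
      = Fintype.card K * (1 + quadraticChar K (u * m)) := by
    rw [← h0 u hu, Finset.mul_sum]
    simp
  rw [h3]
  have h4 : quadraticChar K (-(u * v * w * m))
      = quadraticChar K (-(w * v)) * quadraticChar K (u * m) := by
    rw [← map_mul]; congr 1; ring
  rw [h4]
  simp
  ring

omit [Fintype K] [DecidableEq K] in
lemma toQuadraticForm'_apply (B : Matrix (Fin 3) (Fin 3) K) (x : Fin 3 → K) :
    B.toQuadraticForm' x = ∑ i, ∑ j, B i j * x i * x j := by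
  change Matrix.toLinearMap₂' K B x x = _
  rw [Matrix.toLinearMap₂'_apply]
  refine Finset.sum_congr rfl fun i _ => Finset.sum_congr rfl fun j _ => ?_
  simp only [smul_eq_mul]
  ring

omit [Fintype K] [DecidableEq K] in
lemma associated_toQuadraticForm' [Invertible (2 : K)] {B : Matrix (Fin 3) (Fin 3) K}
    (hB : B.IsSymm) :
    QuadraticMap.associated (R := K) B.toQuadraticForm' = Matrix.toLinearMap₂' K B := by
  refine QuadraticMap.associated_left_inverse K fun x y => ?_
  rw [Matrix.toLinearMap₂'_apply', Matrix.toLinearMap₂'_apply', dotProduct_comm,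
    Matrix.dotProduct_mulVec, ← Matrix.mulVec_transpose, hB]

omit [Fintype K] [DecidableEq K] in
lemma discr'_toQuadraticForm' [Invertible (2 : K)] {B : Matrix (Fin 3) (Fin 3) K}
    (hB : B.IsSymm) : QuadraticForm.discr' B.toQuadraticForm' = B.det := by
  rw [QuadraticForm.discr', QuadraticForm.toMatrix', associated_toQuadraticForm' hB,
    LinearMap.toMatrix'_toLinearMap₂']

open QuadraticMap in
/-- The number of points of a nondegenerate affine quadric in three variables. -/
lemma card_quadric (hK : ringChar K ≠ 2) {B : Matrix (Fin 3) (Fin 3) K} (hB : B.IsSymm)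
    (hd : B.det ≠ 0) (m : K) :
    ((Finset.univ.filter fun x : Fin 3 → K => (∑ i, ∑ j, B i j * x i * x j) = m).card : ℤ)
      = (Fintype.card K : ℤ) ^ 2 + Fintype.card K * quadraticChar K (-(B.det * m)) := by
  have h2 : (2 : K) ≠ 0 := Ring.two_ne_zero hK
  let _ : Invertible (2 : K) := invertibleOfNonzero h2
  set Q : QuadraticForm K (Fin 3 → K) := B.toQuadraticForm' with hQ
  have hsep : (associated (R := K) Q).SeparatingLeft := by
    rw [associated_toQuadraticForm' hB]
    exact LinearMap.separatingLeft_toLinearMap₂'_iff_det_ne_zero.2 hd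
  obtain ⟨w, ⟨e⟩⟩ : ∃ w : Fin 3 → Kˣ, Equivalent Q (weightedSumSquares K w) := by
    have := QuadraticForm.equivalent_weightedSumSquares_units_of_nondegenerate' Q hsep
    rwa [Module.finrank_fin_fun] at this
  set W : QuadraticForm K (Fin 3 → K) := weightedSumSquares K w with hW
  have hWx : ∀ x, W x = w 0 * x 0 ^ 2 + w 1 * x 1 ^ 2 + w 2 * x 2 ^ 2 := by
    intro x
    rw [hW, weightedSumSquares_apply, Fin.sum_univ_three]
    simp [Units.smul_def, _root_.sq]
  have hQx : ∀ x, Q x = ∑ i, ∑ j, B i j * x i * x j := toQuadraticForm'_apply B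
  have hWd : QuadraticForm.discr' W = w 0 * w 1 * w 2 := by
    have e1 : W = (Matrix.diagonal fun i => (w i : K)).toQuadraticForm' := by
      ext x
      rw [hWx, toQuadraticForm'_apply]
      simp [Matrix.diagonal_apply, Fin.sum_univ_three]
      ring
    rw [e1, discr'_toQuadraticForm' (Matrix.isSymm_diagonal _), Matrix.det_diagonal,
      Fin.prod_univ_three]
  have hcomp : Q = W.comp e.toLinearEquiv.toLinearMap := by
    ext x
    exact (e.map_app x).symm
  have hdet : B.det
      = (LinearMap.toMatrix' e.toLinearEquiv.toLinearMap).det ^ 2 * (w 0 * w 1 * w 2) := by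
    rw [← hWd, ← discr'_toQuadraticForm' hB, ← hQ]
    refine (congrArg QuadraticForm.discr' hcomp).trans ?_
    rw [QuadraticForm.discr'_comp, ← _root_.sq]
  have hcard : (Finset.univ.filter fun x : Fin 3 → K => (∑ i, ∑ j, B i j * x i * x j) = m).card
      = (Finset.univ.filter fun x : Fin 3 → K =>
        (w 0 : K) * x 0 ^ 2 + w 1 * x 1 ^ 2 + w 2 * x 2 ^ 2 = m).card := by
    refine Finset.card_equiv e.toLinearEquiv.toEquiv fun x => ?_
    simp only [Finset.mem_filter, Finset.mem_univ, true_and, ← hWx, ← hQx]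
    rw [← e.map_app x]
    rfl
  rw [hcard, card_diagonal hK (w 0).ne_zero (w 1).ne_zero (w 2).ne_zero]
  congr 2
  rw [hdet]
  have h0 : (LinearMap.toMatrix' e.toLinearEquiv.toLinearMap).det ≠ 0 := by
    intro h; rw [hdet, h] at hd; simp at hd
  rw [show ∀ d a : K, -(d ^ 2 * a * m) = d ^ 2 * -(a * m) from fun d a => by ring, map_mul,
    quadraticChar_sq_one' h0, one_mul]

end FiniteField

lemma two_mul_form (F : QuadraticForm ℤ (Fin 3 → ℤ)) (x : Fin 3 → ℤ) :
    2 * F x = ∑ i, ∑ j, polarMatrix F i j * x i * x j := by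
  rw [← polar_eq_sum, QuadraticMap.polar_self]
  rfl

lemma polarMatrix_isSymm (F : QuadraticForm ℤ (Fin 3 → ℤ)) : (polarMatrix F).IsSymm := by
  ext i j
  exact QuadraticMap.polar_comm F _ _

variable {F : QuadraticForm ℤ (Fin 3 → ℤ)} {m : ℤ} {L : ℕ} {ν : Fin 3 → ℤ}

/-- At a prime of good reduction the count is that of the points of a smooth affine quadric over a
finite field. -/
lemma localCount_one_good {p : ℕ} (hp : p.Prime) (hm : ¬ (p : ℤ) ∣ 2 * m) (hL : ¬ p ∣ L)
    (hd : ¬ (p : ℤ) ∣ (polarMatrix F).det) :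
    localCount F m L ν p 1 = 1 + psi F m p / p := by
  have : Fact p.Prime := ⟨hp⟩
  have hp2 : p ≠ 2 := by
    rintro rfl
    exact hm (dvd_mul_right _ _)
  have hK : ringChar (ZMod p) ≠ 2 := by rwa [ZMod.ringChar_zmod_n]
  have hpR : (p : ℝ) ≠ 0 := by exact_mod_cast hp.ne_zero
  set B : Matrix (Fin 3) (Fin 3) (ZMod p) := (polarMatrix F).map (Int.castRingHom (ZMod p)) with hB
  have hBd : B.det = ((polarMatrix F).det : ZMod p) := by
    have := (Int.castRingHom (ZMod p)).map_det (polarMatrix F)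
    rw [hB]
    simpa using this.symm
  have hcard := card_quadric hK (B := B) ((polarMatrix_isSymm F).map _)
    (by rw [hBd, Ne, ZMod.intCast_zmod_eq_zero_iff_dvd]; exact hd) ((2 * m : ℤ) : ZMod p)
  have hchar : quadraticChar (ZMod p) (-(B.det * ((2 * m : ℤ) : ZMod p)))
      = jacobiSym (-(2 * m * (polarMatrix F).det)) p := by
    rw [← jacobiSym.legendreSym.to_jacobiSym, legendreSym, hBd]
    congr 1
    push_cast
    ring
  rw [hchar, ZMod.card] at hcard
  have hcast : ∀ x : Fin 3 → ℤ, (∑ i, ∑ j, B i j * (x i : ZMod p) * (x j : ZMod p))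
      = ((2 * F x : ℤ) : ZMod p) := by
    intro x
    rw [two_mul_form]
    push_cast
    rfl
  have hp2' : ¬ (p : ℤ) ∣ 2 := fun h => hm (h.mul_right m)
  have hiff : ∀ x : Fin 3 → ℤ, ((∑ i, ∑ j, B i j * (x i : ZMod p) * (x j : ZMod p))
      = ((2 * m : ℤ) : ZMod p)) ↔ F x ≡ m [ZMOD p] := by
    intro x
    rw [hcast, ZMod.intCast_eq_intCast_iff, Int.modEq_iff_dvd, Int.modEq_iff_dvd, ← mul_sub]
    constructor
    · intro h
      exact ((Nat.prime_iff_prime_int.1 hp).dvd_or_dvd h).resolve_left hp2'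
    · exact fun h => h.mul_left 2
  unfold localCount
  rw [padicValNat.eq_zero_of_not_dvd hL]
  simp only [pow_one, pow_zero, Int.modEq_one, implies_true, and_true, mul_one]
  have hc : ((residues p).filter fun x => F x ≡ m [ZMOD p]).card
      = (Finset.univ.filter fun x : Fin 3 → ZMod p =>
        (∑ i, ∑ j, B i j * x i * x j) = ((2 * m : ℤ) : ZMod p)).card := by
    refine Finset.card_nbij' (fun x i => (x i : ZMod p)) (fun y i => ((y i).val : ℤ)) ?_ ?_ ?_ ?_
    · intro x hx
      simp only [Finset.coe_filter, Set.mem_ofPred_eq, Finset.mem_univ, true_and] at hx ⊢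
      exact (hiff x).2 hx.2
    · intro y hy
      simp only [Finset.coe_filter, Set.mem_ofPred_eq, Finset.mem_univ, true_and] at hy ⊢
      refine ⟨mem_residues.2 fun i => ⟨by positivity, by exact_mod_cast ZMod.val_lt (y i)⟩, ?_⟩
      rw [← hiff]
      simpa using hy
    · intro x hx
      simp only [Finset.coe_filter, Set.mem_ofPred_eq] at hx
      ext i
      have := mem_residues.1 hx.1 i
      simp only [ZMod.val_intCast]
      exact Int.emod_eq_of_lt this.1 this.2
    · intro y _
      ext i
      simp
  have e5 : (((residues p).filter fun x => F x ≡ m [ZMOD p]).card : ℝ)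
      = (p : ℝ) ^ 2 + p * psi F m p := by
    rw [hc]
    unfold psi
    exact_mod_cast hcard
  rw [show (1 : ℝ) + psi F m p / p = ((p : ℝ) ^ 2 + p * psi F m p) / (p : ℝ) ^ 2 by field_simp,
    ← e5]

end

section

/-! ### The real character -/

lemma jacobiSym_of_modEq {a : ℤ} {n k : ℕ} (hn : Odd n) (hk : Odd k)
    (h : n ≡ k [MOD 4 * a.natAbs]) : jacobiSym a n = jacobiSym a k := by
  rw [jacobiSym.mod_right a hn, jacobiSym.mod_right a hk, h]

lemma coprime_of_modEq_one {n k : ℕ} (h : n ≡ 1 [MOD k]) : Nat.Coprime n k := by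
  rw [Nat.Coprime, h.gcd_eq, Nat.gcd_one_left]

lemma odd_of_modEq_one {n k : ℕ} (h : n ≡ 1 [MOD 4 * k]) : Odd n := by
  have : n ≡ 1 [MOD 2] := h.of_dvd (Dvd.intro_left (2 * k) (by ring))
  exact Nat.odd_iff.2 this

/-- An odd prime factor of `a` occurring to the first power makes the Jacobi symbol of `a`
nontrivial: by reciprocity, a suitable `n` is congruent to `1` modulo everything but that prime. -/
lemma exists_jacobiSym_eq_neg_one_of_prime {ε : ℤ} (hε : ε = 1 ∨ ε = -1) {q t b : ℕ}
    (hq : q.Prime) (hq2 : q ≠ 2) (hqt : ¬ q ∣ t) (hb : b ≠ 0) :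
    ∃ n : ℕ, Nat.Coprime n b ∧ jacobiSym (ε * (q * t : ℕ)) n = -1 := by
  have : Fact q.Prime := ⟨hq⟩
  obtain ⟨r, hr⟩ := quadraticChar_exists_neg_one (F := ZMod q) (by rwa [ZMod.ringChar_zmod_n])
  set b' := b / q ^ b.factorization q with hb'
  have hbb : q ^ b.factorization q * b' = b := Nat.ordProj_mul_ordCompl_eq_self b q
  have hqb : Nat.Coprime q b' := Nat.coprime_ordCompl hq hb
  have hcop : Nat.Coprime (4 * (t * b')) q := by
    refine Nat.Coprime.mul_left ?_ (Nat.Coprime.mul_left ?_ hqb.symm)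
    · exact Nat.Coprime.pow_left 2 ((Nat.coprime_primes Nat.prime_two hq).2 (Ne.symm hq2))
    · exact ((Nat.Prime.coprime_iff_not_dvd hq).2 hqt).symm
  obtain ⟨n, hn1, hn2⟩ := Nat.chineseRemainder hcop 1 r.val
  have hodd : Odd n := odd_of_modEq_one hn1
  have hJ : jacobiSym (n : ℤ) q = -1 := by
    rw [← jacobiSym.legendreSym.to_jacobiSym, legendreSym, ← hr]
    congr 1
    have := (ZMod.natCast_eq_natCast_iff _ _ _).2 hn2
    rw [ZMod.natCast_zmod_val] at this
    simpa using this
  refine ⟨n, ?_, ?_⟩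
  · rw [← hbb]
    refine Nat.Coprime.mul_right (Nat.Coprime.pow_right _ ?_) ?_
    · rw [Nat.coprime_comm, Nat.Prime.coprime_iff_not_dvd hq]
      intro hd
      have : jacobiSym (n : ℤ) q = 0 := by
        rw [jacobiSym.eq_zero_iff_not_coprime]
        rw [Int.gcd_natCast_natCast, Nat.gcd_eq_right hd]
        exact hq.one_lt.ne'
      omega
    · exact coprime_of_modEq_one (hn1.of_dvd ⟨4 * t, by ring⟩)
  · have h1 : jacobiSym (ε * (t : ℤ)) n = 1 := by
      rw [jacobiSym_of_modEq hodd odd_one, jacobiSym.one_right]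
      refine hn1.of_dvd ?_
      have : (ε * (t : ℤ)).natAbs = t := by
        rcases hε with rfl | rfl <;> simp
      rw [this]
      exact ⟨b', by ring⟩
    have h4 : n % 4 = 1 := hn1.of_dvd (dvd_mul_right _ _)
    rw [show ε * ((q * t : ℕ) : ℤ) = ε * t * q by push_cast; ring, jacobiSym.mul_left, h1, one_mul,
      jacobiSym.quadratic_reciprocity_one_mod_four' (hq.odd_of_ne_two hq2) h4, hJ]

lemma exists_jacobiSym_eq_neg_one_of_eight {c : ℤ} {b k : ℕ} (hb : b ≠ 0) (hc : c.natAbs ∣ 2)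
    (hk : Odd k) (hck : jacobiSym c k = -1) :
    ∃ n : ℕ, Nat.Coprime n b ∧ jacobiSym c n = -1 := by
  set b' := b / 2 ^ b.factorization 2 with hb'
  have hbb : 2 ^ b.factorization 2 * b' = b := Nat.ordProj_mul_ordCompl_eq_self b 2
  have hqb : Nat.Coprime 2 b' := Nat.coprime_ordCompl Nat.prime_two hb
  obtain ⟨n, hn1, hn2⟩ := Nat.chineseRemainder (Nat.Coprime.pow_left 3 hqb) k 1
  have hodd : Odd n := by
    have : n ≡ k [MOD 2] := hn1.of_dvd (by norm_num)
    exact Nat.odd_iff.2 (Eq.trans this (Nat.odd_iff.1 hk))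
  refine ⟨n, ?_, ?_⟩
  · rw [← hbb]
    exact Nat.Coprime.mul_right (Nat.Coprime.pow_right _ hodd.coprime_two_right)
      (coprime_of_modEq_one hn2)
  · rw [jacobiSym_of_modEq hodd hk, hck]
    exact hn1.of_dvd (Nat.mul_dvd_mul_left 4 hc)

/-- The Jacobi symbol of a nonsquare takes the value `-1`. -/
lemma exists_jacobiSym_eq_neg_one {a : ℤ} (ha : ¬ IsSquare a) :
    ∃ n : ℕ, jacobiSym a n = -1 := by
  have ha0 : a ≠ 0 := fun h => ha (by rw [h]; exact IsSquare.zero)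
  obtain ⟨s, b, hbs, hs⟩ := Nat.sq_mul_squarefree a.natAbs
  have hb : b ≠ 0 := by
    rintro rfl
    exact ha0 (Int.natAbs_eq_zero.1 (by rw [← hbs]; simp))
  obtain ⟨ε, hε, haε⟩ : ∃ ε : ℤ, (ε = 1 ∨ ε = -1) ∧ a = ε * s * (b : ℤ) ^ 2 := by
    have h1 : ((a.natAbs : ℕ) : ℤ) = (b : ℤ) ^ 2 * s := by rw [← hbs]; push_cast; ring
    rcases Int.natAbs_eq a with h | h
    · exact ⟨1, Or.inl rfl, by rw [h, h1]; ring⟩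
    · exact ⟨-1, Or.inr rfl, by rw [h, h1]; ring⟩
  suffices h : ∃ n : ℕ, Nat.Coprime n b ∧ jacobiSym (ε * (s : ℕ)) n = -1 by
    obtain ⟨n, h1, h2⟩ := h
    refine ⟨n, ?_⟩
    rw [haε, jacobiSym.mul_left, h2, jacobiSym.sq_one', mul_one]
    rw [Int.gcd_natCast_natCast]
    exact h1.symm
  by_cases hq : ∃ q : ℕ, q.Prime ∧ q ∣ s ∧ q ≠ 2
  · obtain ⟨q, hq, ⟨t, rfl⟩, hq2⟩ := hq
    refine exists_jacobiSym_eq_neg_one_of_prime hε hq hq2 ?_ hb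
    intro h
    have := hs q (Nat.mul_dvd_mul_left q h)
    exact hq.one_lt.ne' (Nat.isUnit_iff.1 this)
  · push Not at hq
    have hs2 : s = 1 ∨ s = 2 := by
      have hk := Nat.eq_prime_pow_of_unique_prime_dvd (p := 2) hs.ne_zero
        (fun {d} hd hds => hq d hd hds)
      have hdvd : s ∣ 2 := (hs.dvd_pow_iff_dvd (Nat.succ_ne_zero s.primeFactorsList.length)).1
        (hk.dvd.trans (pow_dvd_pow 2 (Nat.le_succ _)))
      exact (Nat.dvd_prime Nat.prime_two).1 hdvd
    have hc : (ε * (s : ℤ)).natAbs ∣ 2 := by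
      rcases hε with rfl | rfl <;> rcases hs2 with rfl | rfl <;> norm_num
    rcases hε with rfl | rfl <;> rcases hs2 with rfl | rfl
    · exact absurd ⟨(b : ℤ), by rw [haε]; push_cast; ring⟩ ha
    · exact exists_jacobiSym_eq_neg_one_of_eight hb hc (k := 3) (by decide) (by norm_num)
    · exact exists_jacobiSym_eq_neg_one_of_eight hb hc (k := 3) (by decide) (by norm_num)
    · exact exists_jacobiSym_eq_neg_one_of_eight hb hc (k := 5) (by decide) (by norm_num)

/-- The character `ψ` of the statement, principal (and identically one) in the square case, as a
completely multiplicative function on the natural numbers vanishing at zero. -/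
def chi (F : QuadraticForm ℤ (Fin 3 → ℤ)) (m₀ : ℤ) (n : ℕ) : ℝ :=
  open Classical in
  if n = 0 then 0 else if IsSquare (-(m₀ : ℚ) * discr F) then 1 else psi F m₀ n

variable {F : QuadraticForm ℤ (Fin 3 → ℤ)} {m₀ : ℤ}

lemma chi_zero : chi F m₀ 0 = 0 := if_pos rfl

lemma chi_one : chi F m₀ 1 = 1 := by
  unfold chi psi
  split_ifs <;> simp_all

lemma chi_mul (a b : ℕ) : chi F m₀ (a * b) = chi F m₀ a * chi F m₀ b := by
  rcases eq_or_ne a 0 with rfl | ha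
  · simp [chi_zero]
  rcases eq_or_ne b 0 with rfl | hb
  · simp [chi_zero]
  unfold chi psi
  rw [if_neg ha, if_neg hb, if_neg (mul_ne_zero ha hb)]
  split_ifs
  · simp
  · rw [jacobiSym.mul_right' _ ha hb]
    push_cast
    ring

lemma abs_psi_le (n : ℕ) : |psi F m₀ n| ≤ 1 := by
  unfold psi
  rcases jacobiSym.trichotomy (-(2 * m₀ * (polarMatrix F).det)) n with h | h | h <;> simp [h]

lemma abs_chi_le (n : ℕ) : |chi F m₀ n| ≤ 1 := by
  unfold chi
  split_ifs
  · simp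
  · simp
  · exact abs_psi_le n

lemma convFactor_eq {p : ℕ} (hp : p.Prime) : convFactor F m₀ p = 1 - chi F m₀ p / p := by
  unfold convFactor chi
  rw [if_neg hp.ne_zero]
  split_ifs <;> rfl

lemma neg_mul_discr (F : QuadraticForm ℤ (Fin 3 → ℤ)) (m₀ : ℤ) :
    ((-(2 * m₀ * (polarMatrix F).det) : ℤ) : ℚ) = 4 ^ 2 * (-(m₀ : ℚ) * discr F) := by
  unfold discr
  push_cast
  ring

lemma isSquare_iff : IsSquare (-(m₀ : ℚ) * discr F) ↔
    IsSquare (-(2 * m₀ * (polarMatrix F).det)) := by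
  rw [← Rat.isSquare_intCast_iff, neg_mul_discr]
  constructor
  · rintro ⟨r, hr⟩
    exact ⟨4 * r, by rw [hr]; ring⟩
  · rintro ⟨r, hr⟩
    refine ⟨r / 4, ?_⟩
    have : -(m₀ : ℚ) * discr F = (4 ^ 2 * (-(m₀ : ℚ) * discr F)) / 16 := by ring
    rw [this, hr]
    ring

lemma chi_good {p : ℕ} (hp : p.Prime) (hm : ¬ (p : ℤ) ∣ 2 * m₀)
    (hd : ¬ (p : ℤ) ∣ (polarMatrix F).det) : chi F m₀ p = psi F m₀ p := by
  unfold chi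
  rw [if_neg hp.ne_zero]
  split_ifs with hs
  · obtain ⟨r, hr⟩ := isSquare_iff.1 hs
    unfold psi
    rw [hr, ← sq, jacobiSym.sq_one']
    · simp
    · rw [Int.gcd_comm, ← Int.isCoprime_iff_gcd_eq_one,
        (Nat.prime_iff_prime_int.1 hp).coprime_iff_not_dvd]
      intro h
      have h2 : (p : ℤ) ∣ -(2 * m₀ * (polarMatrix F).det) := hr ▸ h.mul_right r
      rw [dvd_neg] at h2
      exact ((Nat.prime_iff_prime_int.1 hp).dvd_or_dvd h2).elim hm hd
  · rfl

lemma psi_even {n : ℕ} (hn : Even n) (hn0 : n ≠ 0) : psi F m₀ n = 0 := by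
  unfold psi
  rw [jacobiSym.eq_zero_iff.2 ⟨hn0, fun h => ?_⟩]
  · simp
  · have h1 : (2 : ℤ) ∣ -(2 * m₀ * (polarMatrix F).det) := ⟨-(m₀ * (polarMatrix F).det), by ring⟩
    have h2 : (2 : ℤ) ∣ (n : ℤ) := by exact_mod_cast hn.two_dvd
    have := Int.dvd_gcd h1 h2
    rw [h] at this
    norm_num at this

/-- The character `ψ₀` is periodic. -/
lemma chi_periodic (hs : ¬ IsSquare (-(m₀ : ℚ) * discr F)) (n k : ℕ)
    (h : n ≡ k [MOD 4 * (-(2 * m₀ * (polarMatrix F).det)).natAbs]) : chi F m₀ n = chi F m₀ k := by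
  have h2 : n % 2 = k % 2 := h.of_dvd (Dvd.dvd.mul_right (by norm_num) _)
  have hev : ∀ n : ℕ, Even n → chi F m₀ n = 0 := by
    intro n hn
    unfold chi
    split_ifs with h0
    · rfl
    · exact psi_even hn h0
  rcases Nat.even_or_odd n with hn | hn
  · rw [hev n hn, hev k (Nat.even_iff.2 (by rw [← h2, Nat.even_iff.1 hn]))]
  · have hk : Odd k := Nat.odd_iff.2 (by rw [← h2, Nat.odd_iff.1 hn])
    unfold chi psi
    rw [if_neg hs, if_neg hs, if_neg hn.pos.ne', if_neg hk.pos.ne', jacobiSym_of_modEq hn hk h]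

/-- The partial sums of `ψ₀` are bounded, since its sum over a period vanishes. -/
lemma exists_abs_sum_chi_le (hF : discr F ≠ 0) (hm : m₀ ≠ 0)
    (hs : ¬ IsSquare (-(m₀ : ℚ) * discr F)) :
    ∃ B : ℝ, ∀ n, |∑ k ∈ Finset.range n, chi F m₀ k| ≤ B := by
  set a : ℤ := -(2 * m₀ * (polarMatrix F).det) with ha
  set M := 4 * a.natAbs with hM
  have hdet : (polarMatrix F).det ≠ 0 := by
    intro h
    exact hF (by simp [discr, h])
  have hM0 : M ≠ 0 := by simp [hM, ha, hm, hdet]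
  have : NeZero M := ⟨hM0⟩
  have hper := chi_periodic hs
  obtain ⟨u, hu⟩ := exists_jacobiSym_eq_neg_one (mt isSquare_iff.2 hs)
  have hu0 : u ≠ 0 := by
    rintro rfl
    simp at hu
  have hchiu : chi F m₀ u = -1 := by
    unfold chi psi
    rw [if_neg hu0, if_neg hs, hu]
    norm_num
  have hodd : Odd u := by
    by_contra h
    rw [Nat.not_odd_iff_even] at h
    have := psi_even (F := F) (m₀ := m₀) h hu0
    unfold psi at this
    rw [hu] at this
    norm_num at this
  have huM : Nat.Coprime u M := by
    refine Nat.Coprime.mul_right (Nat.Coprime.pow_right 2 hodd.coprime_two_right) ?_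
    have : NeZero u := ⟨hu0⟩
    by_contra h
    have : jacobiSym a u = 0 := jacobiSym.eq_zero_iff_not_coprime.2 (by
      rw [Int.gcd_comm]; exact h)
    rw [ha, hu] at this
    norm_num at this
  have hzero : ∑ k ∈ Finset.range M, chi F m₀ k = 0 := by
    have h1 : ∑ k ∈ Finset.range M, chi F m₀ k = ∑ x : ZMod M, chi F m₀ x.val := by
      refine Finset.sum_nbij' (fun k => (k : ZMod M)) (fun x => x.val) ?_ ?_ ?_ ?_ ?_
      · simp
      · intro x _; exact Finset.mem_range.2 (ZMod.val_lt x)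
      · intro k hk; exact ZMod.val_cast_of_lt (Finset.mem_range.1 hk)
      · intro x _; simp
      · intro k hk; rw [ZMod.val_cast_of_lt (Finset.mem_range.1 hk)]
    have h2 : ∑ x : ZMod M, chi F m₀ x.val = ∑ x : ZMod M, chi F m₀ u * chi F m₀ x.val := by
      symm
      refine Fintype.sum_equiv (Units.mulLeft (ZMod.unitOfCoprime u huM)) _ _ fun x => ?_
      rw [← chi_mul]
      refine hper _ _ ?_
      rw [Units.mulLeft_apply, ZMod.coe_unitOfCoprime, ZMod.val_mul, ZMod.val_natCast]
      rw [← ha, ← hM]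
      simp [Nat.ModEq, Nat.mul_mod]
    rw [← Finset.mul_sum, hchiu] at h2
    rw [h1]
    linarith
  have hmul : ∀ k, ∑ i ∈ Finset.range (M * k), chi F m₀ i = 0 := by
    intro k
    induction k with
    | zero => simp
    | succ k ih =>
      rw [Nat.mul_succ, Finset.sum_range_add, ih, zero_add, ← hzero]
      exact Finset.sum_congr rfl fun i _ => hper _ _ (by rw [← ha, ← hM]; simp [Nat.ModEq])
  refine ⟨M, fun n => ?_⟩
  rw [← Nat.div_add_mod n M, Finset.sum_range_add, hmul, zero_add]
  refine (Finset.abs_sum_le_sum_abs _ _).trans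
    ((Finset.sum_le_card_nsmul _ _ 1 fun i _ => abs_chi_le _).trans ?_)
  rw [Finset.card_range, nsmul_eq_mul, mul_one]
  exact_mod_cast (Nat.mod_lt n (Nat.pos_of_ne_zero hM0)).le

/-- A form of partial summation. -/
lemma abs_sum_mul_le {χ g : ℕ → ℝ} {B : ℝ} (hB : ∀ n, |∑ k ∈ Finset.range n, χ k| ≤ B)
    {X Y : ℕ} (h : X ≤ Y) :
    |∑ n ∈ Finset.Ico X Y, χ n * g n|
      ≤ B * (|g X| + |g Y| + ∑ n ∈ Finset.Ico X Y, |g (n + 1) - g n|) := by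
  set A : ℕ → ℝ := fun n => ∑ k ∈ Finset.range n, χ k with hA
  have key : ∑ n ∈ Finset.Ico X Y, χ n * g n
      = A Y * g Y - A X * g X - ∑ n ∈ Finset.Ico X Y, A (n + 1) * (g (n + 1) - g n) := by
    induction Y, h using Nat.le_induction with
    | base => simp
    | succ Y hXY ih =>
      rw [Finset.sum_Ico_succ_top hXY, Finset.sum_Ico_succ_top hXY, ih]
      have : A (Y + 1) = A Y + χ Y := Finset.sum_range_succ _ _
      rw [this]
      ring
  have h1 : |A Y * g Y| ≤ B * |g Y| := by
    rw [abs_mul]; exact mul_le_mul_of_nonneg_right (hB Y) (abs_nonneg _)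
  have h2 : |A X * g X| ≤ B * |g X| := by
    rw [abs_mul]; exact mul_le_mul_of_nonneg_right (hB X) (abs_nonneg _)
  have h3 : |∑ n ∈ Finset.Ico X Y, A (n + 1) * (g (n + 1) - g n)|
      ≤ B * ∑ n ∈ Finset.Ico X Y, |g (n + 1) - g n| := by
    refine (Finset.abs_sum_le_sum_abs _ _).trans ?_
    rw [Finset.mul_sum]
    refine Finset.sum_le_sum fun n _ => ?_
    rw [abs_mul]; exact mul_le_mul_of_nonneg_right (hB (n + 1)) (abs_nonneg _)
  rw [key]
  have h4 := abs_sub (A Y * g Y - A X * g X) (∑ n ∈ Finset.Ico X Y, A (n + 1) * (g (n + 1) - g n))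
  have h5 := abs_sub (A Y * g Y) (A X * g X)
  linarith

/-- Convergence of `∑ χ(n) / n` for a function with bounded partial sums. -/
lemma exists_tendsto_sum_div {χ : ℕ → ℝ} {B : ℝ} (hB : ∀ n, |∑ k ∈ Finset.range n, χ k| ≤ B) :
    ∃ l : ℝ, Tendsto (fun X => ∑ n ∈ Finset.range X, χ n / n) atTop (𝓝 l) ∧
      ∀ X : ℕ, 0 < X → |∑ n ∈ Finset.range X, χ n / n - l| ≤ 2 * B / X := by
  have hd : ∀ X Y : ℕ, 0 < X → X ≤ Y →
      |∑ n ∈ Finset.range Y, χ n / n - ∑ n ∈ Finset.range X, χ n / n| ≤ 2 * B / X := by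
    intro X Y hX hXY
    rw [← Finset.sum_Ico_eq_sub _ hXY]
    have h := abs_sum_mul_le (g := fun n => (1 : ℝ) / n) hB hXY
    have hs : ∑ n ∈ Finset.Ico X Y, |(1 : ℝ) / ((n + 1 : ℕ) : ℝ) - 1 / n| = 1 / X - 1 / Y := by
      induction Y, hXY using Nat.le_induction with
      | base => simp
      | succ Y hXY ih =>
        rw [Finset.sum_Ico_succ_top hXY, ih (abs_sum_mul_le hB hXY), abs_of_nonpos]
        · ring
        · have : (0 : ℝ) < Y := by exact_mod_cast hX.trans_le hXY
          rw [sub_nonpos]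
          exact one_div_le_one_div_of_le this (by push_cast; linarith)
    rw [hs, abs_of_nonneg (a := (1 : ℝ) / X) (by positivity),
      abs_of_nonneg (a := (1 : ℝ) / Y) (by positivity)] at h
    simp only [mul_one_div] at h
    exact h.trans (le_of_eq (by ring))
  have hB0 : 0 ≤ B := (abs_nonneg _).trans (hB 0)
  obtain ⟨l, hl⟩ : ∃ l : ℝ, Tendsto (fun X => ∑ n ∈ Finset.range X, χ n / n) atTop (𝓝 l) := by
    refine cauchySeq_tendsto_of_complete ?_
    have hlim : Tendsto (fun X : ℕ => 2 * (2 * B / ((X + 1 : ℕ) : ℝ))) atTop (𝓝 0) := by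
      have := (tendsto_const_div_atTop_nhds_zero_nat (2 * (2 * B))).comp (tendsto_add_atTop_nat 1)
      refine this.congr fun X => ?_
      simp only [Function.comp_apply]
      ring
    refine Metric.cauchySeq_iff'.2 fun ε hε => ?_
    obtain ⟨X, hX⟩ := (hlim.eventually_lt_const hε).exists
    refine ⟨X + 1, fun n hn => ?_⟩
    rw [Real.dist_eq]
    refine (hd (X + 1) n (by omega) hn).trans_lt (lt_of_le_of_lt ?_ hX)
    have : 0 ≤ 2 * B / ((X + 1 : ℕ) : ℝ) := by positivity
    linarith
  refine ⟨l, hl, fun X hX => ?_⟩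
  rw [abs_sub_comm]
  refine le_of_tendsto ((hl.sub_const _).abs) ?_
  filter_upwards [eventually_ge_atTop X] with Y hY
  exact hd X Y hX hY

lemma lPartial_eq (hs : ¬ IsSquare (-(m₀ : ℚ) * discr F)) (X : ℕ) :
    lPartial F m₀ X = ∑ n ∈ Finset.range (X + 1), chi F m₀ n / n := by
  unfold lPartial
  rw [Finset.sum_range_succ', chi_zero, zero_div, add_zero, Finset.range_eq_Ico,
    Finset.sum_Ico_add' (fun n : ℕ => chi F m₀ n / (n : ℝ)) 0 X 1]
  refine Finset.sum_congr (by ext; simp) fun n hn => ?_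
  unfold chi
  rw [if_neg hs, if_neg (by have := (Finset.mem_Ico.1 hn).1; omega)]

/-- Convergence of `L(1, ψ₀)`. -/
lemma lOne_spec (hF : discr F ≠ 0) (hm : m₀ ≠ 0) (hs : ¬ IsSquare (-(m₀ : ℚ) * discr F)) :
    Tendsto (fun X => lPartial F m₀ X) atTop (𝓝 (lOne F m₀)) ∧
      ∃ B : ℝ, (∀ n, |∑ k ∈ Finset.range n, chi F m₀ k| ≤ B) ∧
        ∀ X : ℕ, 0 < X → |∑ n ∈ Finset.range X, chi F m₀ n / n - lOne F m₀| ≤ 2 * B / X := by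
  obtain ⟨B, hB⟩ := exists_abs_sum_chi_le hF hm hs
  obtain ⟨l, hl, hl'⟩ := exists_tendsto_sum_div hB
  have h1 : Tendsto (fun X => lPartial F m₀ X) atTop (𝓝 l) :=
    (hl.comp (tendsto_add_atTop_nat 1)).congr fun X => (lPartial_eq hs X).symm
  have h2 : lOne F m₀ = l := h1.limUnder_eq
  rw [h2]
  exact ⟨h1, B, hB, hl'⟩

end

section

/-! ### Weighted harmonic sums -/

/-- The sum `∑ χ(n) / n J(n y)`. -/
def harmSum (χ : ℕ → ℝ) (J : ℝ → ℝ) (y : ℝ) : ℝ := ∑' n : ℕ, χ n / n * J (n * y)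

/-- The properties of the weight `J` that are used: it is Lipschitz, tends to `σ` at zero, and
vanishes beyond `c`. -/
structure Weight (J : ℝ → ℝ) (σ c Λ : ℝ) : Prop where
  one_le : 1 ≤ c
  nonneg : 0 ≤ Λ
  eq_zero : ∀ x, c ≤ x → J x = 0
  near_zero : ∀ x, 0 < x → |J x - σ| ≤ Λ * x
  lipschitz : ∀ x y, 0 < x → x ≤ y → |J x - J y| ≤ Λ * (y - x)

variable {χ : ℕ → ℝ} {J : ℝ → ℝ} {σ c Λ : ℝ}

lemma Weight.abs_le (hJ : Weight J σ c Λ) {x : ℝ} (hx : 0 < x) : |J x| ≤ |σ| + Λ * c := by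
  have := hJ.one_le
  have := hJ.nonneg
  rcases le_or_gt c x with h | h
  · rw [hJ.eq_zero x h, abs_zero]
    positivity
  · have h1 := hJ.near_zero x hx
    have h2 : Λ * x ≤ Λ * c := by gcongr
    have h3 := abs_sub_abs_le_abs_sub (J x) σ
    linarith

lemma Weight.const_nonneg (hJ : Weight J σ c Λ) : 0 ≤ |σ| + Λ * c :=
  (abs_nonneg _).trans (hJ.abs_le one_pos)

lemma harmSum_eq (hJ : Weight J σ c Λ) {y : ℝ} (hy : 0 < y) {Y : ℕ} (hY : c ≤ Y * y) :
    harmSum χ J y = ∑ n ∈ Finset.range Y, χ n / n * J (n * y) := by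
  refine tsum_eq_sum fun n hn => ?_
  have hn' : (Y : ℝ) ≤ n := by
    simpa using hn
  rw [hJ.eq_zero _ (hY.trans (by gcongr)), mul_zero]

lemma Weight.abs_sum_head_sub_le (hJ : Weight J σ c Λ) (hχ : ∀ n, |χ n| ≤ 1) {y : ℝ} (hy : 0 < y)
    (X : ℕ) :
    |∑ n ∈ Finset.range X, χ n / n * J (n * y) - σ * ∑ n ∈ Finset.range X, χ n / n|
      ≤ Λ * (X * y) := by
  rw [Finset.mul_sum, ← Finset.sum_sub_distrib]
  refine (Finset.abs_sum_le_sum_abs _ _).trans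
    ((Finset.sum_le_card_nsmul _ _ (Λ * y) fun n _ => ?_).trans (le_of_eq ?_))
  · have := hJ.nonneg
    rcases Nat.eq_zero_or_pos n with rfl | hn
    · simp; positivity
    · have hn' : (0 : ℝ) < n := by exact_mod_cast hn
      rw [mul_comm σ, ← mul_sub, abs_mul, abs_div, abs_of_pos hn']
      calc |χ n| / n * |J (n * y) - σ| ≤ 1 / n * (Λ * (n * y)) := by
            gcongr
            · exact hχ n
            · exact hJ.near_zero _ (by positivity)
        _ = Λ * y := by field_simp
  · rw [Finset.card_range, nsmul_eq_mul]
    ring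

/-- The variation of `u ↦ J (u y) / u` on an interval between consecutive integers. -/
lemma Weight.abs_div_sub_div_le (hJ : Weight J σ c Λ) {y : ℝ} (hy : 0 < y) {X n : ℕ} (hX : 0 < X)
    (hn : X ≤ n) {u : ℝ} (h1 : (n : ℝ) ≤ u) (h2 : u ≤ n + 1) :
    |J (u * y) / u - J (n * y) / n|
      ≤ Λ * y / X + (|σ| + Λ * c) * (1 / n - 1 / ((n + 1 : ℕ) : ℝ)) := by
  have hX' : (0 : ℝ) < X := by exact_mod_cast hX
  have hn' : (X : ℝ) ≤ n := by exact_mod_cast hn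
  have hn0 : (0 : ℝ) < n := hX'.trans_le hn'
  have hu : 0 < u := hn0.trans_le h1
  have := hJ.nonneg
  have e : J (u * y) / u - J (n * y) / n
      = (J (u * y) - J (n * y)) / u - J (n * y) * (1 / n - 1 / u) := by
    field_simp
    ring
  rw [e]
  refine (abs_sub _ _).trans (add_le_add ?_ ?_)
  · rw [abs_div, abs_of_pos hu, abs_sub_comm]
    have h3 : |J (n * y) - J (u * y)| ≤ Λ * y := by
      refine (hJ.lipschitz _ _ (by positivity) (by gcongr)).trans ?_
      rw [← sub_mul]
      refine mul_le_mul_of_nonneg_left ?_ hJ.nonneg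
      nlinarith
    exact div_le_div₀ (by positivity) h3 hX' (hn'.trans h1)
  · rw [abs_mul, abs_of_nonneg (sub_nonneg.2 (one_div_le_one_div_of_le hn0 h1))]
    refine mul_le_mul (hJ.abs_le (by positivity)) ?_
      (sub_nonneg.2 (one_div_le_one_div_of_le hn0 h1)) hJ.const_nonneg
    refine sub_le_sub_left (one_div_le_one_div_of_le hu ?_) _
    push_cast
    exact h2

lemma sum_one_div_sub (X Y : ℕ) (h : X ≤ Y) :
    ∑ n ∈ Finset.Ico X Y, ((1 : ℝ) / n - 1 / ((n + 1 : ℕ) : ℝ)) = 1 / X - 1 / Y := by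
  induction Y, h using Nat.le_induction with
  | base => simp
  | succ Y hXY ih =>
    rw [Finset.sum_Ico_succ_top hXY, ih]
    ring

/-- The point where a sum over `n` with `n y ≪ 1` is split, with both error terms of size `√y`. -/
lemma exists_split (c : ℝ) (hc : 1 ≤ c) {y : ℝ} (hy : 0 < y) (hy1 : y ≤ 1) :
    ∃ X Y : ℕ, 0 < X ∧ X ≤ Y ∧ (1 : ℝ) / X ≤ √y ∧ X * y ≤ 2 * √y ∧ c ≤ Y * y ∧
      ((Y : ℝ) - X) * y ≤ c + 1 := by
  have hs : 0 < √y := Real.sqrt_pos.2 hy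
  have hss : √y * √y = y := Real.mul_self_sqrt hy.le
  have hs1 : √y ≤ 1 := Real.sqrt_le_one.2 hy1
  set X := ⌈1 / √y⌉₊ with hX
  have hX1 : 1 / √y ≤ X := Nat.le_ceil _
  have hX2 : (X : ℝ) < 1 / √y + 1 := Nat.ceil_lt_add_one (by positivity)
  have hX0 : (0 : ℝ) < X := lt_of_lt_of_le (by positivity) hX1
  have hY1 : c / y ≤ ⌈c / y⌉₊ := Nat.le_ceil _
  have hY2 : (⌈c / y⌉₊ : ℝ) < c / y + 1 := Nat.ceil_lt_add_one (by positivity)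
  refine ⟨X, X + ⌈c / y⌉₊, by exact_mod_cast hX0, Nat.le_add_right _ _, ?_, ?_, ?_, ?_⟩
  · rw [div_le_iff₀ hX0]
    rw [div_le_iff₀ hs] at hX1
    linarith
  · have : X * y ≤ (1 / √y + 1) * y := by gcongr
    have e : (1 / √y + 1) * y = √y + y := by
      rw [add_mul, one_mul]
      congr 1
      rw [div_mul_eq_mul_div, one_mul, div_eq_iff hs.ne', hss]
    nlinarith
  · rw [← div_le_iff₀ hy]
    push_cast
    linarith
  · push_cast
    have : (⌈c / y⌉₊ : ℝ) * y ≤ (c / y + 1) * y := by gcongr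
    have e : (c / y + 1) * y = c + y := by field_simp
    nlinarith

lemma Weight.sum_error_le (hJ : Weight J σ c Λ) {y : ℝ} {X Y : ℕ} (hX : 0 < X)
    (hXY : X ≤ Y) (h1 : (1 : ℝ) / X ≤ √y) (h2 : ((Y : ℝ) - X) * y ≤ c + 1) :
    ∑ n ∈ Finset.Ico X Y, (Λ * y / X + (|σ| + Λ * c) * (1 / n - 1 / ((n + 1 : ℕ) : ℝ)))
      ≤ (Λ * (c + 1) + (|σ| + Λ * c)) * √y := by
  have hX' : (0 : ℝ) < X := by exact_mod_cast hX
  rw [Finset.sum_add_distrib, ← Finset.mul_sum, sum_one_div_sub X Y hXY, Finset.sum_const,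
    Nat.card_Ico, nsmul_eq_mul, Nat.cast_sub hXY, add_mul _ _ (√y)]
  have h3 := hJ.nonneg
  have h4 := hJ.const_nonneg
  have h5 := hJ.one_le
  refine add_le_add ?_ (mul_le_mul_of_nonneg_left ?_ h4)
  · calc ((Y : ℝ) - X) * (Λ * y / X) = Λ * (((Y : ℝ) - X) * y) * (1 / X) := by ring
      _ ≤ Λ * (c + 1) * √y := by gcongr
  · have : (0 : ℝ) ≤ 1 / Y := by positivity
    linarith

/-- The asymptotic behaviour of the weighted harmonic sum of a nonprincipal character. -/
lemma harmSum_nonprincipal (hJ : Weight J σ c Λ) (hχ : ∀ n, |χ n| ≤ 1) {l B : ℝ}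
    (hB : ∀ n, |∑ k ∈ Finset.range n, χ k| ≤ B)
    (hl : ∀ X : ℕ, 0 < X → |∑ n ∈ Finset.range X, χ n / n - l| ≤ 2 * B / X) :
    ∃ C : ℝ, ∀ y, 0 < y → y ≤ 1 → |harmSum χ J y - σ * l| ≤ C * √y := by
  set K := |σ| + Λ * c with hK
  have hB0 : 0 ≤ B := (abs_nonneg _).trans (hB 0)
  refine ⟨Λ * 2 + |σ| * (2 * B) + B * (K + (Λ * (c + 1) + K)), fun y hy hy1 => ?_⟩
  obtain ⟨X, Y, hX, hXY, h1, h2, h3, h4⟩ := exists_split c hJ.one_le hy hy1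
  have hX' : (0 : ℝ) < X := by exact_mod_cast hX
  have hY' : (0 : ℝ) < Y := by exact_mod_cast hX.trans_le hXY
  have hΛ := hJ.nonneg
  rw [harmSum_eq hJ hy h3, ← Finset.sum_range_add_sum_Ico _ hXY]
  have e1 := hJ.abs_sum_head_sub_le hχ hy X
  have e2 : |σ * ∑ n ∈ Finset.range X, χ n / n - σ * l| ≤ |σ| * (2 * B) * √y := by
    rw [← mul_sub, abs_mul, mul_assoc]
    refine mul_le_mul_of_nonneg_left ((hl X hX).trans ?_) (abs_nonneg _)
    rw [← mul_one_div]
    gcongr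
  have e3 : |∑ n ∈ Finset.Ico X Y, χ n / n * J (n * y)|
      ≤ B * (K + (Λ * (c + 1) + K)) * √y := by
    have h := abs_sum_mul_le (g := fun n : ℕ => J (n * y) / n) hB hXY
    have hg : ∀ n : ℕ, χ n / n * J (n * y) = χ n * (J (n * y) / n) := fun n => by ring
    rw [Finset.sum_congr rfl fun n _ => hg n]
    refine h.trans ?_
    rw [mul_assoc]
    refine mul_le_mul_of_nonneg_left ?_ hB0
    rw [hJ.eq_zero _ h3, zero_div, abs_zero, add_zero, add_mul]
    refine add_le_add ?_ ?_
    · rw [abs_div, abs_of_pos hX', ← mul_one_div]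
      exact mul_le_mul (hJ.abs_le (by positivity)) h1 (by positivity) hJ.const_nonneg
    · refine le_trans (Finset.sum_le_sum fun n hn => ?_) (hJ.sum_error_le hX hXY h1 h4)
      have hn' := Finset.mem_Ico.1 hn
      have := hJ.abs_div_sub_div_le hy hX hn'.1 (u := ((n + 1 : ℕ) : ℝ)) (by push_cast; linarith)
        (by push_cast; linarith)
      simpa using this
  have e4 : Λ * (X * y) ≤ Λ * 2 * √y := by
    rw [mul_assoc]; gcongr
  rw [abs_le] at *
  constructor <;> nlinarith

lemma Weight.continuousOn (hJ : Weight J σ c Λ) : ContinuousOn J (Set.Ioi 0) := by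
  have h : LipschitzOnWith ⟨Λ, hJ.nonneg⟩ J (Set.Ioi 0) := by
    refine LipschitzOnWith.of_dist_le_mul fun x hx y hy => ?_
    rw [Real.dist_eq, Real.dist_eq]
    change _ ≤ Λ * _
    rcases le_total x y with h | h
    · rw [abs_sub_comm x y, abs_of_nonneg (sub_nonneg.2 h)]
      exact hJ.lipschitz x y hx h
    · rw [abs_sub_comm (J x), abs_of_nonneg (sub_nonneg.2 h)]
      exact hJ.lipschitz y x hy h
  exact h.continuousOn

lemma Weight.intervalIntegrable_div (hJ : Weight J σ c Λ) {a b : ℝ} (ha : 0 < a) (hb : 0 < b) :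
    IntervalIntegrable (fun v => J v / v) volume a b := by
  refine ContinuousOn.intervalIntegrable ?_
  have h : Set.uIcc a b ⊆ Set.Ioi 0 := fun v hv => (lt_min ha hb).trans_le hv.1
  exact (hJ.continuousOn.mono h).div continuousOn_id fun v hv => (h hv).ne'

lemma Weight.norm_sub_div_le (hJ : Weight J σ c Λ) {v : ℝ} (hv : 0 < v) :
    ‖(J v - σ) / v‖ ≤ Λ := by
  rw [norm_div, Real.norm_eq_abs, Real.norm_eq_abs, abs_of_pos hv, div_le_iff₀ hv]
  exact hJ.near_zero v hv

lemma Weight.intervalIntegrable_sub_div (hJ : Weight J σ c Λ) {b : ℝ} (hb : 0 < b) :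
    IntervalIntegrable (fun v => (J v - σ) / v) volume 0 b := by
  rw [intervalIntegrable_iff_integrableOn_Ioc_of_le hb.le]
  have hcont : ContinuousOn (fun v => (J v - σ) / v) (Set.Ioc 0 b) :=
    ((hJ.continuousOn.mono fun v hv => hv.1).sub continuousOn_const).div continuousOn_id
      fun v hv => hv.1.ne'
  refine IntegrableOn.of_bound measure_Ioc_lt_top
    (hcont.aestronglyMeasurable measurableSet_Ioc) Λ ?_
  refine (ae_restrict_iff' measurableSet_Ioc).2 (Eventually.of_forall fun v hv => ?_)
  exact hJ.norm_sub_div_le hv.1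

/-- The integral of `J(v) / v` from a small `t` on. -/
lemma Weight.abs_integral_sub_le (hJ : Weight J σ c Λ) {t T : ℝ} (ht : 0 < t) (hT : c ≤ T) :
    |(∫ v in t..T, J v / v)
      - ((∫ v in (0 : ℝ)..1, (J v - σ) / v) + (∫ v in (1 : ℝ)..c, J v / v) - σ * Real.log t)|
      ≤ Λ * t := by
  have hc : 0 < c := one_pos.trans_le hJ.one_le
  have hT0 : 0 < T := hc.trans_le hT
  have e1 : (∫ v in t..T, J v / v)
      = (∫ v in t..1, J v / v) + (∫ v in (1 : ℝ)..c, J v / v) + ∫ v in c..T, J v / v := by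
    rw [intervalIntegral.integral_add_adjacent_intervals
      (hJ.intervalIntegrable_div ht one_pos) (hJ.intervalIntegrable_div one_pos hc),
      intervalIntegral.integral_add_adjacent_intervals
      (hJ.intervalIntegrable_div ht hc) (hJ.intervalIntegrable_div hc hT0)]
  have e2 : ∫ v in c..T, J v / v = 0 := by
    rw [intervalIntegral.integral_congr (g := fun _ => 0), intervalIntegral.integral_zero]
    intro v hv
    rw [Set.uIcc_of_le hT] at hv
    change J v / v = 0
    rw [hJ.eq_zero v hv.1, zero_div]
  have e3 : ∫ v in t..1, J v / v = (∫ v in t..1, (J v - σ) / v) + ∫ v in t..1, σ * (1 / v) := by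
    rw [← intervalIntegral.integral_add]
    · refine intervalIntegral.integral_congr fun v _ => ?_
      change J v / v = (J v - σ) / v + σ * (1 / v)
      ring
    · exact (hJ.intervalIntegrable_sub_div ht).symm.trans (hJ.intervalIntegrable_sub_div one_pos)
    · refine ContinuousOn.intervalIntegrable ?_
      have h : Set.uIcc t 1 ⊆ Set.Ioi 0 := fun v hv => (lt_min ht one_pos).trans_le hv.1
      exact continuousOn_const.mul (continuousOn_const.div continuousOn_id fun v hv => (h hv).ne')
  have e4 : ∫ v in t..1, σ * (1 / v) = - (σ * Real.log t) := by
    rw [intervalIntegral.integral_const_mul, integral_one_div_of_pos ht one_pos,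
      Real.log_div one_ne_zero ht.ne', Real.log_one]
    ring
  have e5 : (∫ v in (0 : ℝ)..1, (J v - σ) / v)
      = (∫ v in (0 : ℝ)..t, (J v - σ) / v) + ∫ v in t..1, (J v - σ) / v := by
    rw [intervalIntegral.integral_add_adjacent_intervals (hJ.intervalIntegrable_sub_div ht)
      ((hJ.intervalIntegrable_sub_div ht).symm.trans (hJ.intervalIntegrable_sub_div one_pos))]
  have e6 : |∫ v in (0 : ℝ)..t, (J v - σ) / v| ≤ Λ * t := by
    have := intervalIntegral.norm_integral_le_of_norm_le_const (a := 0) (b := t) (C := Λ)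
      (f := fun v => (J v - σ) / v) fun v hv => by
        rw [Set.uIoc_of_le ht.le] at hv
        exact hJ.norm_sub_div_le hv.1
    rwa [sub_zero, abs_of_pos ht, Real.norm_eq_abs] at this
  rw [e1, e2, e3, e4, e5]
  refine le_trans (le_of_eq ?_) e6
  rw [← abs_neg]
  congr 1
  ring

lemma abs_sum_range_one_div_sub_le {X : ℕ} (hX : 0 < X) :
    |∑ n ∈ Finset.range X, (1 : ℝ) / n - (Real.log X + Real.eulerMascheroniConstant)| ≤ 1 / X := by
  obtain ⟨k, rfl⟩ := Nat.exists_eq_succ_of_ne_zero hX.ne'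
  have e : ∑ n ∈ Finset.range (k + 1), (1 : ℝ) / n = (harmonic k : ℝ) := by
    rw [Finset.sum_range_succ', harmonic]
    simp
  have h1 := Real.eulerMascheroniSeq_lt_eulerMascheroniConstant k
  have h2 := Real.eulerMascheroniConstant_lt_eulerMascheroniSeq' (k + 1)
  unfold Real.eulerMascheroniSeq at h1
  unfold Real.eulerMascheroniSeq' at h2
  rw [if_neg (Nat.succ_ne_zero k), harmonic_succ] at h2
  push_cast at h1 h2
  rw [Nat.succ_eq_add_one, e, one_div, abs_le]
  push_cast
  constructor <;> linarith

/-- The asymptotic behaviour of the weighted harmonic sum of the principal character. -/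
lemma harmSum_principal (hJ : Weight J σ c Λ) (hχ : ∀ n, n ≠ 0 → χ n = 1) :
    ∃ c₁ C : ℝ, ∀ y, 0 < y → y ≤ 1 → |harmSum χ J y - (c₁ - σ * Real.log y)| ≤ C * √y := by
  set K := |σ| + Λ * c with hK
  set I := (∫ v in (0 : ℝ)..1, (J v - σ) / v) + (∫ v in (1 : ℝ)..c, J v / v) with hI
  refine ⟨σ * Real.eulerMascheroniConstant + I, Λ * 2 + |σ| + (Λ * (c + 1) + K) + Λ * 2,
    fun y hy hy1 => ?_⟩
  obtain ⟨X, Y, hX, hXY, h1, h2, h3, h4⟩ := exists_split c hJ.one_le hy hy1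
  have hX' : (0 : ℝ) < X := by exact_mod_cast hX
  have hΛ := hJ.nonneg
  have hs0 : harmSum χ J y = harmSum (fun n => if n = 0 then 0 else 1) J y := by
    refine tsum_congr fun n => ?_
    rcases eq_or_ne n 0 with rfl | hn
    · simp
    · simp only [hχ n hn, if_neg hn]
  have hone : ∀ n : ℕ, (if n = 0 then (0 : ℝ) else 1) / n = 1 / n := by
    intro n
    split_ifs with h
    · simp [h]
    · rfl
  rw [hs0, harmSum_eq hJ hy h3, ← Finset.sum_range_add_sum_Ico _ hXY]
  have e1 := hJ.abs_sum_head_sub_le (χ := fun n => if n = 0 then 0 else 1)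
    (fun n => by split_ifs <;> simp) hy X
  simp only [hone] at e1 ⊢
  have e2 : |σ * ∑ n ∈ Finset.range X, (1 : ℝ) / n
      - σ * (Real.log X + Real.eulerMascheroniConstant)| ≤ |σ| * √y := by
    rw [← mul_sub, abs_mul]
    exact mul_le_mul_of_nonneg_left ((abs_sum_range_one_div_sub_le hX).trans h1) (abs_nonneg _)
  -- the tail is compared with an integral
  have hcv : ∫ u in (X : ℝ)..Y, J (u * y) / u = ∫ v in (X * y)..(Y * y), J v / v := by
    have := intervalIntegral.integral_comp_mul_right
      (a := (X : ℝ)) (b := Y) (fun v => J v / v) hy.ne'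
    have e : ∀ u : ℝ, J (u * y) / u = y * (J (u * y) / (u * y)) := fun u => by
      rcases eq_or_ne u 0 with rfl | hu
      · simp
      · field_simp
    rw [intervalIntegral.integral_congr fun u _ => e u, intervalIntegral.integral_const_mul, this,
      smul_eq_mul, ← mul_assoc, mul_inv_cancel₀ hy.ne', one_mul]
  have hint : ∀ a b : ℕ, 0 < a → 0 < b →
      IntervalIntegrable (fun u => J (u * y) / u) volume (a : ℝ) b := by
    intro a b ha hb
    have ha' : (0 : ℝ) < a := by exact_mod_cast ha
    have hb' : (0 : ℝ) < b := by exact_mod_cast hb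
    refine ContinuousOn.intervalIntegrable ?_
    have h : Set.uIcc (a : ℝ) b ⊆ Set.Ioi 0 := fun v hv => (lt_min ha' hb').trans_le hv.1
    refine ContinuousOn.div (hJ.continuousOn.comp (continuousOn_id.mul continuousOn_const) ?_)
      continuousOn_id fun v hv => (h hv).ne'
    exact fun v hv => mul_pos (h hv) hy
  have e3 : |∑ n ∈ Finset.Ico X Y, (1 : ℝ) / n * J (n * y) - ∫ v in (X * y)..(Y * y), J v / v|
      ≤ (Λ * (c + 1) + K) * √y := by
    rw [← hcv, ← intervalIntegral.sum_integral_adjacent_intervals_Ico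
      (a := fun n : ℕ => (n : ℝ)) hXY
      fun k hk => hint k (k + 1) (hX.trans_le hk.1) (Nat.succ_pos k), ← Finset.sum_sub_distrib]
    refine (Finset.abs_sum_le_sum_abs _ _).trans
      (le_trans (Finset.sum_le_sum fun n hn => ?_) (hJ.sum_error_le hX hXY h1 h4))
    have hn' := Finset.mem_Ico.1 hn
    have hn0 : 0 < n := hX.trans_le hn'.1
    have e : (1 : ℝ) / n * J (n * y) = ∫ u in (n : ℝ)..((n + 1 : ℕ) : ℝ), J (n * y) / n := by
      rw [intervalIntegral.integral_const]
      push_cast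
      simp
      ring
    rw [e, ← intervalIntegral.integral_sub intervalIntegrable_const (hint n (n + 1) hn0 (by omega))]
    have := intervalIntegral.norm_integral_le_of_norm_le_const
      (a := (n : ℝ)) (b := ((n + 1 : ℕ) : ℝ))
      (C := Λ * y / X + (|σ| + Λ * c) * (1 / n - 1 / ((n + 1 : ℕ) : ℝ)))
      (f := fun u => J (n * y) / n - J (u * y) / u) fun u hu => by
        rw [Set.uIoc_of_le (by push_cast; linarith)] at hu
        rw [Real.norm_eq_abs, abs_sub_comm]
        refine hJ.abs_div_sub_div_le hy hX hn'.1 hu.1.le ?_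
        have := hu.2
        push_cast at this
        exact this
    refine this.trans (le_of_eq ?_)
    push_cast
    simp
  have e4 := hJ.abs_integral_sub_le (t := X * y) (T := Y * y) (by positivity) h3
  rw [Real.log_mul hX'.ne' hy.ne'] at e4
  have e5 : Λ * (X * y) ≤ Λ * 2 * √y := by
    rw [mul_assoc]; gcongr
  rw [← hI] at e4
  rw [abs_le] at *
  constructor <;> nlinarith

/-- From an expansion near zero with error `√y` to one on the whole half line. -/
lemma harmSum_global (hJ : Weight J σ c Λ) (hχ : ∀ n, |χ n| ≤ 1) {c₁ s C₀ : ℝ}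
    (h : ∀ y, 0 < y → y ≤ 1 → |harmSum χ J y - (c₁ - s * Real.log y)| ≤ C₀ * √y)
    {a : ℝ} (ha : 0 < a) (ha2 : a ≤ 1 / 2) :
    ∃ C : ℝ, 0 ≤ C ∧ ∀ y, 0 < y → |harmSum χ J y - (c₁ - s * Real.log y)| ≤ C * y ^ a := by
  set K := |σ| + Λ * c with hK
  have hK0 : 0 ≤ K := hJ.const_nonneg
  refine ⟨|C₀| + (⌈c⌉₊ * K + |c₁| + |s| / a), by positivity, fun y hy => ?_⟩
  rcases le_total y 1 with hy1 | hy1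
  · refine (h y hy hy1).trans ?_
    have h1 : √y ≤ y ^ a := by
      rw [Real.sqrt_eq_rpow]
      exact Real.rpow_le_rpow_of_exponent_ge hy hy1 ha2
    calc C₀ * √y ≤ |C₀| * y ^ a := mul_le_mul (le_abs_self _) h1 (by positivity) (by positivity)
      _ ≤ _ := by gcongr; exact le_add_of_nonneg_right (by positivity)
  · have h1 : 1 ≤ y ^ a := Real.one_le_rpow hy1 ha.le
    have h2 : |harmSum χ J y| ≤ ⌈c⌉₊ * K := by
      have hc : c ≤ ⌈c⌉₊ := Nat.le_ceil c
      have : 0 < c := one_pos.trans_le hJ.one_le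
      rw [harmSum_eq hJ hy (Y := ⌈c⌉₊) (by nlinarith)]
      refine (Finset.abs_sum_le_sum_abs _ _).trans
        ((Finset.sum_le_card_nsmul _ _ K fun n _ => ?_).trans (le_of_eq ?_))
      · rcases Nat.eq_zero_or_pos n with rfl | hn
        · simpa using hK0
        · have hn' : (1 : ℝ) ≤ n := by exact_mod_cast hn
          rw [abs_mul, abs_div, abs_of_nonneg (by linarith : (0 : ℝ) ≤ n)]
          calc |χ n| / n * |J (n * y)| ≤ 1 * K := by
                refine mul_le_mul ?_ (hJ.abs_le (by positivity)) (abs_nonneg _) zero_le_one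
                rw [div_le_one (by linarith)]
                exact (hχ n).trans hn'
            _ = K := one_mul K
      · rw [Finset.card_range, nsmul_eq_mul]
    have h3 : |Real.log y| ≤ y ^ a / a := by
      rw [abs_of_nonneg (Real.log_nonneg hy1)]
      exact Real.log_le_rpow_div hy.le ha
    have h4 : |harmSum χ J y - (c₁ - s * Real.log y)|
        ≤ |harmSum χ J y| + (|c₁| + |s| * |Real.log y|) := by
      refine (abs_sub _ _).trans (add_le_add le_rfl ((abs_sub _ _).trans ?_))
      rw [abs_mul]
    have h5 : |s| * |Real.log y| ≤ |s| / a * y ^ a := by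
      calc |s| * |Real.log y| ≤ |s| * (y ^ a / a) := by gcongr
        _ = _ := by ring
    have h6 : ⌈c⌉₊ * K ≤ ⌈c⌉₊ * K * y ^ a := le_mul_of_one_le_right (by positivity) h1
    have h7 : |c₁| ≤ |c₁| * y ^ a := le_mul_of_one_le_right (by positivity) h1
    have h8 : 0 ≤ |C₀| * y ^ a := by positivity
    linarith [add_mul (|C₀|) (⌈c⌉₊ * K + |c₁| + |s| / a) (y ^ a),
      add_mul (⌈c⌉₊ * K + |c₁|) (|s| / a) (y ^ a), add_mul (⌈c⌉₊ * K) (|c₁|) (y ^ a)]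

end

section

/-! ### Dirichlet convolution and Euler products -/

open ArithmeticFunction in
/-- The Möbius transform `μ * r`. -/
def moebiusPart (r : ArithmeticFunction ℝ) : ArithmeticFunction ℝ :=
  ((moebius : ArithmeticFunction ℤ) : ArithmeticFunction ℝ) * r

open ArithmeticFunction in
/-- The Dirichlet quotient of `μ * r` by the completely multiplicative function `x`. -/
def quotPart (r x : ArithmeticFunction ℝ) : ArithmeticFunction ℝ :=
  moebiusPart r * ((moebius : ArithmeticFunction ℤ) : ArithmeticFunction ℝ).pmul x

/-- A multiplicative function `r` that at almost all primes takes the value `1 + x(p)` on all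
positive powers of `p`, with `x` completely multiplicative and `|x(n)| ≤ 1 / n`, and that at the
other primes converges along powers of `p` at the speed `p ^ (-e / 2)`. -/
structure LocalFactors (r x : ArithmeticFunction ℝ) (S : Finset ℕ) : Prop where
  mult : r.IsMultiplicative
  one : x 1 = 1
  mul : ∀ a b, x (a * b) = x a * x b
  abs_le : ∀ n, |x n| ≤ 1 / n
  good : ∀ p, p.Prime → p ∉ S → ∀ e, r (p ^ (e + 1)) = 1 + x p
  bound : ∀ p, p.Prime → ∃ C : ℝ, ∀ e : ℕ, |r (p ^ (e + 1)) - r (p ^ e)| ≤ C * (√(p : ℝ))⁻¹ ^ e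

variable {r x : ArithmeticFunction ℝ} {S : Finset ℕ}

lemma sum_moebiusPart (n : ℕ) : ∑ d ∈ n.divisors, moebiusPart r d = r n := by
  rw [← ArithmeticFunction.coe_zeta_mul_apply, moebiusPart, ← mul_assoc,
    ArithmeticFunction.coe_zeta_mul_coe_moebius, one_mul]

lemma moebiusPart_pow_succ {p : ℕ} (hp : p.Prime) (e : ℕ) :
    moebiusPart r (p ^ (e + 1)) = r (p ^ (e + 1)) - r (p ^ e) := by
  rw [← sum_moebiusPart (r := r) (p ^ (e + 1)), ← sum_moebiusPart (r := r) (p ^ e),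
    Nat.sum_divisors_prime_pow hp, Nat.sum_divisors_prime_pow hp, Finset.sum_range_succ _ (e + 1)]
  ring

namespace LocalFactors

variable (h : LocalFactors r x S)
include h

lemma quotPart_mul : quotPart r x * x = moebiusPart r := by
  have : ((ArithmeticFunction.moebius : ArithmeticFunction ℤ) : ArithmeticFunction ℝ).pmul x * x
      = 1 := by
    have e : ((ArithmeticFunction.moebius : ArithmeticFunction ℤ) : ArithmeticFunction ℝ).pmul x * x
        = (((ArithmeticFunction.moebius : ArithmeticFunction ℤ) : ArithmeticFunction ℝ)
          * (ArithmeticFunction.zeta : ArithmeticFunction ℝ)).pmul x := by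
      ext n
      rw [ArithmeticFunction.pmul_apply, ArithmeticFunction.mul_apply, ArithmeticFunction.mul_apply,
        Finset.sum_mul]
      refine Finset.sum_congr rfl fun z hz => ?_
      have hz' := Nat.mem_divisorsAntidiagonal.1 hz
      have h2 : z.2 ≠ 0 := by
        rintro h0
        rw [h0, mul_zero] at hz'
        exact hz'.2 hz'.1.symm
      rw [← hz'.1, h.mul, ArithmeticFunction.pmul_apply, ArithmeticFunction.natCoe_apply,
        ArithmeticFunction.zeta_apply_ne h2]
      push_cast
      ring
    rw [e, ArithmeticFunction.coe_moebius_mul_coe_zeta]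
    ext n
    rw [ArithmeticFunction.pmul_apply, ArithmeticFunction.one_apply]
    split_ifs with hn
    · rw [hn, h.one, one_mul]
    · rw [zero_mul]
  rw [quotPart, mul_assoc, this, mul_one]

lemma quotPart_isMultiplicative : (quotPart r x).IsMultiplicative :=
  (ArithmeticFunction.isMultiplicative_moebius.intCast.mul h.mult).mul
    (ArithmeticFunction.isMultiplicative_moebius.intCast.pmul ⟨h.one, fun _ => h.mul _ _⟩)

lemma moebiusPart_one : moebiusPart r 1 = 1 :=
  (ArithmeticFunction.isMultiplicative_moebius.intCast.mul h.mult).1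

lemma apply_pow (p e : ℕ) : x (p ^ e) = x p ^ e := by
  induction e with
  | zero => simpa using h.one
  | succ e ih => rw [pow_succ, h.mul, ih, pow_succ]

lemma quotPart_pow_succ {p : ℕ} (hp : p.Prime) (e : ℕ) :
    quotPart r x (p ^ (e + 1)) = moebiusPart r (p ^ (e + 1)) - x p * moebiusPart r (p ^ e) := by
  have key : ∀ e : ℕ, moebiusPart r (p ^ e)
      = ∑ i ∈ Finset.range (e + 1), quotPart r x (p ^ i) * x p ^ (e - i) := by
    intro e
    rw [← h.quotPart_mul, ArithmeticFunction.mul_apply,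
      Nat.sum_divisorsAntidiagonal fun a b => quotPart r x a * x b, Nat.sum_divisors_prime_pow hp]
    refine Finset.sum_congr rfl fun i hi => ?_
    rw [Nat.pow_div (Nat.lt_succ_iff.1 (Finset.mem_range.1 hi)) hp.pos, h.apply_pow]
  rw [key, key e, Finset.sum_range_succ, Finset.mul_sum]
  have : ∀ i ∈ Finset.range (e + 1), quotPart r x (p ^ i) * x p ^ (e + 1 - i)
      = x p * (quotPart r x (p ^ i) * x p ^ (e - i)) := by
    intro i hi
    rw [Nat.succ_sub (Nat.lt_succ_iff.1 (Finset.mem_range.1 hi)), pow_succ]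
    ring
  rw [Finset.sum_congr rfl this]
  simp

lemma quotPart_good {p : ℕ} (hp : p.Prime) (hS : p ∉ S) :
    quotPart r x (p ^ 1) = 0 ∧ quotPart r x (p ^ 2) = -(x p) ^ 2 ∧
      ∀ e, quotPart r x (p ^ (e + 3)) = 0 := by
  have h1 : moebiusPart r (p ^ 1) = x p := by
    rw [moebiusPart_pow_succ hp 0, h.good p hp hS 0, pow_zero, h.mult.1]
    ring
  have h2 : ∀ e, moebiusPart r (p ^ (e + 2)) = 0 := by
    intro e
    rw [moebiusPart_pow_succ hp (e + 1), h.good p hp hS, h.good p hp hS, sub_self]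
  refine ⟨?_, ?_, fun e => ?_⟩
  · rw [h.quotPart_pow_succ hp 0, h1, pow_zero, h.moebiusPart_one]
    ring
  · rw [h.quotPart_pow_succ hp 1, h2 0, h1]
    ring
  · rw [h.quotPart_pow_succ hp (e + 2), h2 (e + 1), h2 e]
    ring

lemma abs_apply_le_one (n : ℕ) : |x n| ≤ 1 := by
  refine (h.abs_le n).trans ?_
  rcases Nat.eq_zero_or_pos n with rfl | hn
  · simp
  · rw [div_le_one (by exact_mod_cast hn)]
    exact_mod_cast hn

/-- The bound `p ^ (-e / 2)` passes from the increments of `r` to the quotient, because on powers of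
`p` the quotient is a difference of two consecutive increments, the second one weighted by `x p`. -/
lemma exists_quotPart_pow_le {p : ℕ} (hp : p.Prime) :
    ∃ K : ℝ, ∀ e, |quotPart r x (p ^ e)| ≤ K * (√(p : ℝ))⁻¹ ^ e := by
  obtain ⟨C, hC⟩ := h.bound p hp
  set ρ : ℝ := (√(p : ℝ))⁻¹ with hρ
  have hρ0 : 0 < ρ := inv_pos.2 (Real.sqrt_pos.2 (by exact_mod_cast hp.pos))
  have hC0 : 0 ≤ C := by
    have := (abs_nonneg _).trans (hC 0)
    simpa using this
  have hs : ∀ e, |moebiusPart r (p ^ e)| ≤ (1 + C / ρ) * ρ ^ e := by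
    intro e
    cases e with
    | zero =>
      rw [pow_zero, h.moebiusPart_one, pow_zero, mul_one, abs_one]
      exact le_add_of_nonneg_right (by positivity)
    | succ e =>
      rw [moebiusPart_pow_succ hp]
      refine (hC e).trans ?_
      have : (1 + C / ρ) * ρ ^ (e + 1) = ρ ^ (e + 1) + C * ρ ^ e := by
        field_simp
        ring
      rw [this]
      exact le_add_of_nonneg_left (by positivity)
  refine ⟨(1 + C / ρ) * (1 + 1 / ρ), fun e => ?_⟩
  cases e with
  | zero =>
    rw [pow_zero, h.quotPart_isMultiplicative.1, pow_zero, mul_one, abs_one]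
    have h1 : 0 ≤ C / ρ := by positivity
    have h2 : 0 ≤ 1 / ρ := by positivity
    nlinarith
  | succ e =>
    rw [h.quotPart_pow_succ hp]
    refine (abs_sub _ _).trans ?_
    rw [abs_mul]
    have h1 := hs (e + 1)
    have h2 : |x p| * |moebiusPart r (p ^ e)| ≤ 1 * ((1 + C / ρ) * ρ ^ e) :=
      mul_le_mul (h.abs_apply_le_one p) (hs e) (abs_nonneg _) zero_le_one
    have h3 : (1 + C / ρ) * (1 + 1 / ρ) * ρ ^ (e + 1)
        = (1 + C / ρ) * ρ ^ (e + 1) + 1 * ((1 + C / ρ) * ρ ^ e) := by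
      field_simp
      ring
    rw [h3]
    exact add_le_add h1 h2

lemma summable_pow {p : ℕ} (hp : p.Prime) {a : ℝ} (ha : a < 1 / 2) :
    Summable fun e : ℕ => |quotPart r x (p ^ e)| * ((p ^ e : ℕ) : ℝ) ^ a := by
  obtain ⟨K, hK⟩ := h.exists_quotPart_pow_le hp
  have hp0 : (0 : ℝ) < p := by exact_mod_cast hp.pos
  have hp1 : (1 : ℝ) < p := by exact_mod_cast hp.one_lt
  have hq : (√(p : ℝ))⁻¹ * (p : ℝ) ^ a < 1 := by
    rw [Real.sqrt_eq_rpow, ← Real.rpow_neg hp0.le, ← Real.rpow_add hp0]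
    exact Real.rpow_lt_one_of_one_lt_of_neg hp1 (by linarith)
  refine Summable.of_nonneg_of_le (fun e => by positivity) (fun e => ?_)
    ((summable_geometric_of_lt_one (by positivity) hq).mul_left K)
  calc |quotPart r x (p ^ e)| * ((p ^ e : ℕ) : ℝ) ^ a
      ≤ K * (√(p : ℝ))⁻¹ ^ e * ((p ^ e : ℕ) : ℝ) ^ a := by gcongr; exact hK e
    _ = K * ((√(p : ℝ))⁻¹ * (p : ℝ) ^ a) ^ e := by
      push_cast
      rw [← Real.rpow_natCast_mul hp0.le, mul_comm (e : ℝ), Real.rpow_mul_natCast hp0.le, mul_pow]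
      ring

/-- The quotient of `μ * r` by `x` converges absolutely beyond the line `-1/2`. -/
lemma summable_quotPart {a : ℝ} (ha : a < 1 / 2) :
    Summable fun n : ℕ => |quotPart r x n| * (n : ℝ) ^ a := by
  set W : ℕ → ℝ := fun n => |quotPart r x n| * (n : ℝ) ^ a with hW
  have hWnn : ∀ n, 0 ≤ W n := fun n => by positivity
  have hW1 : W 1 = 1 := by simp [hW, h.quotPart_isMultiplicative.1]
  have hWmul : ∀ {m n : ℕ}, m.Coprime n → W (m * n) = W m * W n := by
    intro m n hmn
    simp only [hW]
    rw [h.quotPart_isMultiplicative.2 hmn, abs_mul]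
    push_cast
    rw [Real.mul_rpow (by positivity) (by positivity)]
    ring
  have hWp : ∀ {p : ℕ}, p.Prime → Summable fun e => ‖W (p ^ e)‖ := by
    intro p hp
    simpa only [Real.norm_eq_abs, abs_of_nonneg (hWnn _)] using h.summable_pow hp ha
  set T : ℕ → ℝ := fun p => ∑' e, W (p ^ (e + 1)) with hT
  have hTnn : ∀ p, 0 ≤ T p := fun p => tsum_nonneg fun e => hWnn _
  have hsum : ∀ {p : ℕ}, p.Prime → ∑' e, W (p ^ e) = 1 + T p := by
    intro p hp
    rw [(h.summable_pow hp ha).tsum_eq_zero_add]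
    simp only [pow_zero, ← hW1, hT, hW]
  have hgood : ∀ {p : ℕ}, p.Prime → p ∉ S → T p ≤ (p : ℝ) ^ (2 * a - 2) := by
    intro p hp hS
    obtain ⟨h1, h2, h3⟩ := h.quotPart_good hp hS
    have hp0 : (0 : ℝ) < p := by exact_mod_cast hp.pos
    have e : T p = W (p ^ 2) := by
      refine tsum_eq_single 1 fun e he => ?_
      match e, he with
      | 0, _ => simp only [hW, zero_add, h1, abs_zero, zero_mul]
      | e + 2, _ => simp only [hW, h3 e, abs_zero, zero_mul]
    rw [e]
    simp only [hW, h2, abs_neg, abs_pow]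
    have h4 : |x p| ^ 2 ≤ (1 / (p : ℝ)) ^ 2 := pow_le_pow_left₀ (abs_nonneg _) (h.abs_le p) 2
    calc |x p| ^ 2 * ((p ^ 2 : ℕ) : ℝ) ^ a ≤ (1 / (p : ℝ)) ^ 2 * ((p ^ 2 : ℕ) : ℝ) ^ a := by gcongr
      _ = (p : ℝ) ^ (2 * a - 2) := by
        push_cast
        rw [Real.rpow_sub hp0, ← Real.rpow_natCast_mul hp0.le]
        norm_num
        field_simp
  have hexp : 2 * a - 2 < -1 := by linarith
  have hprimes := Real.summable_nat_rpow.2 hexp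
  set Z := ∑ p ∈ S, T p + ∑' n : ℕ, (n : ℝ) ^ (2 * a - 2) with hZ
  refine summable_of_sum_range_le hWnn (c := Real.exp Z) fun N => ?_
  obtain ⟨-, hs⟩ := EulerProduct.summable_and_hasSum_smoothNumbers_prod_primesBelow_tsum hW1 hWmul
    hWp N
  have hs2 : HasSum ((N.smoothNumbers).indicator W) (∏ p ∈ N.primesBelow, ∑' n, W (p ^ n)) :=
    hasSum_subtype_iff_indicator.1 hs
  have h1 : ∑ i ∈ Finset.range N, W i ≤ ∏ p ∈ N.primesBelow, ∑' n, W (p ^ n) := by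
    refine le_trans (Finset.sum_le_sum fun i hi => ?_) (sum_le_hasSum (Finset.range N) (fun i _ =>
      Set.indicator_nonneg (fun n _ => hWnn n) i) hs2)
    rcases Nat.eq_zero_or_pos i with rfl | hi0
    · have : W 0 = 0 := by simp [hW]
      rw [this]
      exact Set.indicator_nonneg (fun n _ => hWnn n) 0
    · rw [Set.indicator_of_mem (Nat.mem_smoothNumbers_of_lt hi0 (Finset.mem_range.1 hi))]
  refine h1.trans ?_
  have h2 : ∏ p ∈ N.primesBelow, ∑' n, W (p ^ n) ≤ ∏ p ∈ N.primesBelow, Real.exp (T p) := by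
    refine Finset.prod_le_prod (fun p _ => tsum_nonneg fun n => hWnn _) fun p hp => ?_
    rw [hsum (Nat.prime_of_mem_primesBelow hp), add_comm]
    exact Real.add_one_le_exp _
  refine h2.trans ?_
  rw [← Real.exp_sum, Real.exp_le_exp]
  calc ∑ p ∈ N.primesBelow, T p
      ≤ ∑ p ∈ N.primesBelow, ((if p ∈ S then T p else 0) + (p : ℝ) ^ (2 * a - 2)) := by
        refine Finset.sum_le_sum fun p hp => ?_
        have hp' := Nat.prime_of_mem_primesBelow hp
        have : (0 : ℝ) ≤ (p : ℝ) ^ (2 * a - 2) := by positivity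
        split_ifs with hS
        · linarith
        · linarith [hgood hp' hS]
    _ ≤ Z := by
        rw [Finset.sum_add_distrib]
        refine add_le_add ?_ (hprimes.sum_le_tsum _ fun n _ => by positivity)
        rw [← Finset.sum_filter]
        refine Finset.sum_le_sum_of_subset_of_nonneg (fun p hp => (Finset.mem_filter.1 hp).2)
          fun p _ _ => hTnn p

lemma summable_quotPart' : Summable fun n => ‖quotPart r x n‖ := by
  have := h.summable_quotPart (a := 0) (by norm_num)
  simpa using this

lemma sum_range_quotPart {p : ℕ} (hp : p.Prime) (E : ℕ) :
    ∑ e ∈ Finset.range (E + 2), quotPart r x (p ^ e) = r (p ^ (E + 1)) - x p * r (p ^ E) := by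
  induction E with
  | zero =>
    rw [Finset.sum_range_succ, Finset.sum_range_one, h.quotPart_pow_succ hp 0,
      moebiusPart_pow_succ hp, pow_zero, h.moebiusPart_one, h.quotPart_isMultiplicative.1, h.mult.1]
    ring
  | succ E ih =>
    rw [Finset.sum_range_succ, ih, h.quotPart_pow_succ hp (E + 1), moebiusPart_pow_succ hp,
      moebiusPart_pow_succ hp]
    ring

lemma tsum_pow {p : ℕ} (hp : p.Prime) {l : ℝ} (hl : Tendsto (fun e : ℕ => r (p ^ e)) atTop (𝓝 l)) :
    ∑' e : ℕ, quotPart r x (p ^ e) = (1 - x p) * l := by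
  have hs : Summable fun e : ℕ => quotPart r x (p ^ e) := by
    have := h.summable_pow hp (a := 0) (by norm_num)
    simp only [Real.rpow_zero, mul_one] at this
    exact summable_abs_iff.1 this
  have h1 : Tendsto (fun E : ℕ => ∑ e ∈ Finset.range (E + 2), quotPart r x (p ^ e)) atTop
      (𝓝 (∑' e : ℕ, quotPart r x (p ^ e))) :=
    hs.hasSum.tendsto_sum_nat.comp (tendsto_add_atTop_nat 2)
  have h2 : Tendsto (fun E : ℕ => r (p ^ (E + 1)) - x p * r (p ^ E)) atTop (𝓝 (l - x p * l)) :=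
    (hl.comp (tendsto_add_atTop_nat 1)).sub (hl.const_mul _)
  have h3 : (fun E : ℕ => ∑ e ∈ Finset.range (E + 2), quotPart r x (p ^ e))
      = fun E : ℕ => r (p ^ (E + 1)) - x p * r (p ^ E) := funext (h.sum_range_quotPart hp)
  rw [h3] at h1
  rw [tendsto_nhds_unique h1 h2]
  ring

/-- The Euler product of the total mass of the quotient of `μ * r` by `x`. -/
lemma hasProd {l : ℕ → ℝ}
    (hl : ∀ p, p.Prime → Tendsto (fun e : ℕ => r (p ^ e)) atTop (𝓝 (l p))) :
    HasProd (Set.mulIndicator {p | Nat.Prime p} fun p => (1 - x p) * l p)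
      (∑' n, quotPart r x n) := by
  have hm := h.quotPart_isMultiplicative
  have key := EulerProduct.eulerProduct_hasProd_mulIndicator hm.1 hm.2 h.summable_quotPart'
    (ArithmeticFunction.map_zero)
  have e : Set.mulIndicator {p | Nat.Prime p} (fun p => (1 - x p) * l p)
      = Set.mulIndicator {p | Nat.Prime p} fun p => ∑' e : ℕ, quotPart r x (p ^ e) := by
    refine Set.mulIndicator_congr fun p hp => ?_
    exact (h.tsum_pow hp (hl p hp)).symm
  rw [e]
  exact key

end LocalFactors

end

section

/-! ### Weighted sums of arithmetic functions -/

variable {r x : ArithmeticFunction ℝ} {S : Finset ℕ} {χ : ℕ → ℝ} {J : ℝ → ℝ} {σ c Λ : ℝ}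

/-- Writing `μ * r = f * x` turns the weighted sum of `μ * r` into a combination of weighted
harmonic sums. -/
lemma sum_moebiusPart_mul (h : LocalFactors r x S) (hx : ∀ n, x n = χ n / n) (hJ : Weight J σ c Λ)
    {Q : ℝ} (hQ : 0 < Q) {Y : ℕ} (hY : c ≤ Y / Q) :
    ∑ q ∈ Finset.range Y, moebiusPart r q * J (q / Q)
      = ∑ d ∈ Finset.range Y, quotPart r x d * harmSum χ J (d / Q) := by
  have hR : ∀ d ∈ Finset.range Y, quotPart r x d * harmSum χ J (d / Q)
      = ∑ n ∈ Finset.range Y, quotPart r x d * (x n * J ((d * n : ℕ) / Q)) := by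
    intro d _
    rcases Nat.eq_zero_or_pos d with rfl | hd
    · simp
    · have hd' : (1 : ℝ) ≤ d := by exact_mod_cast hd
      have hle : (Y : ℝ) / Q ≤ Y * (d / Q) := by
        rw [← mul_div_assoc]
        gcongr
        exact le_mul_of_one_le_right (by positivity) hd'
      rw [harmSum_eq hJ (by positivity) (hY.trans hle), Finset.mul_sum]
      refine Finset.sum_congr rfl fun n _ => ?_
      rw [hx]
      push_cast
      congr 3
      ring
  rw [Finset.sum_congr rfl hR, ← Finset.sum_product']
  have hL : ∀ q ∈ Finset.range Y, moebiusPart r q * J (q / Q)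
      = ∑ z ∈ q.divisorsAntidiagonal, quotPart r x z.1 * (x z.2 * J (q / Q)) := by
    intro q _
    rw [← h.quotPart_mul, ArithmeticFunction.mul_apply, Finset.sum_mul]
    exact Finset.sum_congr rfl fun z _ => by ring
  rw [Finset.sum_congr rfl hL, Finset.sum_sigma']
  refine Finset.sum_of_injOn (fun z => z.2) ?_ ?_ ?_ ?_
  · rintro ⟨q, z⟩ hz ⟨q', z'⟩ hz' heq
    simp only [Finset.coe_sigma, Set.mem_sigma_iff, Finset.mem_coe, Nat.mem_divisorsAntidiagonal]
      at hz hz' heq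
    obtain ⟨_, h1, _⟩ := hz
    obtain ⟨_, h2, _⟩ := hz'
    subst heq
    rw [h1] at h2
    subst h2
    rfl
  · rintro ⟨q, z⟩ hz
    simp only [Finset.coe_sigma, Set.mem_sigma_iff, Finset.mem_coe, Nat.mem_divisorsAntidiagonal,
      Finset.mem_range] at hz
    obtain ⟨h0, h1, h2⟩ := hz
    simp only [Finset.mem_coe, Finset.mem_product, Finset.mem_range]
    have hz1 : z.1 ∣ q := ⟨z.2, h1.symm⟩
    have hz2 : z.2 ∣ q := ⟨z.1, by rw [mul_comm]; exact h1.symm⟩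
    exact ⟨(Nat.le_of_dvd (Nat.pos_of_ne_zero h2) hz1).trans_lt h0,
      (Nat.le_of_dvd (Nat.pos_of_ne_zero h2) hz2).trans_lt h0⟩
  · rintro ⟨d, n⟩ _ hdn
    simp only
    rcases Nat.eq_zero_or_pos d with rfl | hd
    · simp
    rcases Nat.eq_zero_or_pos n with rfl | hn
    · simp
    by_cases hlt : d * n < Y
    · refine absurd ⟨⟨d * n, (d, n)⟩, ?_, rfl⟩ hdn
      simp only [Finset.coe_sigma, Set.mem_sigma_iff, Finset.mem_coe,
        Nat.mem_divisorsAntidiagonal, Finset.mem_range]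
      exact ⟨hlt, trivial, (Nat.mul_pos hd hn).ne'⟩
    · rw [hJ.eq_zero, mul_zero, mul_zero]
      refine hY.trans ?_
      have : (Y : ℝ) ≤ (d * n : ℕ) := by exact_mod_cast not_lt.1 hlt
      gcongr
  · rintro ⟨q, z⟩ hz
    simp only [Finset.mem_sigma, Nat.mem_divisorsAntidiagonal] at hz
    simp only
    rw [hz.2.1]

lemma tsum_moebiusPart_mul (h : LocalFactors r x S) (hx : ∀ n, x n = χ n / n)
    (hJ : Weight J σ c Λ) {Q : ℝ} (hQ : 0 < Q) :
    HasSum (fun d => quotPart r x d * harmSum χ J (d / Q))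
      (∑' q : ℕ, moebiusPart r q * J (q / Q)) := by
  set Y := ⌈c * Q⌉₊ with hYdef
  have hY : c ≤ Y / Q := by
    rw [le_div_iff₀ hQ]
    exact Nat.le_ceil _
  have hge : ∀ n, n ∉ Finset.range Y → c ≤ (n : ℝ) / Q := by
    intro n hn
    have : (Y : ℝ) ≤ n := by exact_mod_cast not_lt.1 (mt Finset.mem_range.2 hn)
    exact hY.trans (by gcongr)
  have h1 : ∑' q : ℕ, moebiusPart r q * J (q / Q)
      = ∑ q ∈ Finset.range Y, moebiusPart r q * J (q / Q) :=
    tsum_eq_sum fun q hq => by rw [hJ.eq_zero _ (hge q hq), mul_zero]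
  rw [h1, sum_moebiusPart_mul h hx hJ hQ hY]
  refine hasSum_sum_of_ne_finset_zero fun d hd => ?_
  have hc := hge d hd
  have hpos : 0 < (d : ℝ) / Q := (one_pos.trans_le hJ.one_le).trans_le hc
  rw [harmSum_eq hJ hpos (Y := 1) (by simpa using hc)]
  simp

/-- The asymptotic evaluation of the weighted sum of `μ * r`. -/
lemma exists_sum_asymp (h : LocalFactors r x S) (hx : ∀ n, x n = χ n / n) (hJ : Weight J σ c Λ)
    {c₁ s : ℝ}
    (hR : ∀ a : ℝ, 0 < a → a ≤ 1 / 2 → ∃ C : ℝ, 0 ≤ C ∧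
      ∀ y, 0 < y → |harmSum χ J y - (c₁ - s * Real.log y)| ≤ C * y ^ a) :
    ∃ A : ℝ, (s = 0 → A = c₁ * ∑' n, quotPart r x n) ∧
      ∀ a : ℝ, 0 < a → a < 1 / 2 → ∃ C : ℝ, ∀ Q : ℝ, 0 < Q →
        |∑' q : ℕ, moebiusPart r q * J (q / Q) - (A + s * (∑' n, quotPart r x n) * Real.log Q)|
          ≤ C * Q ^ (-a) := by
  set f : ℕ → ℝ := fun n => quotPart r x n with hf
  have hf0 : f 0 = 0 := ArithmeticFunction.map_zero
  have hfs : Summable f := h.summable_quotPart'.of_norm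
  have hfl : Summable fun n : ℕ => f n * Real.log n := by
    refine Summable.of_norm_bounded
      ((h.summable_quotPart (a := 1 / 4) (by norm_num)).mul_right 4) fun n => ?_
    rw [norm_mul, Real.norm_eq_abs, Real.norm_eq_abs, abs_of_nonneg (Real.log_natCast_nonneg n),
      mul_assoc]
    refine mul_le_mul_of_nonneg_left ?_ (abs_nonneg _)
    have := Real.log_le_rpow_div (x := (n : ℝ)) (by positivity) (ε := 1 / 4) (by norm_num)
    linarith
  refine ⟨c₁ * ∑' n, f n - s * ∑' n, f n * Real.log n, fun hs => by rw [hs]; ring,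
    fun a ha ha2 => ?_⟩
  obtain ⟨C, hC0, hC⟩ := hR a ha ha2.le
  have hfa := h.summable_quotPart ha2
  refine ⟨C * ∑' n : ℕ, |f n| * (n : ℝ) ^ a, fun Q hQ => ?_⟩
  have e1 := tsum_moebiusPart_mul h hx hJ hQ
  have e2 : HasSum (fun n : ℕ => f n * (c₁ - s * Real.log n + s * Real.log Q))
      (c₁ * ∑' n, f n - s * ∑' n, f n * Real.log n + s * (∑' n, f n) * Real.log Q) := by
    have := ((hfs.hasSum.mul_left c₁).sub (hfl.hasSum.mul_left s)).add
      (hfs.hasSum.mul_left (s * Real.log Q))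
    have e4 : (fun n : ℕ => f n * (c₁ - s * Real.log n + s * Real.log Q))
        = fun n : ℕ => c₁ * f n - s * (f n * Real.log n) + s * Real.log Q * f n := by
      ext n
      ring
    rw [e4, mul_right_comm s]
    exact this
  have e3 := e1.sub e2
  rw [← e3.tsum_eq, ← Real.norm_eq_abs]
  refine (tsum_of_norm_bounded ((hfa.hasSum.mul_left (C * Q ^ (-a)))) fun n => ?_).trans
    (le_of_eq (by ring))
  rcases Nat.eq_zero_or_pos n with rfl | hn
  · change ‖f 0 * _ - f 0 * _‖ ≤ C * Q ^ (-a) * (|f 0| * _)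
    rw [hf0]
    simp
  · have hn' : (0 : ℝ) < n := by exact_mod_cast hn
    have hl : Real.log (n / Q) = Real.log n - Real.log Q := Real.log_div hn'.ne' hQ.ne'
    have hc := hC (n / Q) (by positivity)
    rw [hl, Real.div_rpow hn'.le hQ.le] at hc
    have e : f n * harmSum χ J (n / Q) - f n * (c₁ - s * Real.log n + s * Real.log Q)
        = f n * (harmSum χ J (n / Q) - (c₁ - s * (Real.log n - Real.log Q))) := by ring
    change ‖f n * harmSum χ J (n / Q) - f n * (c₁ - s * Real.log n + s * Real.log Q)‖ ≤ _
    rw [e, norm_mul, Real.norm_eq_abs, Real.norm_eq_abs]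
    calc |f n| * |harmSum χ J (n / Q) - (c₁ - s * (Real.log n - Real.log Q))|
        ≤ |f n| * (C * ((n : ℝ) ^ a / Q ^ a)) := by gcongr
      _ = C * Q ^ (-a) * (|f n| * (n : ℝ) ^ a) := by
        rw [Real.rpow_neg hQ.le]
        ring

end

section

/-! ### The local densities and the singular series -/

/-- The arithmetic function with the values of `u` away from zero. -/
def ofPos (u : ℕ → ℝ) : ArithmeticFunction ℝ := ⟨fun n => if n = 0 then 0 else u n, if_pos rfl⟩

lemma ofPos_apply {u : ℕ → ℝ} {n : ℕ} (hn : n ≠ 0) : ofPos u n = u n := if_neg hn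

lemma ofPos_isMultiplicative {u : ℕ → ℝ} (h1 : u 1 = 1)
    (h : ∀ a b : ℕ, 0 < a → 0 < b → Nat.Coprime a b → u (a * b) = u a * u b) :
    (ofPos u).IsMultiplicative := by
  rw [ArithmeticFunction.IsMultiplicative.iff_ne_zero]
  refine ⟨(ofPos_apply one_ne_zero).trans h1, fun {a b} ha hb hab => ?_⟩
  rw [ofPos_apply ha, ofPos_apply hb, ofPos_apply (mul_ne_zero ha hb),
    h a b (Nat.pos_of_ne_zero ha) (Nat.pos_of_ne_zero hb) hab]

lemma exists_bound_of_eventually_const {u : ℕ → ℝ} {k₀ : ℕ} (h : ∀ k ≥ k₀, u k = u k₀) {ρ : ℝ}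
    (hρ : 0 < ρ) : ∃ C : ℝ, ∀ e : ℕ, |u (e + 1) - u e| ≤ C * ρ ^ e := by
  refine ⟨∑ e ∈ Finset.range k₀, |u (e + 1) - u e| / ρ ^ e, fun e => ?_⟩
  rw [← div_le_iff₀ (by positivity)]
  by_cases he : e < k₀
  · exact Finset.single_le_sum (f := fun e => |u (e + 1) - u e| / ρ ^ e)
      (fun e _ => by positivity) (Finset.mem_range.2 he)
  · rw [h e (by omega), h (e + 1) (by omega), sub_self, abs_zero, zero_div]
    exact Finset.sum_nonneg fun e _ => by positivity

variable {F : QuadraticForm ℤ (Fin 3 → ℤ)} {m : ℤ} {L : ℕ} {ν : Fin 3 → ℤ} {p₀ : ℕ}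

lemma tendsto_localCount {p : ℕ} (hp : p.Prime) (hm : m ≠ 0) :
    Tendsto (fun k => localCount F m L ν p k) atTop (𝓝 (localDensity F m L ν p)) := by
  obtain ⟨k₀, hk₀⟩ := exists_localCount_eq (F := F) (L := L) (ν := ν) hp hm
  have : Tendsto (fun k => localCount F m L ν p k) atTop (𝓝 (localCount F m L ν p k₀)) :=
    tendsto_const_nhds.congr' (by
      filter_upwards [eventually_ge_atTop k₀] with k hk
      exact (hk₀ k hk).symm)
  unfold localDensity
  rwa [this.limUnder_eq]

lemma localCount_cone (hp₀ : p₀.Prime) (k : ℕ) :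
    localCount F 0 1 0 p₀ k = (p₀ : ℝ) ^ k * solDens F 0 1 0 (p₀ ^ k) := by
  rw [localCount_eq hp₀ one_pos (by simp)]
  simp

lemma tendsto_localCount_cone (hF : discr F ≠ 0) (hp₀ : p₀.Prime) :
    Tendsto (fun k => localCount F 0 1 0 p₀ k) atTop (𝓝 (localDensity F 0 1 0 p₀)) := by
  obtain ⟨C, hC⟩ := coneDens_diff_bound hF hp₀
  have hρ : (√(p₀ : ℝ))⁻¹ < 1 := by
    refine inv_lt_one_of_one_lt₀ ?_
    rw [Real.lt_sqrt zero_le_one]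
    have : (1 : ℝ) < p₀ := by exact_mod_cast hp₀.one_lt
    linarith
  have hcs : CauchySeq fun k => localCount F 0 1 0 p₀ k := by
    refine cauchySeq_of_le_geometric _ C hρ fun k => ?_
    rw [dist_comm, Real.dist_eq, localCount_cone hp₀, localCount_cone hp₀]
    exact hC k
  obtain ⟨l, hl⟩ := cauchySeq_tendsto_of_complete hcs
  unfold localDensity
  rwa [hl.limUnder_eq]

/-- The function `n ↦ n D(n L ^ 2) / D(L ^ 2)` built from the limiting densities `D`. -/
def normDens (F : QuadraticForm ℤ (Fin 3 → ℤ)) (m : ℤ) (L : ℕ) (ν : Fin 3 → ℤ) (p₀ : ℕ) :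
    ArithmeticFunction ℝ :=
  ofPos fun n => n * limDens F m L ν p₀ (n * L ^ 2) / limDens F m L ν p₀ (L ^ 2)

/-- The completely multiplicative function `χ(n) / n`. -/
def chiDiv (F : QuadraticForm ℤ (Fin 3 → ℤ)) (m : ℤ) : ArithmeticFunction ℝ :=
  ofPos fun n => chi F m n / n

lemma chiDiv_apply (n : ℕ) : chiDiv F m n = chi F m n / n := by
  rcases eq_or_ne n 0 with rfl | hn
  · simp
  · exact ofPos_apply hn

lemma normDens_isMultiplicative (hL : 0 < L) (hD : limDens F m L ν p₀ (L ^ 2) ≠ 0) :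
    (normDens F m L ν p₀).IsMultiplicative := by
  refine ofPos_isMultiplicative (by simp [hD]) fun a b ha hb hab => ?_
  set G := ofPos (limDens F m L ν p₀) with hG
  have hGm : G.IsMultiplicative :=
    ofPos_isMultiplicative (limDens_one p₀) fun a b ha hb hab => limDens_mul ha hb hab
  have hL2 : 0 < L ^ 2 := pow_pos hL 2
  have key := hGm.lcm_apply_mul_gcd_apply (x := a * L ^ 2) (y := b * L ^ 2)
  rw [Nat.lcm_mul_right, Nat.gcd_mul_right, hab.gcd_eq_one, hab.lcm_eq_mul, one_mul, hG,
    ofPos_apply (Nat.mul_pos (Nat.mul_pos ha hb) hL2).ne', ofPos_apply hL2.ne',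
    ofPos_apply (Nat.mul_pos ha hL2).ne', ofPos_apply (Nat.mul_pos hb hL2).ne'] at key
  push_cast
  field_simp
  linear_combination key

lemma sq_eq_ordProj_mul {p : ℕ} : L ^ 2 = p ^ (2 * L.factorization p)
    * (L / p ^ L.factorization p) ^ 2 := by
  conv_lhs => rw [← Nat.ordProj_mul_ordCompl_eq_self L p]
  rw [mul_pow, ← pow_mul, mul_comm 2]

lemma limDens_pow_mul_sq {p : ℕ} (hp : p.Prime) (hL : 0 < L) (e : ℕ) :
    limDens F m L ν p₀ (p ^ e * L ^ 2) = limDens F m L ν p₀ (p ^ (e + 2 * L.factorization p))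
      * limDens F m L ν p₀ ((L / p ^ L.factorization p) ^ 2) := by
  rw [sq_eq_ordProj_mul (L := L) (p := p), ← mul_assoc, ← pow_add]
  exact limDens_mul (pow_pos hp.pos _) (pow_pos (Nat.ordCompl_pos p hL.ne') 2)
    (Nat.Coprime.pow _ _ (Nat.coprime_ordCompl hp hL.ne'))

lemma limDens_pow_of_ne {p : ℕ} (hp : p.Prime) (hp₀ : p₀.Prime) (hne : p ≠ p₀) (e : ℕ) :
    limDens F m L ν p₀ (p ^ e) = solDens F m L ν (p ^ e) :=
  limDens_of_not_dvd fun h => hne ((Nat.prime_dvd_prime_iff_eq hp₀ hp).1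
    (hp₀.dvd_of_dvd_pow h)).symm

lemma normDens_pow {p : ℕ} (hp : p.Prime) (hL : 0 < L) (hD : limDens F m L ν p₀ (L ^ 2) ≠ 0)
    (e : ℕ) : normDens F m L ν p₀ (p ^ e)
      = (p : ℝ) ^ e * limDens F m L ν p₀ (p ^ (e + 2 * L.factorization p))
        / limDens F m L ν p₀ (p ^ (2 * L.factorization p)) := by
  have h0 := limDens_pow_mul_sq (F := F) (m := m) (ν := ν) (p₀ := p₀) hp hL 0
  rw [pow_zero, one_mul, zero_add] at h0
  rw [h0] at hD
  rw [normDens, ofPos_apply (pow_pos hp.pos e).ne', limDens_pow_mul_sq hp hL, h0]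
  have h1 := left_ne_zero_of_mul hD
  have h2 := right_ne_zero_of_mul hD
  push_cast
  field_simp

lemma normDens_pow_of_ne {p : ℕ} (hp : p.Prime) (hp₀ : p₀.Prime) (hne : p ≠ p₀) (hL : 0 < L)
    (hD : limDens F m L ν p₀ (L ^ 2) ≠ 0) (e : ℕ) :
    normDens F m L ν p₀ (p ^ e) = localCount F m L ν p (e + 2 * L.factorization p)
      * ((p : ℝ) ^ L.factorization p / solDens F m L ν (p ^ (2 * L.factorization p))) := by
  have hp0 : (p : ℝ) ≠ 0 := by exact_mod_cast hp.ne_zero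
  rw [normDens_pow hp hL hD, limDens_pow_of_ne hp hp₀ hne, limDens_pow_of_ne hp hp₀ hne,
    localCount_eq hp hL (by rw [← Nat.factorization_def L hp]; omega), ← Nat.factorization_def L hp]
  have : (p : ℝ) ^ (e + 2 * L.factorization p) * ((p : ℝ) ^ (3 * L.factorization p))⁻¹
      * (p : ℝ) ^ L.factorization p = (p : ℝ) ^ e := by
    rw [mul_assoc, mul_comm _ ((p : ℝ) ^ L.factorization p), ← mul_assoc, ← pow_add,
      mul_inv_eq_iff_eq_mul₀ (pow_ne_zero _ hp0), ← pow_add]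
    congr 1
    ring
  rw [← this]
  ring

lemma normDens_pow_self (hp₀ : p₀.Prime) (hL : 0 < L) (hp₀L : ¬ p₀ ∣ L)
    (hD : limDens F m L ν p₀ (L ^ 2) ≠ 0) (e : ℕ) :
    normDens F m L ν p₀ (p₀ ^ e) = localCount F 0 1 0 p₀ e := by
  rw [normDens_pow hp₀ hL hD, Nat.factorization_eq_zero_of_not_dvd hp₀L, mul_zero, add_zero,
    pow_zero, limDens_one, limDens_p₀_pow hp₀, localCount_cone hp₀, div_one]

/-- The primes of bad reduction. -/
def badPrimes (F : QuadraticForm ℤ (Fin 3 → ℤ)) (m : ℤ) (L p₀ : ℕ) : Finset ℕ :=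
  (2 * m * (polarMatrix F).det * L * p₀).natAbs.primeFactors

lemma not_dvd_of_notMem_badPrimes (hF : discr F ≠ 0) (hm : m ≠ 0) (hL : 0 < L) (hp₀ : p₀.Prime)
    {p : ℕ} (hp : p.Prime) (h : p ∉ badPrimes F m L p₀) :
    ¬ (p : ℤ) ∣ 2 * m ∧ ¬ (p : ℤ) ∣ (polarMatrix F).det ∧ ¬ p ∣ L ∧ p ≠ p₀ := by
  have hdet : (polarMatrix F).det ≠ 0 := fun h => hF (by simp [discr, h])
  have hne : (2 * m * (polarMatrix F).det * L * p₀) ≠ 0 := by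
    have : (L : ℤ) ≠ 0 := by exact_mod_cast hL.ne'
    have : (p₀ : ℤ) ≠ 0 := by exact_mod_cast hp₀.ne_zero
    positivity
  have hnd : ¬ (p : ℤ) ∣ 2 * m * (polarMatrix F).det * L * p₀ := by
    intro hd
    refine h (Nat.mem_primeFactors.2 ⟨hp, ?_, Int.natAbs_ne_zero.2 hne⟩)
    exact Int.natCast_dvd.1 hd
  refine ⟨fun hd => hnd ?_, fun hd => hnd ?_, fun hd => hnd ?_, fun hd => hnd ?_⟩
  · exact ((hd.mul_right _).mul_right _).mul_right _
  · exact ((hd.mul_left _).mul_right _).mul_right _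
  · exact ((Int.natCast_dvd_natCast.2 hd).mul_left _).mul_right _
  · rw [hd]
    exact dvd_mul_left _ _

lemma localCount_eq_of_good (hF : discr F ≠ 0) (hm : m ≠ 0) (hL : 0 < L) (hp₀ : p₀.Prime)
    {p k : ℕ} (hp : p.Prime) (h : p ∉ badPrimes F m L p₀) (hk : 1 ≤ k) :
    localCount F m L ν p k = 1 + chi F m p / p := by
  obtain ⟨h1, h2, h3, -⟩ := not_dvd_of_notMem_badPrimes hF hm hL hp₀ hp h
  rw [localCount_good hp h1 h3 hk, localCount_one_good hp h1 h3 h2, chi_good hp h1 h2]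

/-- The limiting densities have the local structure that the convolution argument needs: Hensel's
lemma at the primes other than `p₀`, the cone densities at `p₀`. -/
lemma localFactors (hF : discr F ≠ 0) (hm : m ≠ 0) (hL : 0 < L) (hp₀ : p₀.Prime) (hp₀L : ¬ p₀ ∣ L)
    (hD : limDens F m L ν p₀ (L ^ 2) ≠ 0) :
    LocalFactors (normDens F m L ν p₀) (chiDiv F m) (badPrimes F m L p₀) where
  mult := normDens_isMultiplicative hL hD
  one := by rw [chiDiv_apply, chi_one]; simp
  mul a b := by
    rw [chiDiv_apply, chiDiv_apply, chiDiv_apply, chi_mul]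
    push_cast
    rw [mul_div_mul_comm]
  abs_le n := by
    rw [chiDiv_apply, abs_div, Nat.abs_cast]
    gcongr
    exact abs_chi_le n
  good p hp h e := by
    obtain ⟨-, -, h3, h4⟩ := not_dvd_of_notMem_badPrimes hF hm hL hp₀ hp h
    rw [normDens_pow_of_ne hp hp₀ h4 hL hD, Nat.factorization_eq_zero_of_not_dvd h3, chiDiv_apply,
      localCount_eq_of_good hF hm hL hp₀ hp h (by omega)]
    simp [solDens_one]
  bound p hp := by
    have hρ : 0 < (√(p : ℝ))⁻¹ := inv_pos.2 (Real.sqrt_pos.2 (by exact_mod_cast hp.pos))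
    rcases eq_or_ne p p₀ with rfl | hne
    · obtain ⟨C, hC⟩ := coneDens_diff_bound hF hp
      refine ⟨C, fun e => ?_⟩
      rw [normDens_pow_self hp hL hp₀L hD, normDens_pow_self hp hL hp₀L hD, localCount_cone hp,
        localCount_cone hp]
      exact hC e
    · obtain ⟨k₀, hk₀⟩ := exists_localCount_eq (F := F) (L := L) (ν := ν) hp hm
      refine exists_bound_of_eventually_const (u := fun e => normDens F m L ν p₀ (p ^ e)) (k₀ := k₀)
        (fun k hk => ?_) hρ
      rw [normDens_pow_of_ne hp hp₀ hne hL hD, normDens_pow_of_ne hp hp₀ hne hL hD,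
        hk₀ _ (by omega), hk₀ (k₀ + _) (by omega)]

lemma convFactor_mul_of_good (hF : discr F ≠ 0) (hm : m ≠ 0) (hL : 0 < L) (hp₀ : p₀.Prime) {p : ℕ}
    (hp : p.Prime) (h : p ∉ badPrimes F m L p₀) :
    eulerFactor F m L ν p = 1 - (chi F m p / p) ^ 2 := by
  have : localDensity F m L ν p = 1 + chi F m p / p :=
    tendsto_nhds_unique (tendsto_localCount hp hm) (tendsto_const_nhds.congr' (by
      filter_upwards [eventually_ge_atTop 1] with k hk
      exact (localCount_eq_of_good hF hm hL hp₀ hp h hk).symm))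
  rw [eulerFactor, this, convFactor_eq hp]
  ring

/-- The Euler product of the singular series converges absolutely. -/
lemma multipliable_eulerFactor (hF : discr F ≠ 0) (hm : m ≠ 0) (hL : 0 < L) (hp₀ : p₀.Prime) :
    Multipliable fun p : {p : ℕ // p.Prime ∧ p ≠ p₀} => eulerFactor F m L ν p := by
  set B := badPrimes F m L p₀ with hB
  have h1 : Summable fun n : ℕ => (if n ∈ B then |eulerFactor F m L ν n - 1| else 0)
      + 1 / (n : ℝ) ^ 2 :=
    (summable_of_ne_finset_zero (s := B) fun n hn => if_neg hn).add
      (Real.summable_one_div_nat_pow.2 one_lt_two)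
  have h2 : Summable fun p : {p : ℕ // p.Prime ∧ p ≠ p₀} => eulerFactor F m L ν p - 1 := by
    refine Summable.of_norm_bounded (h1.comp_injective Subtype.val_injective) fun p => ?_
    simp only [Function.comp_apply]
    rw [Real.norm_eq_abs]
    split_ifs with h
    · exact le_add_of_nonneg_right (by positivity)
    · rw [convFactor_mul_of_good hF hm hL hp₀ p.2.1 h, zero_add, sub_sub_cancel_left, abs_neg,
        abs_pow, abs_div, Nat.abs_cast, div_pow]
      gcongr
      exact pow_le_one₀ (abs_nonneg _) (abs_chi_le _)
  have := Real.multipliable_one_add_of_summable h2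
  simpa using this

lemma prod_solDens (hL : 0 < L) :
    ∏ p ∈ L.primeFactors, (solDens F m L ν (p ^ (2 * L.factorization p))
      / (p : ℝ) ^ L.factorization p) = solDens F m L ν (L ^ 2) / L := by
  have hm : (ofPos fun n => solDens F m L ν (n ^ 2)).IsMultiplicative := by
    refine ofPos_isMultiplicative (by rw [one_pow, solDens_one]) fun a b ha hb hab => ?_
    rw [mul_pow, solDens_mul (pow_pos ha 2) (pow_pos hb 2) (Nat.Coprime.pow 2 2 hab)]
  have h1 := hm.multiplicative_factorization _ hL.ne'
  rw [ofPos_apply hL.ne', Finsupp.prod, Nat.support_factorization] at h1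
  rw [Finset.prod_div_distrib, h1]
  congr 1
  · refine Finset.prod_congr rfl fun p hp => ?_
    rw [ofPos_apply (pow_pos (Nat.prime_of_mem_primeFactors hp).pos _).ne', ← pow_mul, mul_comm 2]
  · conv_rhs => rw [← Nat.prod_factorization_pow_eq_self hL.ne']
    rw [Finsupp.prod, Nat.support_factorization]
    push_cast
    rfl

lemma limDens_sq (hp₀ : p₀.Prime) (hp₀L : ¬ p₀ ∣ L) :
    limDens F m L ν p₀ (L ^ 2) = solDens F m L ν (L ^ 2) :=
  limDens_of_not_dvd fun h => hp₀L (hp₀.dvd_of_dvd_pow h)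

/-- If no `σ` satisfies the congruence modulo `L ^ 2`, then some local density vanishes. -/
lemma singSeries_eq_zero (hm : m ≠ 0) (hL : 0 < L) (hp₀ : p₀.Prime) (hp₀L : ¬ p₀ ∣ L)
    (hD : limDens F m L ν p₀ (L ^ 2) = 0) : singSeries F m p₀ L ν = 0 := by
  rw [limDens_sq hp₀ hp₀L] at hD
  have h1 := prod_solDens (F := F) (m := m) (ν := ν) hL
  rw [hD, zero_div, Finset.prod_eq_zero_iff] at h1
  obtain ⟨p, hp, h2⟩ := h1
  have hpp := Nat.prime_of_mem_primeFactors hp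
  have hp0 : (p : ℝ) ≠ 0 := by exact_mod_cast hpp.ne_zero
  have h3 : solDens F m L ν (p ^ (2 * L.factorization p)) = 0 :=
    (div_eq_zero_iff.1 h2).resolve_right (pow_ne_zero _ hp0)
  have h4 : localDensity F m L ν p = 0 :=
    tendsto_nhds_unique (tendsto_localCount hpp hm) (tendsto_const_nhds.congr' (by
      filter_upwards [eventually_ge_atTop (2 * L.factorization p)] with k hk
      rw [localCount_eq hpp hL (by rw [← Nat.factorization_def L hpp]; omega)]
      have h5 : solDens F m L ν (p ^ k) ≤ 0 :=
        (solDens_antitone (pow_pos hpp.pos k) (pow_dvd_pow p hk)).trans_eq h3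
      rw [le_antisymm h5 (solDens_nonneg _), mul_zero]))
  have hne : p ≠ p₀ := by
    rintro rfl
    exact hp₀L (Nat.dvd_of_mem_primeFactors hp)
  unfold singSeries
  rw [tprod_of_exists_eq_zero ⟨⟨p, hpp, hne⟩, by rw [eulerFactor, h4, mul_zero]⟩, mul_zero]

/-- The total mass of the quotient of `μ * r` by `χ(n) / n` is the singular series. -/
lemma limDens_mul_tsum_quotPart (hF : discr F ≠ 0) (hm : m ≠ 0) (hL : 0 < L) (hp₀ : p₀.Prime)
    (hp₀L : ¬ p₀ ∣ L) (hD : limDens F m L ν p₀ (L ^ 2) ≠ 0) :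
    limDens F m L ν p₀ (L ^ 2) * ∑' n, quotPart (normDens F m L ν p₀) (chiDiv F m) n
      = L * singSeries F m p₀ L ν := by
  classical
  have hlf := localFactors hF hm hL hp₀ hp₀L hD
  set l : ℕ → ℝ := fun p => if p = p₀ then localDensity F 0 1 0 p₀ else
    localDensity F m L ν p
      * ((p : ℝ) ^ L.factorization p / solDens F m L ν (p ^ (2 * L.factorization p))) with hl
  have hlim : ∀ p, p.Prime →
      Tendsto (fun e : ℕ => normDens F m L ν p₀ (p ^ e)) atTop (𝓝 (l p)) := by
    intro p hp
    rcases eq_or_ne p p₀ with rfl | hne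
    · simp only [hl, if_true, normDens_pow_self hp hL hp₀L hD]
      exact tendsto_localCount_cone hF hp
    · simp only [hl, if_neg hne, normDens_pow_of_ne hp hp₀ hne hL hD]
      exact ((tendsto_localCount hp hm).comp (tendsto_add_atTop_nat _)).mul_const _
  have hP1 := hlf.hasProd hlim
  have hP2 : HasProd (fun p => if p ∈ L.primeFactors then
      solDens F m L ν (p ^ (2 * L.factorization p)) / (p : ℝ) ^ L.factorization p else 1)
      (solDens F m L ν (L ^ 2) / L) := by
    rw [← prod_solDens hL, ← Finset.prod_congr rfl fun p hp => if_pos hp]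
    exact hasProd_prod_of_ne_finset_one fun p hp => if_neg hp
  have hP3 := (multipliable_eulerFactor (ν := ν) hF hm hL hp₀).hasProd
  have hP3' : HasProd (Set.mulIndicator {p : ℕ | p.Prime ∧ p ≠ p₀} fun p => eulerFactor F m L ν p)
      (∏' p : {p : ℕ // p.Prime ∧ p ≠ p₀}, eulerFactor F m L ν p) :=
    hasProd_subtype_iff_mulIndicator.1 hP3
  have hP4 : HasProd (fun p => if p = p₀ then convFactor F m p₀ * localDensity F 0 1 0 p₀ else 1)
      (convFactor F m p₀ * localDensity F 0 1 0 p₀) := hasProd_ite_eq _ _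
  have heq : (fun p => Set.mulIndicator {p | Nat.Prime p} (fun p => (1 - chiDiv F m p) * l p) p
      * if p ∈ L.primeFactors then
      solDens F m L ν (p ^ (2 * L.factorization p)) / (p : ℝ) ^ L.factorization p else 1)
      = fun p => (if p = p₀ then convFactor F m p₀ * localDensity F 0 1 0 p₀ else 1)
        * Set.mulIndicator {p : ℕ | p.Prime ∧ p ≠ p₀} (fun p => eulerFactor F m L ν p) p := by
    ext p
    by_cases hp : p.Prime
    · have hp0 : (p : ℝ) ≠ 0 := by exact_mod_cast hp.ne_zero
      rw [Set.mulIndicator_of_mem (by exact hp), chiDiv_apply, ← convFactor_eq hp]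
      rcases eq_or_ne p p₀ with rfl | hne
      · rw [Set.mulIndicator_of_notMem (by simp), if_pos rfl,
          if_neg fun h => hp₀L (Nat.dvd_of_mem_primeFactors h)]
        simp only [hl, if_true]
      · rw [Set.mulIndicator_of_mem (by exact ⟨hp, hne⟩), if_neg hne, one_mul]
        simp only [hl, if_neg hne, eulerFactor]
        split_ifs with hpL
        · have h5 : solDens F m L ν (p ^ (2 * L.factorization p)) ≠ 0 := by
            intro h0
            refine hD ?_
            rw [limDens_sq hp₀ hp₀L]
            have := prod_solDens (F := F) (m := m) (ν := ν) hL
            rw [Finset.prod_eq_zero hpL (by rw [h0, zero_div])] at this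
            exact (div_eq_zero_iff.1 this.symm).resolve_right (by exact_mod_cast hL.ne')
          field_simp
        · have : L.factorization p = 0 :=
            Nat.factorization_eq_zero_of_not_dvd fun h =>
              hpL (Nat.mem_primeFactors.2 ⟨hp, h, hL.ne'⟩)
          rw [this]
          simp [solDens_one]
    · rw [Set.mulIndicator_of_notMem (by exact hp),
        Set.mulIndicator_of_notMem (by exact fun h => hp h.1),
        if_neg fun h => hp (Nat.prime_of_mem_primeFactors h), if_neg (by rintro rfl; exact hp hp₀)]
  have key := (hP1.mul hP2).unique (heq ▸ hP4.mul hP3')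
  have hL0 : (L : ℝ) ≠ 0 := by exact_mod_cast hL.ne'
  rw [limDens_sq hp₀ hp₀L]
  unfold singSeries
  rw [← key]
  field_simp

end

section

/-! ### The delta method expansion -/

variable {F : QuadraticForm ℤ (Fin 3 → ℤ)} {m : ℤ} {L : ℕ} {ν : Fin 3 → ℤ} {p₀ : ℕ}
  {w : (Fin 3 → ℝ) → ℝ} {σ c Λ : ℝ}

open ArithmeticFunction in
/-- The arithmetic factor of the `q`-th term of the expansion. -/
def termCoeff (F : QuadraticForm ℤ (Fin 3 → ℤ)) (m : ℤ) (L : ℕ) (ν : Fin 3 → ℤ) (P q : ℕ) : ℝ :=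
  ∑ z ∈ q.divisorsAntidiagonal, (moebius z.1 : ℝ) *
    (z.2 * solDens F (m * (P : ℤ) ^ 2) L ((P : ℤ) • ν) (z.2 * L ^ 2))

lemma deltaTerm_eq (hL : 0 < L) (hp₀ : p₀.Prime) (h : ℕ) {q : ℕ} (hq : 0 < q) :
    deltaTerm F m L (p₀ ^ (2 * h)) ((p₀ : ℤ) ^ h • ν) w 0 q
      = ((((p₀ ^ h : ℕ) : ℝ) / L) ^ 3 * (termCoeff F m L ν (p₀ ^ h) q
        * levelAvg F m w (q / (((p₀ ^ h : ℕ) : ℝ) / L))) : ℝ) := by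
  have e1 : p₀ ^ (2 * h) = (p₀ ^ h) ^ 2 := by rw [← pow_mul, mul_comm]
  have e2 : (p₀ : ℤ) ^ h = ((p₀ ^ h : ℕ) : ℤ) := by push_cast; rfl
  unfold deltaTerm
  rw [e1, e2, oscInt_zero m hL (pow_pos hp₀.pos h), mul_div_right_comm, expSum_zero_div hL hq]
  rw [← Complex.ofReal_mul]
  congr 1
  unfold termCoeff
  rw [div_div_eq_mul_div]
  push_cast
  ring

/-- On the support of the weight `q` is small against `p₀ ^ (2 h)`, so that all the densities
involved have reached their limits. -/
lemma termCoeff_mul_levelAvg (hL : 0 < L) (hp₀ : p₀.Prime) (hp₀L : ¬ p₀ ∣ L)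
    (hJ : Weight (levelAvg F m w) σ c Λ) {h : ℕ} (hh : c ≤ ((p₀ ^ h : ℕ) : ℝ)) (q : ℕ) :
    termCoeff F m L ν (p₀ ^ h) q * levelAvg F m w (q / (((p₀ ^ h : ℕ) : ℝ) / L))
      = limDens F m L ν p₀ (L ^ 2) * (moebiusPart (normDens F m L ν p₀) q
        * levelAvg F m w (q / (((p₀ ^ h : ℕ) : ℝ) / L))) := by
  have hP : (0 : ℝ) < ((p₀ ^ h : ℕ) : ℝ) := by exact_mod_cast pow_pos hp₀.pos h
  have hL' : (1 : ℝ) ≤ L := by exact_mod_cast hL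
  rcases le_or_gt c (q / (((p₀ ^ h : ℕ) : ℝ) / L)) with hq | hq
  · rw [hJ.eq_zero _ hq]
    ring
  rw [← mul_assoc]
  congr 1
  unfold termCoeff moebiusPart
  rw [ArithmeticFunction.mul_apply, Finset.mul_sum]
  refine Finset.sum_congr rfl fun z hz => ?_
  obtain ⟨hz1, hz0⟩ := Nat.mem_divisorsAntidiagonal.1 hz
  have hz2 : 0 < z.2 := Nat.pos_of_ne_zero fun h0 => hz0 (by rw [← hz1, h0, mul_zero])
  have hzq : z.2 ≤ q := Nat.le_of_dvd (Nat.pos_of_ne_zero hz0)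
    ⟨z.1, by rw [mul_comm]; exact hz1.symm⟩
  -- on the support of the weight, the `p₀`-part of `z.2` is less than `p₀ ^ (2 * h)`
  have hlt : (q : ℝ) < ((p₀ ^ (2 * h) : ℕ) : ℝ) := by
    rw [div_div_eq_mul_div, div_lt_iff₀ hP] at hq
    calc (q : ℝ) ≤ q * L := le_mul_of_one_le_right (by positivity) hL'
      _ < c * ((p₀ ^ h : ℕ) : ℝ) := hq
      _ ≤ ((p₀ ^ h : ℕ) : ℝ) * ((p₀ ^ h : ℕ) : ℝ) := by gcongr
      _ = ((p₀ ^ (2 * h) : ℕ) : ℝ) := by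
        push_cast
        rw [two_mul, pow_add]
  have hv : (z.2 * L ^ 2).factorization p₀ ≤ 2 * h := by
    rw [Nat.factorization_mul hz2.ne' (pow_pos hL 2).ne', Nat.factorization_pow, Finsupp.add_apply,
      Finsupp.smul_apply, Nat.factorization_eq_zero_of_not_dvd hp₀L, smul_zero, add_zero]
    have h1 : p₀ ^ z.2.factorization p₀ ≤ z.2 := Nat.ordProj_le p₀ hz2.ne'
    have h2 : p₀ ^ z.2.factorization p₀ < p₀ ^ (2 * h) :=
      (h1.trans hzq).trans_lt (by exact_mod_cast hlt)
    exact ((Nat.pow_lt_pow_iff_right hp₀.one_lt).1 h2).le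
  rw [solDens_eq_limDens hp₀ hp₀L (Nat.mul_pos hz2 (pow_pos hL 2)) hv, normDens,
    ofPos_apply hz2.ne',
    ArithmeticFunction.intCoe_apply]
  by_cases hD : limDens F m L ν p₀ (L ^ 2) = 0
  · have h3 : limDens F m L ν p₀ (z.2 * L ^ 2) = 0 :=
      le_antisymm
        ((limDens_antitone (Nat.mul_pos hz2 (pow_pos hL 2)) (dvd_mul_left _ _)).trans_eq hD)
        (limDens_nonneg _ _)
    rw [h3, hD]
    ring
  · field_simp

lemma summable_term (hL : 0 < L) (hp₀ : p₀.Prime) (hJ : Weight (levelAvg F m w) σ c Λ) (h : ℕ)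
    (u : ℕ → ℝ) :
    Summable fun q : ℕ => u q * levelAvg F m w (q / (((p₀ ^ h : ℕ) : ℝ) / L)) := by
  have hP : (0 : ℝ) < ((p₀ ^ h : ℕ) : ℝ) := by exact_mod_cast pow_pos hp₀.pos h
  have hL' : (0 : ℝ) < L := by exact_mod_cast hL
  refine summable_of_ne_finset_zero (s := Finset.range ⌈c * (((p₀ ^ h : ℕ) : ℝ) / L)⌉₊)
    fun q hq => ?_
  rw [hJ.eq_zero, mul_zero]
  rw [le_div_iff₀ (by positivity)]
  exact Nat.ceil_le.1 (not_lt.1 (mt Finset.mem_range.2 hq))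

lemma hasSum_deltaTerm (hL : 0 < L) (hp₀ : p₀.Prime) (hJ : Weight (levelAvg F m w) σ c Λ) (h : ℕ) :
    HasSum (fun q : ℕ+ => deltaTerm F m L (p₀ ^ (2 * h)) ((p₀ : ℤ) ^ h • ν) w 0 q)
      ((((p₀ ^ h : ℕ) : ℝ) / L) ^ 3 * ∑' q : ℕ, (termCoeff F m L ν (p₀ ^ h) q
        * levelAvg F m w (q / (((p₀ ^ h : ℕ) : ℝ) / L))) : ℝ) := by
  have h1 := ((summable_term hL hp₀ hJ h (termCoeff F m L ν (p₀ ^ h))).hasSum.mul_left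
    ((((p₀ ^ h : ℕ) : ℝ) / L) ^ 3))
  have h2 : HasSum (fun q : ℕ+ => (((p₀ ^ h : ℕ) : ℝ) / L) ^ 3 * (termCoeff F m L ν (p₀ ^ h) q
      * levelAvg F m w (q / (((p₀ ^ h : ℕ) : ℝ) / L)))) _ :=
    (PNat.coe_injective.hasSum_iff (f := fun q : ℕ => (((p₀ ^ h : ℕ) : ℝ) / L) ^ 3
      * (termCoeff F m L ν (p₀ ^ h) q * levelAvg F m w (q / (((p₀ ^ h : ℕ) : ℝ) / L))))
      fun q hq => by
        have : q = 0 := by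
          by_contra h0
          exact hq ⟨⟨q, Nat.pos_of_ne_zero h0⟩, rfl⟩
        rw [this]
        simp [termCoeff]).2 h1
  refine (Complex.hasSum_ofReal.2 h2).congr_fun ?_
  intro q
  exact deltaTerm_eq hL hp₀ h q.pos

/-- The asymptotic formula, given an expansion of the weighted harmonic sums of the character. -/
lemma exists_sum_deltaTerm_asymp (hF : discr F ≠ 0) (hm : m ≠ 0) (hL : 0 < L) (hp₀ : p₀.Prime)
    (hp₀L : ¬ p₀ ∣ L) (hJ : Weight (levelAvg F m w) σ c Λ) {c₁ s : ℝ}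
    (hR : ∀ a : ℝ, 0 < a → a ≤ 1 / 2 → ∃ C : ℝ, 0 ≤ C ∧
      ∀ y, 0 < y → |harmSum (chi F m) (levelAvg F m w) y - (c₁ - s * Real.log y)| ≤ C * y ^ a) :
    ∃ A : ℝ, (s = 0 → A = c₁ * (L * singSeries F m p₀ L ν)) ∧
      ∀ ε : ℝ, 0 < ε → ∃ C : ℝ, ∀ h : ℕ,
        ‖(∑' q : ℕ+, deltaTerm F m L (p₀ ^ (2 * h)) ((p₀ : ℤ) ^ h • ν) w 0 q)
          - (((((p₀ ^ h : ℕ) : ℝ) / L) ^ 3 * (A + s * (L * singSeries F m p₀ L ν)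
            * Real.log (((p₀ ^ h : ℕ) : ℝ) / L)) : ℝ) : ℂ)‖
          ≤ C * ((p₀ ^ (2 * h) : ℕ) : ℝ) ^ (5 / 4 + ε) := by
  set D := limDens F m L ν p₀ (L ^ 2) with hD
  have hL1 : (1 : ℝ) ≤ L := by exact_mod_cast hL
  have hp1 : (1 : ℝ) < p₀ := by exact_mod_cast hp₀.one_lt
  obtain ⟨A, hA, hbound⟩ : ∃ A : ℝ, (s = 0 → A = c₁ * (L * singSeries F m p₀ L ν)) ∧
      ∀ a : ℝ, 0 < a → a < 1 / 2 → ∃ C : ℝ, ∀ Q : ℝ, 0 < Q →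
        |D * (∑' q : ℕ, moebiusPart (normDens F m L ν p₀) q * levelAvg F m w (q / Q))
          - (A + s * (L * singSeries F m p₀ L ν) * Real.log Q)| ≤ C * Q ^ (-a) := by
    -- if the density to the modulus `L ^ 2` is zero, so are the singular series and all the terms
    by_cases hD0 : D = 0
    · refine ⟨0, fun _ => ?_, fun a _ _ => ⟨0, fun Q _ => ?_⟩⟩
      · rw [singSeries_eq_zero hm hL hp₀ hp₀L hD0]
        ring
      · rw [singSeries_eq_zero hm hL hp₀ hp₀L hD0, hD0]
        simp
    · obtain ⟨A, hA, hb⟩ := exists_sum_asymp (localFactors hF hm hL hp₀ hp₀L hD0)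
        (χ := chi F m) chiDiv_apply hJ hR
      have hS := limDens_mul_tsum_quotPart hF hm hL hp₀ hp₀L hD0
      refine ⟨D * A, fun hs => ?_, fun a ha ha2 => ?_⟩
      · rw [hA hs, ← hS]
        ring
      · obtain ⟨C, hC⟩ := hb a ha ha2
        refine ⟨|D| * C, fun Q hQ => ?_⟩
        have := mul_le_mul_of_nonneg_left (hC Q hQ) (abs_nonneg D)
        rw [← abs_mul] at this
        rw [← hS]
        refine le_trans (le_of_eq ?_) (this.trans (le_of_eq (by ring)))
        congr 1
        ring
  refine ⟨A, hA, fun ε hε => ?_⟩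
  set δ := min ε (1 / 8) with hδ
  have hδ0 : 0 < δ := lt_min hε (by norm_num)
  have hδ1 : δ ≤ 1 / 8 := min_le_right _ _
  -- the exponent `1 / 2 - 2 δ` in `Q` leaves `P ^ (5 / 2 + 2 δ)`, and `P = N ^ (1 / 2)`
  obtain ⟨C, hC⟩ := hbound (1 / 2 - 2 * δ) (by linarith) (by linarith)
  -- the finitely many `h` for which `p₀ ^ h` is too small go into the constant
  obtain ⟨h₀, hh₀⟩ : ∃ h₀ : ℕ, c < (p₀ : ℝ) ^ h₀ := pow_unbounded_of_one_lt c hp1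
  set E : ℕ → ℝ := fun h =>
    ‖(∑' q : ℕ+, deltaTerm F m L (p₀ ^ (2 * h)) ((p₀ : ℤ) ^ h • ν) w 0 q)
      - (((((p₀ ^ h : ℕ) : ℝ) / L) ^ 3 * (A + s * (L * singSeries F m p₀ L ν)
        * Real.log (((p₀ ^ h : ℕ) : ℝ) / L)) : ℝ) : ℂ)‖ with hE
  refine ⟨|C| + ∑ h ∈ Finset.range h₀, E h, fun h => ?_⟩
  change E h ≤ _
  have hN1 : (1 : ℝ) ≤ ((p₀ ^ (2 * h) : ℕ) : ℝ) := by exact_mod_cast Nat.one_le_pow _ _ hp₀.pos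
  have hE0 : ∀ h, 0 ≤ E h := fun h => norm_nonneg _
  have hsum0 : 0 ≤ ∑ h ∈ Finset.range h₀, E h := Finset.sum_nonneg fun h _ => hE0 h
  rcases lt_or_ge h h₀ with hlt | hge
  · have h1 : E h ≤ ∑ h ∈ Finset.range h₀, E h :=
      Finset.single_le_sum (fun h _ => hE0 h) (Finset.mem_range.2 hlt)
    have h2 : (1 : ℝ) ≤ ((p₀ ^ (2 * h) : ℕ) : ℝ) ^ (5 / 4 + ε) := Real.one_le_rpow hN1 (by linarith)
    calc E h ≤ |C| + ∑ h ∈ Finset.range h₀, E h := by linarith [abs_nonneg C]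
      _ ≤ _ := le_mul_of_one_le_right (by positivity) h2
  · have hc : c ≤ ((p₀ ^ h : ℕ) : ℝ) := by
      push_cast
      exact hh₀.le.trans (pow_le_pow_right₀ hp1.le hge)
    have hP1 : (1 : ℝ) ≤ ((p₀ ^ h : ℕ) : ℝ) := by exact_mod_cast Nat.one_le_pow _ _ hp₀.pos
    set P : ℝ := ((p₀ ^ h : ℕ) : ℝ) with hP
    have hQ : 0 < P / L := by positivity
    have hNP : ((p₀ ^ (2 * h) : ℕ) : ℝ) = P ^ (2 : ℝ) := by
      rw [hP, Real.rpow_two]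
      push_cast
      rw [← pow_mul, mul_comm]
    have h1 : E h = (P / L) ^ 3 * |D * (∑' q : ℕ, moebiusPart (normDens F m L ν p₀) q
        * levelAvg F m w (q / (P / L)))
          - (A + s * (L * singSeries F m p₀ L ν) * Real.log (P / L))| := by
      simp only [hE]
      rw [(hasSum_deltaTerm hL hp₀ hJ h).tsum_eq, ← Complex.ofReal_sub, Complex.norm_real,
        Real.norm_eq_abs, ← mul_sub, abs_mul, abs_of_pos (by positivity)]
      congr 3
      rw [← tsum_mul_left]
      exact tsum_congr fun q => termCoeff_mul_levelAvg hL hp₀ hp₀L hJ hc q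
    rw [h1]
    calc (P / L) ^ 3 * _ ≤ (P / L) ^ 3 * (C * (P / L) ^ (-(1 / 2 - 2 * δ))) := by
          gcongr
          exact hC _ hQ
      _ ≤ (P / L) ^ 3 * (|C| * (P / L) ^ (-(1 / 2 - 2 * δ))) := by
          gcongr
          exact le_abs_self C
      _ = |C| * (P / L) ^ (5 / 2 + 2 * δ) := by
          rw [show (5 : ℝ) / 2 + 2 * δ = (3 : ℕ) + -(1 / 2 - 2 * δ) by push_cast; ring,
            Real.rpow_add hQ, Real.rpow_natCast]
          ring
      _ ≤ |C| * P ^ (5 / 2 + 2 * δ) := by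
          gcongr
          exact div_le_self (by positivity) hL1
      _ ≤ |C| * ((p₀ ^ (2 * h) : ℕ) : ℝ) ^ (5 / 4 + ε) := by
          rw [hNP, ← Real.rpow_mul (by positivity)]
          gcongr
          linarith [min_le_left ε (1 / 8)]
      _ ≤ _ := by
          gcongr
          linarith

end

end Ternary

end

theorem mainTheorem7
    (F : QuadraticForm ℤ (Fin 3 → ℤ)) (hF : Ternary.discr F ≠ 0)
    (m₀ : ℤ) (hm₀ : m₀ ≠ 0)
    (p₀ : ℕ) (hp₀ : p₀.Prime)
    (L : ℕ) (hL : 0 < L) (hp₀L : ¬ p₀ ∣ L)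
    (lam : Fin 3 → ℤ) (hlam : F lam ≡ m₀ [ZMOD (L : ℤ)])
    (w : (Fin 3 → ℝ) → ℝ) (hw : ContDiff ℝ ∞ w) (hwc : HasCompactSupport w) :
    -- the local densities, the Euler product and the singular integral converge
    (∀ p : ℕ, p.Prime → p ≠ p₀ →
      ∃ l : ℝ, Tendsto (fun k : ℕ => Ternary.localCount F m₀ L lam p k) atTop (𝓝 l)) ∧
    (∃ l : ℝ, Tendsto (fun k : ℕ => Ternary.localCount F 0 1 0 p₀ k) atTop (𝓝 l)) ∧
    (Multipliable fun p : {p : ℕ // p.Prime ∧ p ≠ p₀} => Ternary.eulerFactor F m₀ L lam p) ∧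
    Integrable (Ternary.singIntInner F m₀ w) ∧
    -- the sum over `q` converges
    (∀ h : ℕ, Summable fun q : ℕ+ =>
      Ternary.deltaTerm F m₀ L (p₀ ^ (2 * h)) ((p₀ : ℤ) ^ h • lam) w 0 q) ∧
    -- the asymptotic formula when `-m₀ Δ_F` is a square
    (IsSquare (-(m₀ : ℚ) * Ternary.discr F) →
      ∃ a₀ : ℂ, ∀ ε : ℝ, 0 < ε → ∃ C : ℝ, ∀ h N : ℕ, N = p₀ ^ (2 * h) →
        ‖(∑' q : ℕ+, Ternary.deltaTerm F m₀ L N ((p₀ : ℤ) ^ h • lam) w 0 q)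
            - ((√(N : ℝ) / (L : ℝ) ^ 2 : ℝ) : ℂ) ^ 3
              * (Ternary.singInt F m₀ w * (L : ℂ) ^ 4 * (Ternary.singSeries F m₀ p₀ L lam : ℂ)
                  * (Real.log √(N : ℝ) : ℂ) + a₀)‖
          ≤ C * (N : ℝ) ^ (5 / 4 + ε)) ∧
    -- the asymptotic formula when `-m₀ Δ_F` is not a square
    (¬ IsSquare (-(m₀ : ℚ) * Ternary.discr F) →
      (∃ l : ℝ, Tendsto (fun X : ℕ => Ternary.lPartial F m₀ X) atTop (𝓝 l)) ∧
      ∀ ε : ℝ, 0 < ε → ∃ C : ℝ, ∀ h N : ℕ, N = p₀ ^ (2 * h) →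
        ‖(∑' q : ℕ+, Ternary.deltaTerm F m₀ L N ((p₀ : ℤ) ^ h • lam) w 0 q)
            - ((√(N : ℝ) / (L : ℝ) ^ 2 : ℝ) : ℂ) ^ 3
              * (Ternary.singInt F m₀ w * (L : ℂ) ^ 4 * (Ternary.lOne F m₀ : ℂ)
                  * (Ternary.singSeries F m₀ p₀ L lam : ℂ))‖
          ≤ C * (N : ℝ) ^ (5 / 4 + ε)) := by
  obtain ⟨σ, c, Λ, hσ, h1, h2, h3, h4, h5⟩ := Ternary.levelAvg_lipschitz hF hm₀ hw hwc
  have hJ : Ternary.Weight (Ternary.levelAvg F m₀ w) σ c Λ := ⟨h1, h2, h3, h4, h5⟩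
  have hL0 : (L : ℝ) ≠ 0 := by exact_mod_cast hL.ne'
  have hsqrt : ∀ h : ℕ, √((p₀ ^ (2 * h) : ℕ) : ℝ) = ((p₀ ^ h : ℕ) : ℝ) := by
    intro h
    rw [mul_comm, pow_mul]
    push_cast
    exact Real.sqrt_sq (by positivity)
  refine ⟨fun p hp _ => ⟨_, Ternary.tendsto_localCount hp hm₀⟩,
    ⟨_, Ternary.tendsto_localCount_cone hF hp₀⟩, Ternary.multipliable_eulerFactor hF hm₀ hL hp₀,
    Ternary.integrable_singIntInner hF m₀ hw hwc,
    fun h => (Ternary.hasSum_deltaTerm hL hp₀ hJ h).summable, fun hs => ?_, fun hs => ?_⟩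
  · have hχ : ∀ n : ℕ, n ≠ 0 → Ternary.chi F m₀ n = 1 := by
      intro n hn
      rw [Ternary.chi, if_neg hn, if_pos hs]
    obtain ⟨c₁, C₀, hC₀⟩ := Ternary.harmSum_principal hJ hχ
    obtain ⟨A, -, hA⟩ := Ternary.exists_sum_deltaTerm_asymp (ν := lam) hF hm₀ hL hp₀ hp₀L hJ
      (fun a ha ha2 => Ternary.harmSum_global hJ Ternary.abs_chi_le hC₀ ha ha2)
    refine ⟨((L : ℝ) ^ 3 * (A - σ * (L * Ternary.singSeries F m₀ p₀ L lam) * Real.log L) : ℝ),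
      fun ε hε => ?_⟩
    obtain ⟨C, hC⟩ := hA ε hε
    refine ⟨C, fun h N hN => ?_⟩
    subst hN
    have hP0 : ((p₀ ^ h : ℕ) : ℝ) ≠ 0 := by exact_mod_cast (pow_pos hp₀.pos h).ne'
    refine le_trans (le_of_eq ?_) (hC h)
    congr 2
    rw [hσ, hsqrt, Real.log_div hP0 hL0]
    have hL0' : (L : ℂ) ≠ 0 := by exact_mod_cast hL.ne'
    push_cast
    field_simp
    ring
  · obtain ⟨hlim, B, hB, hl⟩ := Ternary.lOne_spec hF hm₀ hs
    refine ⟨⟨_, hlim⟩, fun ε hε => ?_⟩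
    obtain ⟨C₀, hC₀⟩ := Ternary.harmSum_nonprincipal hJ Ternary.abs_chi_le hB hl
    obtain ⟨A, hA0, hA⟩ := Ternary.exists_sum_deltaTerm_asymp (ν := lam) (s := 0)
      (c₁ := σ * Ternary.lOne F m₀) hF hm₀ hL hp₀ hp₀L hJ
      (fun a ha ha2 => Ternary.harmSum_global hJ Ternary.abs_chi_le
        (fun y hy hy1 => by rw [zero_mul, sub_zero]; exact hC₀ y hy hy1) ha ha2)
    obtain ⟨C, hC⟩ := hA ε hε
    refine ⟨C, fun h N hN => ?_⟩
    subst hN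
    refine le_trans (le_of_eq ?_) (hC h)
    congr 2
    rw [hσ, hsqrt, hA0 rfl]
    have hL0' : (L : ℂ) ≠ 0 := by exact_mod_cast hL.ne'
    push_cast
    field_simp
    ring
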